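/- Let $\sigma>1>\tau>0$, $\alpha>0$ with $\alpha^2=\pi^2/2$, and $0<\eta<\eta_c:=\frac{27}{4}\pi^4\tau^2(1+\sigma^{-1})(1-\tau)^{-1}$; put $\lambda_c:=\frac{\eta}{\tau}+\frac{27}{4}\pi^4$. **Setting.** Let $\Omega=\mathbb R\times(0,1)$ with coordinates $(x,z)$; all functions are $2\pi/\alpha$-periodic in $x$, and integrals and $L^2$-norms are taken over one period cell. Let $H$ be the real Hilbert space of $\psi=(u,w,T,S)\in L^2(\Omega)^4$ with $\partial_xu+\partial_zw=0$, $w=0$ at $z=0,1$ (in the weak sense) and $\int u=0$. Let $P$ be the orthogonal projection of $L^2(\Omega)^4$ onto $H$ (the Leray projection on $(u,w)$, the identity on $T,S$), and let $$L_{\lambda\eta}\psi=P\big(\sigma\Delta u,\ \sigma\Delta w+\sigma(\lambda T-\eta S),\ \Delta T+w,\ \tau\Delta S+w\big)$$ be the unbounded operator in $H$ with domain $H_1=\{\psi\in H\cap H^2(\Omega)^4: w=T=S=\partial_zu=0\text{ at }z=0,1\}$. Spectral notions refer to its complexification. For $j\in\mathbb Z$, $l\in\mathbb N=\{1,2,\dots\}$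 put $\gamma_{jl}^2=j^2\alpha^2+l^2\pi^2$ and $$f_{jl}(\beta)=\beta^3+(\sigma+\tau+1)\gamma_{jl}^2\beta^2+\big[(\sigma+\tau+\sigma\tau)\gamma_{jl}^4-\sigma j^2\alpha^2\gamma_{jl}^{-2}(\lambda-\eta)\big]\beta+\sigma\tau\gamma_{jl}^6+\sigma j^2\alpha^2(\eta-\tau\lambda).$$ The Fourier block $E_{0l}$ is the span of $(0,0,\sin l\pi z,0)$, $(0,0,0,\sin l\pi z)$, $(\cos l\pi z,0,0,0)$. For $j\neq0$ the block $E_{jl}$ is the span of the six fields $$\big(\tfrac{l\pi}{j\alpha}\cos j\alpha x\cos l\pi z,\ \sin j\alpha x\sin l\pi z,\ 0,\ 0\big),\quad \big(-\tfrac{l\pi}{j\alpha}\sin j\alpha x\cos l\pi z,\ \cos j\alpha x\sin l\pi z,\ 0,\ 0\big),$$ $$(0,0,g\sin l\pi z,0),\quad (0,0,0,g\sin l\pi z),\qquad g\in\{\sin j\alpha x,\ \cos j\alpha x\}.$$ A *root vector at* $(j,l)$ is the real or imaginary part of a complex field $\psi$ in the complexification of $H$ with wave numbers $(j,l)$ such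 that $(L_{\lambda\eta}-\beta)^k\psi=0$ for some $k\in\mathbb N$ and some zero $\beta$ of $f_{jl}$; here $\psi$ has wave numbers $(j,l)$ if $u$ is a combination of $\cos j\alpha x\cos l\pi z$, $\sin j\alpha x\cos l\pi z$, and $w,T,S$ are combinations of $\cos j\alpha x\sin l\pi z$, $\sin j\alpha x\sin l\pi z$. Let $E_{f_{jl}}$ be the real span of the root vectors at $(j,l)$. **Theorem.** There is $\delta>0$ (depending on $\sigma,\tau,\eta$) such that for every $\lambda$ with $|\lambda-\lambda_c|<\delta$: 1. $E_{f_{jl}}=E_{jl}$ for all $j\in\mathbb Z$, $l\in\mathbb N$. 2. These vectors together give a basis of $H$: one can choose root vectors at all $(j,l)$ with $j\ge0$, $l\ge1$ (three for $j=0$, six for $j\ge1$) such that every $\psi\in H$ has a unique expansion in them as an unconditionally convergent series in $H$. 3. Every $E_{jl}$ is contained in $H_1$ and invariant under $L_{\lambda\eta}$. If $\lambda<\lambda_c$, then for all $j\in\mathbb Z$, $l\in\mathbb N$ the restriction of $L_{\lambda\eta}$ to $E_{jl}$ is strictly negative definite in the following sense: all its (complex) eigenvalues have negative real part, and there is an inner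 product $Q$ on $E_{jl}$ with $Q(L_{\lambda\eta}x,x)<0$ for all $0\neq x\in E_{jl}$. 4. $-L_{\lambda\eta}$ is a sectorial operator in the complexification of $H$: it is closed and densely defined, and there are $a\in\mathbb R$, $\varphi\in(0,\pi/2)$, $M\ge1$ such that every $z\ne a$ with $\varphi\le|\arg(z-a)|\le\pi$ lies in its resolvent set and $\|(z+L_{\lambda\eta})^{-1}\|\le M/|z-a|$. -/

import Mathlib

open MeasureTheory Set Filter Topology
open scoped ContDiff ENNReal

noncomputable section

namespace DoubleDiffusive

/-! ### The periodicity cell, `L²` and weak derivatives -/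

/-- Lebesgue measure on the cell `(0, 2π/α) × (0,1)`, coordinates `(x,z)`. Functions on the strip
`ℝ × (0,1)` that are `2π/α`-periodic in `x` are identified with functions on this cell. -/
def cellMeasure (α : ℝ) : Measure (ℝ × ℝ) :=
  volume.restrict (Ioo 0 (2 * Real.pi / α) ×ˢ Ioo 0 1)

instance (α : ℝ) : IsFiniteMeasure (cellMeasure α) := by
  constructor
  rw [cellMeasure, Measure.restrict_apply_univ, Measure.volume_eq_prod, Measure.prod_prod]
  simp [Real.volume_Ioo]

/-- Scalar `L²` functions on the cell, with values in `𝕜 = ℝ` or `ℂ`. -/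
abbrev ScalarL2 (𝕜 : Type) [RCLike 𝕜] (α : ℝ) : Type := Lp 𝕜 2 (cellMeasure α)

/-- `L²(Ω)⁴` with its Hilbert space structure; the components `0,1,2,3` are `u, w, T, S`. -/
abbrev Fields (𝕜 : Type) [RCLike 𝕜] (α : ℝ) : Type := PiLp 2 (fun _ : Fin 4 => ScalarL2 𝕜 α)

/-- Test functions: smooth on the plane, `2π/α`-periodic in `x`, unrestricted at `z = 0,1`. -/
def IsTest (α : ℝ) (φ : ℝ × ℝ → ℝ) : Prop :=
  ContDiff ℝ ∞ φ ∧ ∀ x z, φ (x + 2 * Real.pi / α, z) = φ (x, z)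

/-- Test functions that vanish near the walls `z = 0` and `z = 1`. -/
def IsInteriorTest (α : ℝ) (φ : ℝ × ℝ → ℝ) : Prop :=
  IsTest α φ ∧ ∃ ε > 0, ∀ x z, (z < ε ∨ 1 - ε < z) → φ (x, z) = 0

/-- The directions of the `x`- and the `z`-derivative. -/
def ex : ℝ × ℝ := (1, 0)
/-- See `ex`. -/
def ez : ℝ × ℝ := (0, 1)

/-- The integral `∫ c f` over the cell. -/
def pair {𝕜 : Type} [RCLike 𝕜] {α : ℝ} (c : ℝ × ℝ → ℝ) (f : ScalarL2 𝕜 α) : 𝕜 :=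
  ∫ p, c p • f p ∂(cellMeasure α)

/-- The derivative of a test function in the direction `e`. -/
def dir (e : ℝ × ℝ) (φ : ℝ × ℝ → ℝ) (p : ℝ × ℝ) : ℝ := fderiv ℝ φ p e

section pairing

variable {𝕜 : Type} [RCLike 𝕜] {α : ℝ}

theorem IsTest.continuous {φ : ℝ × ℝ → ℝ} (h : IsTest α φ) : Continuous φ := h.1.continuous

theorem IsTest.continuous_dir {φ : ℝ × ℝ → ℝ} (h : IsTest α φ) (e : ℝ × ℝ) :
    Continuous (dir e φ) := by
  have := h.1.continuous_fderiv (by simp)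
  exact this.clm_apply continuous_const

theorem exists_bound {c : ℝ × ℝ → ℝ} (hc : Continuous c) :
    ∃ C : ℝ, ∀ᵐ p ∂(cellMeasure α), ‖c p‖ ≤ C := by
  have hK : IsCompact (Icc (0 : ℝ) (2 * Real.pi / α) ×ˢ Icc (0 : ℝ) 1) :=
    isCompact_Icc.prod isCompact_Icc
  obtain ⟨C, hC⟩ := hK.exists_bound_of_continuousOn hc.continuousOn
  refine ⟨C, ?_⟩
  rw [cellMeasure]
  filter_upwards [ae_restrict_mem (measurableSet_Ioo.prod measurableSet_Ioo)] with p hp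
  exact hC p ⟨Ioo_subset_Icc_self hp.1, Ioo_subset_Icc_self hp.2⟩

theorem integrable_pair {c : ℝ × ℝ → ℝ} (hc : Continuous c) (f : ScalarL2 𝕜 α) :
    Integrable (fun p => c p • f p) (cellMeasure α) := by
  obtain ⟨C, hC⟩ := exists_bound (α := α) hc
  have hf : Integrable f (cellMeasure α) := (Lp.memLp f).integrable (by norm_num)
  exact hf.bdd_smul C hc.aestronglyMeasurable hC

theorem pair_zero (c : ℝ × ℝ → ℝ) : pair c (0 : ScalarL2 𝕜 α) = 0 := by
  rw [pair]
  have : (fun p => c p • (0 : ScalarL2 𝕜 α) p) =ᵐ[cellMeasure α] fun _ => (0 : 𝕜) := by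
    filter_upwards [Lp.coeFn_zero 𝕜 2 (cellMeasure α)] with p hp
    rw [hp, Pi.zero_apply, smul_zero]
  rw [integral_congr_ae this, integral_zero]

theorem pair_add {c : ℝ × ℝ → ℝ} (hc : Continuous c) (f g : ScalarL2 𝕜 α) :
    pair c (f + g) = pair c f + pair c g := by
  rw [pair, pair, pair, ← integral_add (integrable_pair hc f) (integrable_pair hc g)]
  refine integral_congr_ae ?_
  filter_upwards [Lp.coeFn_add f g] with p hp
  rw [hp, Pi.add_apply, smul_add]

theorem pair_smul (c : ℝ × ℝ → ℝ) (a : 𝕜) (f : ScalarL2 𝕜 α) :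
    pair c (a • f) = a * pair c f := by
  rw [pair, pair, ← integral_const_mul]
  refine integral_congr_ae ?_
  filter_upwards [Lp.coeFn_smul a f] with p hp
  simp [hp]

theorem norm_pair_le {c : ℝ × ℝ → ℝ} (hc : Continuous c) :
    ∃ C : ℝ, ∀ f : ScalarL2 𝕜 α, ‖pair c f‖ ≤ C * ‖f‖ := by
  obtain ⟨C, hC⟩ := exists_bound (α := α) hc
  have hm : MemLp (fun p => (c p : 𝕜)) 2 (cellMeasure α) :=
    MemLp.of_bound (RCLike.continuous_ofReal.comp hc).aestronglyMeasurable C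
      (by filter_upwards [hC] with p hp; simpa using hp)
  refine ⟨‖hm.toLp _‖, fun f => ?_⟩
  have : pair c f = inner 𝕜 (hm.toLp _) f := by
    rw [L2.inner_def, pair]
    refine integral_congr_ae ?_
    filter_upwards [hm.coeFn_toLp] with p hp
    simp [hp, RCLike.real_smul_eq_coe_mul, mul_comm]
  rw [this]
  exact norm_inner_le_norm _ _

theorem continuous_pair {c : ℝ × ℝ → ℝ} (hc : Continuous c) :
    Continuous (pair c : ScalarL2 𝕜 α → 𝕜) := by
  obtain ⟨C, hC⟩ := norm_pair_le (𝕜 := 𝕜) (α := α) hc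
  let P : ScalarL2 𝕜 α →ₗ[𝕜] 𝕜 :=
    { toFun := pair c, map_add' := pair_add hc, map_smul' := fun a f => by simp [pair_smul] }
  exact (P.mkContinuous C hC).continuous

end pairing

/-- `WeakDeriv e f g`: `g` is the weak derivative of `f` in the direction `e` on `Ω`. -/
def WeakDeriv {𝕜 : Type} [RCLike 𝕜] {α : ℝ} (e : ℝ × ℝ) (f g : ScalarL2 𝕜 α) : Prop :=
  ∀ φ, IsInteriorTest α φ → pair (dir e φ) f = -pair φ g

/-- `ZeroTraceDeriv f g`: `g` is the weak `z`-derivative of `f` and `f` has zero trace at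
`z = 0,1` (integration by parts in `z` has no boundary terms, for all test functions up to the
walls). -/
def ZeroTraceDeriv {𝕜 : Type} [RCLike 𝕜] {α : ℝ} (f g : ScalarL2 𝕜 α) : Prop :=
  ∀ φ, IsTest α φ → pair (dir ez φ) f = -pair φ g

/-! ### The phase space `H` and the linearized operator -/

/-- `H`: fields `(u,w,T,S)` in `L²(Ω)⁴` with `div (u,w) = 0`, `w = 0` at `z = 0,1` (both in the
weak sense: `(u,w)` is orthogonal to all gradients), and `∫ u = 0`. -/
def H (𝕜 : Type) [RCLike 𝕜] (α : ℝ) : Submodule 𝕜 (Fields 𝕜 α) where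
  carrier := {ψ | (∀ φ, IsTest α φ → pair (dir ex φ) (ψ 0) + pair (dir ez φ) (ψ 1) = 0) ∧
    pair (fun _ => 1) (ψ 0) = 0}
  zero_mem' := by simp [pair_zero]
  add_mem' := by
    rintro ψ χ ⟨h1, h2⟩ ⟨h3, h4⟩
    refine ⟨fun φ hφ => ?_, ?_⟩
    · rw [PiLp.add_apply, PiLp.add_apply, pair_add (hφ.continuous_dir _),
        pair_add (hφ.continuous_dir _)]
      linear_combination h1 φ hφ + h3 φ hφ
    · rw [PiLp.add_apply, pair_add continuous_const, h2, h4, add_zero]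
  smul_mem' := by
    rintro a ψ ⟨h1, h2⟩
    refine ⟨fun φ hφ => ?_, ?_⟩
    · rw [PiLp.smul_apply, PiLp.smul_apply, pair_smul, pair_smul]
      linear_combination a * h1 φ hφ
    · rw [PiLp.smul_apply, pair_smul, h2, mul_zero]

theorem isClosed_H (𝕜 : Type) [RCLike 𝕜] (α : ℝ) : IsClosed (H 𝕜 α : Set (Fields 𝕜 α)) := by
  have h : (H 𝕜 α : Set (Fields 𝕜 α)) =
      (⋂ φ, ⋂ (_ : IsTest α φ),
        {ψ | pair (dir ex φ) (ψ 0) + pair (dir ez φ) (ψ 1) = 0}) ∩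
      {ψ | pair (fun _ => 1) (ψ 0) = 0} := by
    ext ψ
    simp [H]
  have c0 : ∀ i : Fin 4, Continuous fun ψ : Fields 𝕜 α => ψ i :=
    fun i => PiLp.continuous_apply 2 _ i
  rw [h]
  refine IsClosed.inter (isClosed_iInter fun φ => isClosed_iInter fun hφ => ?_) ?_
  · exact isClosed_eq (((continuous_pair (hφ.continuous_dir _)).comp (c0 0)).add
      ((continuous_pair (hφ.continuous_dir _)).comp (c0 1))) continuous_const
  · exact isClosed_eq ((continuous_pair continuous_const).comp (c0 0)) continuous_const

instance (𝕜 : Type) [RCLike 𝕜] (α : ℝ) : CompleteSpace (H 𝕜 α) :=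
  (isClosed_H 𝕜 α).completeSpace_coe

/-- The unprojected right-hand side of the linearized equations, as a function of the field
`ψ = (u,w,T,S)` and of its componentwise Laplacian `Δψ`:
`(σ Δu, σ Δw + σ (lam T - η S), ΔT + w, τ ΔS + w)`. -/
def rhs {𝕜 : Type} [RCLike 𝕜] {α : ℝ} (σ τ η lam : ℝ) (ψ lap : Fields 𝕜 α) : Fields 𝕜 α :=
  WithLp.toLp 2 ![(σ : 𝕜) • lap 0,
    (σ : 𝕜) • lap 1 + (σ : 𝕜) • ((lam : 𝕜) • ψ 2 - (η : 𝕜) • ψ 3),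
    lap 2 + ψ 1,
    (τ : 𝕜) • lap 3 + ψ 1]

/-- `ψ` lies in `H²(Ω)` with weak derivatives `ψx, ψz, ψxx, ψxz, ψzz`, and it satisfies the
free-free boundary conditions `w = T = S = 0` and `∂u/∂z = 0` at `z = 0,1`. -/
structure IsRegular {𝕜 : Type} [RCLike 𝕜] {α : ℝ} (ψ ψx ψz ψxx ψxz ψzz : Fields 𝕜 α) :
    Prop where
  dx : ∀ i, WeakDeriv ex (ψ i) (ψx i)
  dz : ∀ i, WeakDeriv ez (ψ i) (ψz i)
  dxx : ∀ i, WeakDeriv ex (ψx i) (ψxx i)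
  dxz : ∀ i, WeakDeriv ez (ψx i) (ψxz i)
  dzz : ∀ i, WeakDeriv ez (ψz i) (ψzz i)
  w_zero : ZeroTraceDeriv (ψ 1) (ψz 1)
  T_zero : ZeroTraceDeriv (ψ 2) (ψz 2)
  S_zero : ZeroTraceDeriv (ψ 3) (ψz 3)
  uz_zero : ZeroTraceDeriv (ψz 0) (ψzz 0)

section linearity

variable {𝕜 : Type} [RCLike 𝕜] {α : ℝ}

theorem WeakDeriv.zero (e : ℝ × ℝ) : WeakDeriv e (0 : ScalarL2 𝕜 α) 0 := fun φ _ => by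
  simp [pair_zero]

theorem WeakDeriv.add {e : ℝ × ℝ} {f g f' g' : ScalarL2 𝕜 α} (h : WeakDeriv e f g)
    (h' : WeakDeriv e f' g') : WeakDeriv e (f + f') (g + g') := fun φ hφ => by
  rw [pair_add (hφ.1.continuous_dir e), pair_add hφ.1.continuous, h φ hφ, h' φ hφ]; ring

theorem WeakDeriv.smul {e : ℝ × ℝ} {f g : ScalarL2 𝕜 α} (a : 𝕜) (h : WeakDeriv e f g) :
    WeakDeriv e (a • f) (a • g) := fun φ hφ => by
  rw [pair_smul, pair_smul, h φ hφ]; ring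

theorem ZeroTraceDeriv.zero : ZeroTraceDeriv (0 : ScalarL2 𝕜 α) 0 := fun φ _ => by
  simp [pair_zero]

theorem ZeroTraceDeriv.add {f g f' g' : ScalarL2 𝕜 α} (h : ZeroTraceDeriv f g)
    (h' : ZeroTraceDeriv f' g') : ZeroTraceDeriv (f + f') (g + g') := fun φ hφ => by
  rw [pair_add (hφ.continuous_dir ez), pair_add hφ.continuous, h φ hφ, h' φ hφ]; ring

theorem ZeroTraceDeriv.smul {f g : ScalarL2 𝕜 α} (a : 𝕜) (h : ZeroTraceDeriv f g) :
    ZeroTraceDeriv (a • f) (a • g) := fun φ hφ => by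
  rw [pair_smul, pair_smul, h φ hφ]; ring

theorem IsRegular.zero : IsRegular (0 : Fields 𝕜 α) 0 0 0 0 0 :=
  ⟨fun _ => .zero _, fun _ => .zero _, fun _ => .zero _, fun _ => .zero _, fun _ => .zero _,
    .zero, .zero, .zero, .zero⟩

theorem IsRegular.add {ψ a b c d e ψ' a' b' c' d' e' : Fields 𝕜 α}
    (h : IsRegular ψ a b c d e) (h' : IsRegular ψ' a' b' c' d' e') :
    IsRegular (ψ + ψ') (a + a') (b + b') (c + c') (d + d') (e + e') :=
  ⟨fun i => (h.dx i).add (h'.dx i), fun i => (h.dz i).add (h'.dz i),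
    fun i => (h.dxx i).add (h'.dxx i), fun i => (h.dxz i).add (h'.dxz i),
    fun i => (h.dzz i).add (h'.dzz i), h.w_zero.add h'.w_zero, h.T_zero.add h'.T_zero,
    h.S_zero.add h'.S_zero, h.uz_zero.add h'.uz_zero⟩

theorem IsRegular.smul {ψ a b c d e : Fields 𝕜 α} (r : 𝕜) (h : IsRegular ψ a b c d e) :
    IsRegular (r • ψ) (r • a) (r • b) (r • c) (r • d) (r • e) :=
  ⟨fun i => (h.dx i).smul r, fun i => (h.dz i).smul r,
    fun i => (h.dxx i).smul r, fun i => (h.dxz i).smul r,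
    fun i => (h.dzz i).smul r, h.w_zero.smul r, h.T_zero.smul r,
    h.S_zero.smul r, h.uz_zero.smul r⟩

theorem rhs_zero (σ τ η lam : ℝ) : rhs σ τ η lam (0 : Fields 𝕜 α) 0 = 0 := by
  ext1 i
  fin_cases i <;> simp [rhs]

theorem rhs_add (σ τ η lam : ℝ) (ψ ψ' d d' : Fields 𝕜 α) :
    rhs σ τ η lam (ψ + ψ') (d + d') = rhs σ τ η lam ψ d + rhs σ τ η lam ψ' d' := by
  ext1 i
  fin_cases i <;> simp [rhs] <;> module

theorem rhs_smul (σ τ η lam : ℝ) (r : 𝕜) (ψ d : Fields 𝕜 α) :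
    rhs σ τ η lam (r • ψ) (r • d) = r • rhs σ τ η lam ψ d := by
  ext1 i
  fin_cases i <;> simp [rhs] <;> module

end linearity

/-- The graph of `L = -A - B`: pairs `(ψ, F)` with `ψ ∈ H` regular and
`F = P (σ Δu, σ Δw + σ (lam T - η S), ΔT + w, τ ΔS + w)`, where `P` is the orthogonal projection
of `L²(Ω)⁴` onto `H` (the Leray projection on the velocity, the identity on `T` and `S`). -/
def opGraph (𝕜 : Type) [RCLike 𝕜] (α σ τ η lam : ℝ) : Submodule 𝕜 (H 𝕜 α × H 𝕜 α) where
  carrier := {q | ∃ ψx ψz ψxx ψxz ψzz : Fields 𝕜 α,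
    IsRegular (q.1 : Fields 𝕜 α) ψx ψz ψxx ψxz ψzz ∧
    q.2 = (H 𝕜 α).orthogonalProjectionOnto (rhs σ τ η lam (q.1 : Fields 𝕜 α) (ψxx + ψzz))}
  zero_mem' := ⟨0, 0, 0, 0, 0, IsRegular.zero, by
    rw [add_zero, Prod.fst_zero, Submodule.coe_zero, rhs_zero, map_zero, Prod.snd_zero]⟩
  add_mem' := by
    rintro p q ⟨a, b, c, d, e, h, h1⟩ ⟨a', b', c', d', e', h', h1'⟩
    refine ⟨_, _, _, _, _, h.add h', ?_⟩
    rw [Prod.snd_add, h1, h1', ← map_add, ← rhs_add, add_add_add_comm, Prod.fst_add,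
      Submodule.coe_add]
  smul_mem' := by
    rintro r p ⟨a, b, c, d, e, h, h1⟩
    refine ⟨_, _, _, _, _, h.smul r, ?_⟩
    rw [Prod.smul_snd, h1, ← map_smul, ← rhs_smul, smul_add, Prod.smul_fst, Submodule.coe_smul]

/-- The linearized operator `L`, an unbounded operator in `H` with domain `H₁`. -/
def L (𝕜 : Type) [RCLike 𝕜] (α σ τ η lam : ℝ) : H 𝕜 α →ₗ.[𝕜] H 𝕜 α :=
  (opGraph 𝕜 α σ τ η lam).toLinearPMap

/-! ### Fourier blocks -/

/-- The subspace of `H` of all linear combinations of the given (real) vector fields. -/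
def fieldSpan (𝕜 : Type) [RCLike 𝕜] (α : ℝ) {n : ℕ} (v : Fin n → ℝ × ℝ → Fin 4 → ℝ) :
    Submodule 𝕜 (H 𝕜 α) where
  carrier := {ψ | ∃ c : Fin n → 𝕜, ∀ i : Fin 4,
    ((ψ : Fields 𝕜 α) i : ℝ × ℝ → 𝕜) =ᵐ[cellMeasure α] fun p => ∑ k, c k * (v k p i : 𝕜)}
  zero_mem' := by
    refine ⟨0, fun i => ?_⟩
    filter_upwards [Lp.coeFn_zero 𝕜 2 (cellMeasure α)] with p hp
    simpa using hp
  add_mem' := by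
    rintro ψ χ ⟨c, hc⟩ ⟨d, hd⟩
    refine ⟨c + d, fun i => ?_⟩
    filter_upwards [hc i, hd i,
      Lp.coeFn_add ((ψ : Fields 𝕜 α) i) ((χ : Fields 𝕜 α) i)] with p h1 h2 h3
    rw [Submodule.coe_add, PiLp.add_apply, h3, Pi.add_apply, h1, h2, ← Finset.sum_add_distrib]
    simp [add_mul]
  smul_mem' := by
    rintro a ψ ⟨c, hc⟩
    refine ⟨a • c, fun i => ?_⟩
    filter_upwards [hc i, Lp.coeFn_smul a ((ψ : Fields 𝕜 α) i)] with p h1 h3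
    rw [Submodule.coe_smul, PiLp.smul_apply, h3, Pi.smul_apply, h1, Finset.smul_sum]
    simp [mul_assoc]

/-- For `j = 0`: the vector fields `(0,0,sin lπz,0)`, `(0,0,0,sin lπz)`, `(cos lπz,0,0,0)`. -/
def zeroModes (l : ℕ) : Fin 3 → ℝ × ℝ → Fin 4 → ℝ :=
  ![fun p => ![0, 0, Real.sin (l * Real.pi * p.2), 0],
    fun p => ![0, 0, 0, Real.sin (l * Real.pi * p.2)],
    fun p => ![Real.cos (l * Real.pi * p.2), 0, 0, 0]]

/-- For `j ≠ 0`: the six vector fields `φ¹, …, φ⁶` with wave numbers `(j,l)`. -/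
def modes (α : ℝ) (j : ℤ) (l : ℕ) : Fin 6 → ℝ × ℝ → Fin 4 → ℝ :=
  ![fun p => ![l * Real.pi / (j * α) * (Real.cos (j * α * p.1) * Real.cos (l * Real.pi * p.2)),
      Real.sin (j * α * p.1) * Real.sin (l * Real.pi * p.2), 0, 0],
    fun p => ![0, 0, Real.sin (j * α * p.1) * Real.sin (l * Real.pi * p.2), 0],
    fun p => ![0, 0, 0, Real.sin (j * α * p.1) * Real.sin (l * Real.pi * p.2)],
    fun p => ![-(l * Real.pi / (j * α) * (Real.sin (j * α * p.1) * Real.cos (l * Real.pi * p.2))),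
      Real.cos (j * α * p.1) * Real.sin (l * Real.pi * p.2), 0, 0],
    fun p => ![0, 0, Real.cos (j * α * p.1) * Real.sin (l * Real.pi * p.2), 0],
    fun p => ![0, 0, 0, Real.cos (j * α * p.1) * Real.sin (l * Real.pi * p.2)]]

/-- The Fourier block `E_{jl}` (over `𝕜 = ℝ`, or its complexification over `𝕜 = ℂ`). -/
def E (𝕜 : Type) [RCLike 𝕜] (α : ℝ) (j : ℤ) (l : ℕ) : Submodule 𝕜 (H 𝕜 α) :=
  if j = 0 then fieldSpan 𝕜 α (zeroModes l) else fieldSpan 𝕜 α (modes α j l)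

/-- The complex fields in `H` with wave numbers `(j,l)`: `u` is a combination of
`cos jαx cos lπz` and `sin jαx cos lπz`, and each of `w, T, S` is a combination of
`cos jαx sin lπz` and `sin jαx sin lπz`. -/
def HasWaveNumbers {α : ℝ} (j : ℤ) (l : ℕ) (ψ : H ℂ α) : Prop :=
  ∃ c s : Fin 4 → ℂ, ∀ i : Fin 4,
    ((ψ : Fields ℂ α) i : ℝ × ℝ → ℂ) =ᵐ[cellMeasure α] fun p =>
      (c i * (Real.cos (j * α * p.1) : ℂ) + s i * (Real.sin (j * α * p.1) : ℂ)) *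
        (if i = 0 then (Real.cos (l * Real.pi * p.2) : ℂ) else (Real.sin (l * Real.pi * p.2) : ℂ))

/-- `γ_{jl}² = j²α² + l²π²`. -/
def gammaSq (α : ℝ) (j : ℤ) (l : ℕ) : ℝ := (j : ℝ) ^ 2 * α ^ 2 + (l : ℝ) ^ 2 * Real.pi ^ 2

/-- The characteristic cubic `f_{jl}`. -/
def f (α σ τ η lam : ℝ) (j : ℤ) (l : ℕ) (β : ℂ) : ℂ :=
  β ^ 3 + ((σ + τ + 1) * gammaSq α j l : ℝ) * β ^ 2
    + ((σ + τ + σ * τ) * gammaSq α j l ^ 2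
        - σ * (j : ℝ) ^ 2 * α ^ 2 / gammaSq α j l * (lam - η) : ℝ) * β
    + (σ * τ * gammaSq α j l ^ 3 + σ * (j : ℝ) ^ 2 * α ^ 2 * (η - τ * lam) : ℝ)

/-- `(A - β)^k ψ = 0` for an unbounded operator `A` (including that all the iterates lie in the
domain of `A`). -/
def PowKer {X : Type*} [AddCommGroup X] [Module ℂ X] (A : X →ₗ.[ℂ] X) (β : ℂ) : ℕ → X → Prop
  | 0, ψ => ψ = 0
  | k + 1, ψ => ∃ h : ψ ∈ A.domain, PowKer A β k (A ⟨ψ, h⟩ - β • ψ)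

/-- `ψ = x + i y` almost everywhere. -/
def IsComplexCombination {α : ℝ} (ψ : H ℂ α) (x y : H ℝ α) : Prop :=
  ∀ i : Fin 4, ∀ᵐ p ∂(cellMeasure α),
    ((ψ : Fields ℂ α) i : ℝ × ℝ → ℂ) p =
      (((x : Fields ℝ α) i : ℝ × ℝ → ℝ) p : ℂ) +
        Complex.I * (((y : Fields ℝ α) i : ℝ × ℝ → ℝ) p : ℂ)

/-- `x` is the real or the imaginary part of a vector with wave numbers `(j,l)` which is an
eigenvector or generalized eigenvector of (the complexified) `L` for a zero of `f_{jl}`. -/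
def IsRootVector (α σ τ η lam : ℝ) (j : ℤ) (l : ℕ) (x : H ℝ α) : Prop :=
  ∃ (ψ : H ℂ α) (y : H ℝ α) (β : ℂ) (k : ℕ),
    (IsComplexCombination ψ x y ∨ IsComplexCombination ψ y x) ∧
    HasWaveNumbers j l ψ ∧ f α σ τ η lam j l β = 0 ∧ PowKer (L ℂ α σ τ η lam) β k ψ

/-- The space `E_{f_{jl}}` spanned by the eigenvectors and generalized eigenvectors that belong to
the zeros of `f_{jl}`. -/
def rootSpace (α σ τ η lam : ℝ) (j : ℤ) (l : ℕ) : Submodule ℝ (H ℝ α) :=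
  Submodule.span ℝ {x | IsRootVector α σ τ η lam j l x}

/-! ### Sectorial operators -/

/-- `R` is a bounded inverse of `z - A`. -/
def IsResolvent {X : Type*} [NormedAddCommGroup X] [NormedSpace ℂ X] (A : X →ₗ.[ℂ] X) (z : ℂ)
    (R : X →L[ℂ] X) : Prop :=
  (∀ x, ∃ h : R x ∈ A.domain, z • R x - A ⟨R x, h⟩ = x) ∧
    ∀ x : A.domain, R (z • (x : X) - A x) = x

/-- Sectorial operators: closed, densely defined, and for some `φ ∈ (0, π/2)`, `M ≥ 1` and real
`a`, the sector `φ ≤ |arg (z - a)| ≤ π`, `z ≠ a`, lies in the resolvent set, with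
`‖(z - A)⁻¹‖ ≤ M / |z - a|` there. -/
def IsSectorial {X : Type*} [NormedAddCommGroup X] [NormedSpace ℂ X] (A : X →ₗ.[ℂ] X) : Prop :=
  A.IsClosed ∧ Dense (A.domain : Set X) ∧
    ∃ (a φ M : ℝ), 0 < φ ∧ φ < Real.pi / 2 ∧ 1 ≤ M ∧
      ∀ z : ℂ, z ≠ a → φ ≤ |(z - a).arg| →
        ∃ R : X →L[ℂ] X, IsResolvent A z R ∧ ‖R‖ ≤ M / ‖z - a‖

/-! ### Critical parameters -/

/-- `η_c = (27/4) π⁴ τ² (1 + σ⁻¹) (1 - τ)⁻¹`. -/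
def etaC (σ τ : ℝ) : ℝ := 27 / 4 * Real.pi ^ 4 * τ ^ 2 * (1 + σ⁻¹) * (1 - τ)⁻¹

/-- `λ_c = η / τ + (27/4) π⁴`. -/
def lamC (τ η : ℝ) : ℝ := η / τ + 27 / 4 * Real.pi ^ 4

end DoubleDiffusive

end

/-! Everything reduces to 3 × 3 matrices. Products of trigonometric modes give an orthonormal basis
`basisH` of H, indexed by a wave vector p and one of three fields: the divergence-free velocity, the
temperature, the salinity. Orthogonality to gradients leaves one velocity field per wave vector. In
this basis L is block diagonal (`inner_basisVec_L`) with real blocks `blockMatrix`; the Leray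
projection never has to be computed, because L is only tested against elements of H. Conversely,
coefficients that are square summable after multiplication by γ² give an element of the domain
(`mem_domain_of_summable`).

The cubic f is minus the determinant of the shifted block (`f_eq_det`), so the zeros of f are the
eigenvalues of the block. Generalized eigenvectors of a complex matrix span ℂ³, hence their real
parts span ℝ³ (`span_rootSet`). Since E at (j,l) is the sum of the blocks at the wave vectors
(±j,l), the first assertion follows, and invariance is block diagonality.

For the basis, each block is γ² times (t C - diag(σ,1,τ)) with a fixed coupling matrix C and t
tending to 0 along the wave vectors. The numbers σ, 1, τ are distinct, so for all but finitely many
blocks there are eigenvectors close to the standard basis (`eventually_exists_eigenMatrix`).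
Matrices of root vectors can therefore be chosen bounded together with their inverses
(`exists_bounded_rootMatrix`). They assemble to a bounded invertible operator carrying the
orthonormal basis to the root vectors, and such an image is an unconditional basis.

Below λ_c the Routh–Hurwitz criterion applies to every f. Its two inequalities come from the minimum
27π⁴/4 of γ⁶/(j²α²) and from η < η_c, which puts the oscillatory threshold above the stationary one
(`re_neg_of_f_eq_zero`). The inner product on a block is supplied by Lyapunov's theorem
(`exists_lyapunov`).

Finally -L = A - B, with A positive and diagonal in the Fourier basis and B bounded. A Neumann
series outside a sector whose vertex is far enough to the left gives the resolvent estimate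
(`isSectorial_neg_L`). -/

noncomputable section

namespace DoubleDiffusive

/-! ### Trigonometric modes in one variable -/

/-- Orthonormal trigonometric functions of period `2π/α`: cosines for `n > 0`, sines for `n < 0`. -/
def xMode (α : ℝ) (n : ℤ) (x : ℝ) : ℝ :=
  if n = 0 then √(α / (2 * Real.pi))
  else if 0 < n then √(α / Real.pi) * Real.cos (n * α * x)
  else √(α / Real.pi) * Real.sin (n * α * x)

/-- `√2 sin lπz`. -/
def sinMode (l : ℕ) (z : ℝ) : ℝ := √2 * Real.sin (l * Real.pi * z)

/-- `√2 cos lπz`. -/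
def cosMode (l : ℕ) (z : ℝ) : ℝ := √2 * Real.cos (l * Real.pi * z)

theorem contDiff_xMode (α : ℝ) (n : ℤ) : ContDiff ℝ ∞ (xMode α n) := by
  unfold xMode
  split_ifs <;> fun_prop

theorem contDiff_sinMode (l : ℕ) : ContDiff ℝ ∞ (sinMode l) := by
  unfold sinMode; fun_prop

theorem contDiff_cosMode (l : ℕ) : ContDiff ℝ ∞ (cosMode l) := by
  unfold cosMode; fun_prop

theorem continuous_xMode (α : ℝ) (n : ℤ) : Continuous (xMode α n) := (contDiff_xMode α n).continuous

theorem continuous_sinMode (l : ℕ) : Continuous (sinMode l) := (contDiff_sinMode l).continuous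

theorem continuous_cosMode (l : ℕ) : Continuous (cosMode l) := (contDiff_cosMode l).continuous

theorem xMode_periodic {α : ℝ} (hα : 0 < α) (n : ℤ) (x : ℝ) :
    xMode α n (x + 2 * Real.pi / α) = xMode α n x := by
  have h : (n : ℝ) * α * (x + 2 * Real.pi / α) = n * α * x + n * (2 * Real.pi) := by
    field_simp
  unfold xMode
  rw [h, Real.cos_add_int_mul_two_pi, Real.sin_add_int_mul_two_pi]

/-- For n < 0 the sine keeps the signed argument nαx. This convention makes differentiation a single
formula n ↦ -n for all n, so later computations need no case distinction. -/
theorem hasDerivAt_xMode (α : ℝ) (n : ℤ) (x : ℝ) :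
    HasDerivAt (xMode α n) (n * α * xMode α (-n) x) x := by
  have h0 : HasDerivAt (fun x : ℝ => (n : ℝ) * α * x) (n * α) x := by
    simpa using (hasDerivAt_id x).const_mul ((n : ℝ) * α)
  rcases lt_trichotomy n 0 with hn | rfl | hn
  · have e : xMode α n = fun x => √(α / Real.pi) * Real.sin (n * α * x) := by
      funext x; simp [xMode, hn.ne, hn.not_gt]
    have e' : xMode α (-n) x = √(α / Real.pi) * Real.cos (n * α * x) := by
      simp [xMode, hn.ne, hn]
    rw [e, e']
    exact (h0.sin.const_mul _).congr_deriv (by ring)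
  · have e : xMode α 0 = fun x => √(α / (2 * Real.pi)) := by
      funext x; simp [xMode]
    rw [e]
    simpa using hasDerivAt_const x (√(α / (2 * Real.pi)))
  · have e : xMode α n = fun x => √(α / Real.pi) * Real.cos (n * α * x) := by
      funext x; simp [xMode, hn.ne', hn]
    have e' : xMode α (-n) x = -(√(α / Real.pi) * Real.sin (n * α * x)) := by
      simp [xMode, hn.ne', hn.le]
    rw [e, e']
    exact (h0.cos.const_mul _).congr_deriv (by ring)

theorem hasDerivAt_sinMode (l : ℕ) (z : ℝ) :
    HasDerivAt (sinMode l) (l * Real.pi * cosMode l z) z := by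
  have h0 : HasDerivAt (fun x : ℝ => (l : ℝ) * Real.pi * x) (l * Real.pi) z := by
    simpa using (hasDerivAt_id z).const_mul ((l : ℝ) * Real.pi)
  unfold sinMode cosMode
  exact (h0.sin.const_mul _).congr_deriv (by ring)

theorem hasDerivAt_cosMode (l : ℕ) (z : ℝ) :
    HasDerivAt (cosMode l) (-(l * Real.pi) * sinMode l z) z := by
  have h0 : HasDerivAt (fun x : ℝ => (l : ℝ) * Real.pi * x) (l * Real.pi) z := by
    simpa using (hasDerivAt_id z).const_mul ((l : ℝ) * Real.pi)
  unfold sinMode cosMode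
  exact (h0.cos.const_mul _).congr_deriv (by ring)

@[simp] theorem sinMode_at_zero (l : ℕ) : sinMode l 0 = 0 := by simp [sinMode]

@[simp] theorem sinMode_at_one (l : ℕ) : sinMode l 1 = 0 := by simp [sinMode]

theorem sinMode_sq_add_cosMode_sq (l : ℕ) (z : ℝ) : sinMode l z ^ 2 + cosMode l z ^ 2 = 2 := by
  unfold sinMode cosMode
  rw [mul_pow, mul_pow, ← mul_add, Real.sin_sq_add_cos_sq, Real.sq_sqrt (by norm_num), mul_one]

theorem xMode_sq_add {α : ℝ} (hα : 0 < α) {n : ℤ} (hn : n ≠ 0) (x : ℝ) :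
    xMode α n x ^ 2 + xMode α (-n) x ^ 2 = α / Real.pi := by
  have h : (√(α / Real.pi)) ^ 2 = α / Real.pi := Real.sq_sqrt (by positivity)
  have h2 := Real.sin_sq_add_cos_sq (n * α * x)
  rcases lt_or_gt_of_ne hn with hn | hn
  · have e : xMode α n x = √(α / Real.pi) * Real.sin (n * α * x) := by
      simp [xMode, hn.ne, hn.not_gt]
    have e' : xMode α (-n) x = √(α / Real.pi) * Real.cos (n * α * x) := by
      simp [xMode, hn.ne, hn]
    rw [e, e', mul_pow, mul_pow, h]; linear_combination (α / Real.pi) * h2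
  · have e : xMode α n x = √(α / Real.pi) * Real.cos (n * α * x) := by
      simp [xMode, hn.ne', hn]
    have e' : xMode α (-n) x = -(√(α / Real.pi) * Real.sin (n * α * x)) := by
      simp [xMode, hn.ne', hn.le]
    rw [e, e', neg_sq, mul_pow, mul_pow, h]; linear_combination (α / Real.pi) * h2

/-- `cos jαx` and `sin jαx` are combinations of the modes `± j`. -/
theorem exists_cos_sin_eq_xMode {α : ℝ} (hα : 0 < α) (j : ℤ) :
    ∃ a b c d : ℝ, ∀ x : ℝ,
      Real.cos (j * α * x) = a * xMode α j x + b * xMode α (-j) x ∧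
      Real.sin (j * α * x) = c * xMode α j x + d * xMode α (-j) x := by
  have h1 : √(α / Real.pi) ≠ 0 := by positivity
  have h2 : √(α / (2 * Real.pi)) ≠ 0 := by positivity
  rcases lt_trichotomy j 0 with hn | rfl | hn
  · refine ⟨0, (√(α / Real.pi))⁻¹, (√(α / Real.pi))⁻¹, 0, fun x => ?_⟩
    have e : xMode α j x = √(α / Real.pi) * Real.sin (j * α * x) := by
      simp [xMode, hn.ne, hn.not_gt]
    have e' : xMode α (-j) x = √(α / Real.pi) * Real.cos (j * α * x) := by
      simp [xMode, hn.ne, hn]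
    rw [e, e']; constructor <;> field_simp <;> ring
  · refine ⟨(√(α / (2 * Real.pi)))⁻¹, 0, 0, 0, fun x => ?_⟩
    have e : xMode α 0 x = √(α / (2 * Real.pi)) := by simp [xMode]
    rw [e, inv_mul_cancel₀ h2]; simp
  · refine ⟨(√(α / Real.pi))⁻¹, 0, 0, -(√(α / Real.pi))⁻¹, fun x => ?_⟩
    have e : xMode α j x = √(α / Real.pi) * Real.cos (j * α * x) := by
      simp [xMode, hn.ne', hn]
    have e' : xMode α (-j) x = -(√(α / Real.pi) * Real.sin (j * α * x)) := by
      simp [xMode, hn.ne', hn.le]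
    rw [e, e']; constructor <;> field_simp <;> ring

/-- The modes `± j` are multiples of `cos jαx` or of `sin jαx`. -/
theorem exists_xMode_eq_cos_sin (α : ℝ) (j n : ℤ) (hn : n.natAbs = j.natAbs) :
    ∃ a b : ℝ, ∀ x : ℝ, xMode α n x = a * Real.cos (j * α * x) + b * Real.sin (j * α * x) := by
  have key : ∃ a b : ℝ, ∀ x : ℝ,
      xMode α n x = a * Real.cos (n * α * x) + b * Real.sin (n * α * x) := by
    unfold xMode
    split_ifs with h h
    · exact ⟨√(α / (2 * Real.pi)), 0, fun x => by simp [h]⟩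
    · exact ⟨√(α / Real.pi), 0, fun x => by simp⟩
    · exact ⟨0, √(α / Real.pi), fun x => by simp⟩
  obtain ⟨a, b, h⟩ := key
  rcases Int.natAbs_eq_natAbs_iff.mp hn with rfl | rfl
  · exact ⟨a, b, h⟩
  · exact ⟨a, -b, fun x => by rw [h]; simp⟩

/-! ### Orthonormality -/

theorem integral_sub_eq_zero_of_hasDerivAt {F F' : ℝ → ℝ} {a b : ℝ} (hab : a ≤ b)
    (hF : ∀ x, HasDerivAt F (F' x) x) (hc : Continuous F') (h : F a = F b) :
    ∫ x in Ioo a b, F' x = 0 := by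
  rw [← integral_Ioc_eq_integral_Ioo, ← intervalIntegral.integral_of_le hab,
    intervalIntegral.integral_eq_sub_of_hasDerivAt (fun x _ => hF x) (hc.intervalIntegrable _ _), h,
    sub_self]

theorem integrableOn_Ioo_of_continuous {F : ℝ → ℝ} (hc : Continuous F) (a b : ℝ) :
    IntegrableOn F (Ioo a b) :=
  (hc.integrableOn_Icc (a := a) (b := b)).mono_set Ioo_subset_Icc_self

/-- On the diagonal, cos² - sin² is up to a factor the derivative of sin · cos, so sin² may be
replaced by its mean. Off the diagonal, the product is up to a nonzero factor the derivative of the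
Wronskian, which vanishes at both ends. -/
theorem integral_sinMode_mul (l k : ℕ) (hl : l ≠ 0) :
    ∫ z in Ioo (0 : ℝ) 1, sinMode l z * sinMode k z = if l = k then 1 else 0 := by
  have cs := continuous_sinMode
  have cc := continuous_cosMode
  split_ifs with h
  · subst h
    have h1 : ∫ z in Ioo (0 : ℝ) 1, l * Real.pi * (cosMode l z ^ 2 - sinMode l z ^ 2) = 0 := by
      refine integral_sub_eq_zero_of_hasDerivAt (F := fun z => sinMode l z * cosMode l z) zero_le_one
        (fun z => ?_) (by fun_prop) (by simp)
      exact ((hasDerivAt_sinMode l z).mul (hasDerivAt_cosMode l z)).congr_deriv (by ring)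
    have h2 : (∫ z in Ioo (0 : ℝ) 1, sinMode l z * sinMode l z) =
        ∫ z in Ioo (0 : ℝ) 1,
          (1 - (2 * (l * Real.pi))⁻¹ * (l * Real.pi * (cosMode l z ^ 2 - sinMode l z ^ 2))) := by
      congr 1; funext z
      have := sinMode_sq_add_cosMode_sq l z
      have hl' : (l : ℝ) ≠ 0 := by exact_mod_cast hl
      field_simp
      linear_combination this
    rw [h2, integral_sub (integrableOn_Ioo_of_continuous (by fun_prop) _ _)
      (integrableOn_Ioo_of_continuous (by fun_prop) _ _), integral_const_mul, h1]
    simp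
  · have h1 : ∫ z in Ioo (0 : ℝ) 1, ((k : ℝ) ^ 2 - l ^ 2) * Real.pi ^ 2 *
        (sinMode l z * sinMode k z) = 0 := by
      refine integral_sub_eq_zero_of_hasDerivAt
        (F := fun z => l * Real.pi * cosMode l z * sinMode k z -
          k * Real.pi * cosMode k z * sinMode l z) zero_le_one (fun z => ?_) (by fun_prop) (by simp)
      exact ((((hasDerivAt_cosMode l z).const_mul _).mul (hasDerivAt_sinMode k z)).sub
        (((hasDerivAt_cosMode k z).const_mul _).mul (hasDerivAt_sinMode l z))).congr_deriv (by ring)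
    rw [integral_const_mul] at h1
    refine (mul_eq_zero.mp h1).resolve_left (mul_ne_zero (sub_ne_zero.mpr ?_) (by positivity))
    intro h2
    exact h (by exact_mod_cast ((sq_eq_sq₀ (Nat.cast_nonneg _) (Nat.cast_nonneg _)).mp h2).symm)

theorem integral_cosMode_mul (l k : ℕ) (hl : l ≠ 0) :
    ∫ z in Ioo (0 : ℝ) 1, cosMode l z * cosMode k z = if l = k then 1 else 0 := by
  have cs := continuous_sinMode
  have cc := continuous_cosMode
  split_ifs with h
  · subst h
    have h1 := integral_sinMode_mul l l hl
    rw [if_pos rfl] at h1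
    have h2 : (∫ z in Ioo (0 : ℝ) 1, cosMode l z * cosMode l z) =
        ∫ z in Ioo (0 : ℝ) 1, (2 - sinMode l z * sinMode l z) := by
      congr 1; funext z
      linear_combination sinMode_sq_add_cosMode_sq l z
    rw [h2, integral_sub (integrableOn_Ioo_of_continuous (by fun_prop) _ _)
      (integrableOn_Ioo_of_continuous (by fun_prop) _ _), h1]
    simp; norm_num
  · have h1 : ∫ z in Ioo (0 : ℝ) 1, ((k : ℝ) ^ 2 - l ^ 2) * Real.pi ^ 2 *
        (cosMode l z * cosMode k z) = 0 := by
      refine integral_sub_eq_zero_of_hasDerivAt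
        (F := fun z => -(l * Real.pi * sinMode l z * cosMode k z) +
          k * Real.pi * sinMode k z * cosMode l z) zero_le_one (fun z => ?_) (by fun_prop) (by simp)
      exact ((((hasDerivAt_sinMode l z).const_mul _).mul (hasDerivAt_cosMode k z)).neg.add
        (((hasDerivAt_sinMode k z).const_mul _).mul (hasDerivAt_cosMode l z))).congr_deriv (by ring)
    rw [integral_const_mul] at h1
    refine (mul_eq_zero.mp h1).resolve_left (mul_ne_zero (sub_ne_zero.mpr ?_) (by positivity))
    intro h2
    exact h (by exact_mod_cast ((sq_eq_sq₀ (Nat.cast_nonneg _) (Nat.cast_nonneg _)).mp h2).symm)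

theorem integral_xMode_mul {α : ℝ} (hα : 0 < α) (n m : ℤ) :
    ∫ x in Ioo (0 : ℝ) (2 * Real.pi / α), xMode α n x * xMode α m x = if n = m then 1 else 0 := by
  have cx := continuous_xMode α
  have hp : 0 ≤ 2 * Real.pi / α := by positivity
  have per : ∀ n, xMode α n (2 * Real.pi / α) = xMode α n 0 := fun n => by
    simpa using xMode_periodic hα n 0
  split_ifs with h
  · subst h
    rcases eq_or_ne n 0 with rfl | hn
    · have e : ∀ x, xMode α 0 x = √(α / (2 * Real.pi)) := fun x => by simp [xMode]
      simp only [e, Real.mul_self_sqrt (show 0 ≤ α / (2 * Real.pi) by positivity)]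
      simp [Measure.real, hp]
      exact hα.ne'
    have hn' : (n : ℝ) ≠ 0 := by exact_mod_cast hn
    have h1 : ∫ z in Ioo (0 : ℝ) (2 * Real.pi / α),
        n * α * (xMode α (-n) z ^ 2 - xMode α n z ^ 2) = 0 := by
      refine integral_sub_eq_zero_of_hasDerivAt (F := fun z => xMode α n z * xMode α (-n) z) hp
        (fun z => ?_) (by fun_prop) (by simp [per])
      have := (hasDerivAt_xMode α n z).mul (hasDerivAt_xMode α (-n) z)
      rw [neg_neg] at this
      exact this.congr_deriv (by push_cast; ring)
    have h2 : (∫ z in Ioo (0 : ℝ) (2 * Real.pi / α), xMode α n z * xMode α n z) =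
        ∫ z in Ioo (0 : ℝ) (2 * Real.pi / α), (α / (2 * Real.pi) -
          (2 * (n * α))⁻¹ * (n * α * (xMode α (-n) z ^ 2 - xMode α n z ^ 2))) := by
      congr 1; funext z
      have := xMode_sq_add hα hn z
      have e : α / (2 * Real.pi) = (α / Real.pi) / 2 := by field_simp
      rw [e, ← this]
      field_simp
      ring
    rw [h2, integral_sub (integrableOn_Ioo_of_continuous (by fun_prop) _ _)
      (integrableOn_Ioo_of_continuous (by fun_prop) _ _), integral_const_mul, h1]
    simp [Measure.real, hp]
    exact hα.ne'
  -- The modes n and -n belong to the same eigenvalue, so the Wronskian says nothing about them;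
  -- their product is instead a multiple of the derivative of a square.
  · rcases eq_or_ne m (-n) with rfl | hm
    · have hn : n ≠ 0 := by rintro rfl; simp at h
      have hn' : (n : ℝ) ≠ 0 := by exact_mod_cast hn
      have h1 : ∫ z in Ioo (0 : ℝ) (2 * Real.pi / α),
          2 * (n * α) * (xMode α n z * xMode α (-n) z) = 0 := by
        refine integral_sub_eq_zero_of_hasDerivAt (F := fun z => xMode α n z * xMode α n z) hp
          (fun z => ?_) (by fun_prop) (by simp [per])
        exact ((hasDerivAt_xMode α n z).mul (hasDerivAt_xMode α n z)).congr_deriv (by ring)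
      rw [integral_const_mul] at h1
      exact (mul_eq_zero.mp h1).resolve_left (by positivity)
    · have h1 : ∫ z in Ioo (0 : ℝ) (2 * Real.pi / α), ((m : ℝ) ^ 2 - n ^ 2) * α ^ 2 *
          (xMode α n z * xMode α m z) = 0 := by
        refine integral_sub_eq_zero_of_hasDerivAt
          (F := fun z => n * α * xMode α (-n) z * xMode α m z -
            m * α * xMode α (-m) z * xMode α n z) hp (fun z => ?_) (by fun_prop) (by simp [per])
        have e1 := hasDerivAt_xMode α (-n) z
        have e2 := hasDerivAt_xMode α (-m) z
        rw [neg_neg] at e1 e2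
        exact (((e1.const_mul _).mul (hasDerivAt_xMode α m z)).sub
          ((e2.const_mul _).mul (hasDerivAt_xMode α n z))).congr_deriv (by push_cast; ring)
      rw [integral_const_mul] at h1
      refine (mul_eq_zero.mp h1).resolve_left (mul_ne_zero (sub_ne_zero.mpr ?_) (by positivity))
      intro h2
      rcases sq_eq_sq_iff_eq_or_eq_neg.mp h2 with h3 | h3
      · exact h (by exact_mod_cast h3.symm)
      · exact hm (by exact_mod_cast h3)

end DoubleDiffusive

end

noncomputable section

namespace DoubleDiffusive

/-! ### Completeness of the trigonometric modes -/

section completeness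

variable {F : Type*} [NormedAddCommGroup F] [NormedSpace ℝ F]

theorem IntegrableOn.continuous_smul {a b : ℝ} {f : ℝ → F} (hf : IntegrableOn f (Ioo a b))
    {g : ℝ → ℝ} (hg : Continuous g) : IntegrableOn (fun x => g x • f x) (Ioo a b) := by
  obtain ⟨C, hC⟩ := (isCompact_Icc (a := a) (b := b)).exists_bound_of_continuousOn hg.continuousOn
  refine Integrable.bdd_smul hf C hg.aestronglyMeasurable ?_
  filter_upwards [ae_restrict_mem measurableSet_Ioo] with x hx
  exact hC x (Ioo_subset_Icc_self hx)

theorem integral_comb_smul {a b : ℝ} {f : ℝ → F} (hf : IntegrableOn f (Ioo a b))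
    {g k : ℝ → ℝ} (hg : Continuous g) (hk : Continuous k) (r s : ℝ) :
    ∫ x in Ioo a b, (r * g x + s * k x) • f x =
      r • (∫ x in Ioo a b, g x • f x) + s • ∫ x in Ioo a b, k x • f x := by
  rw [← integral_smul, ← integral_smul, ← integral_add]
  · simp_rw [add_smul, mul_smul]
  · exact Integrable.fun_smul r (IntegrableOn.continuous_smul hf hg)
  · exact Integrable.fun_smul s (IntegrableOn.continuous_smul hf hk)

/-- The functional k ↦ ∫ k f is bounded by the supremum of |k| times the L¹ norm of f, so its kernel
is closed under uniform limits. -/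
theorem integral_smul_eq_zero_of_approx {a b : ℝ} {f : ℝ → F} (hf : IntegrableOn f (Ioo a b))
    {g : ℝ → ℝ} (hg : Continuous g)
    (h : ∀ ε > 0, ∃ k : ℝ → ℝ, Continuous k ∧ (∀ x ∈ Ioo a b, |g x - k x| ≤ ε) ∧
      ∫ x in Ioo a b, k x • f x = 0) :
    ∫ x in Ioo a b, g x • f x = 0 := by
  have key : ∀ ε > 0, ‖∫ x in Ioo a b, g x • f x‖ ≤ ε * ∫ x in Ioo a b, ‖f x‖ := by
    intro ε hε
    obtain ⟨k, hk, hgk, hk0⟩ := h ε hε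
    have e : ∫ x in Ioo a b, g x • f x = ∫ x in Ioo a b, (g x - k x) • f x := by
      simp_rw [sub_smul]
      rw [integral_sub (IntegrableOn.continuous_smul hf hg) (IntegrableOn.continuous_smul hf hk),
        hk0, sub_zero]
    rw [e, ← integral_const_mul]
    refine norm_integral_le_of_norm_le (hf.norm.const_mul ε) ?_
    filter_upwards [ae_restrict_mem measurableSet_Ioo] with x hx
    rw [norm_smul]
    exact mul_le_mul_of_nonneg_right (hgk x hx) (norm_nonneg _)
  have hC : 0 ≤ ∫ x in Ioo a b, ‖f x‖ := integral_nonneg fun _ => norm_nonneg _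
  by_contra hne
  have hpos := norm_pos_iff.mpr hne
  -- With this ε the bound is less than half of the left side; the summand 1 keeps the denominator
  -- positive.
  have := key (‖∫ x in Ioo a b, g x • f x‖ / (2 * ((∫ x in Ioo a b, ‖f x‖) + 1))) (by positivity)
  rw [div_mul_eq_mul_div, le_div_iff₀ (by positivity)] at this
  nlinarith

theorem ae_eq_zero_of_integral_contDiff_Ioo [CompleteSpace F] {a b : ℝ} {f : ℝ → F}
    (hf : IntegrableOn f (Ioo a b))
    (h : ∀ g : ℝ → ℝ, ContDiff ℝ ∞ g → tsupport g ⊆ Ioo a b → ∫ x in Ioo a b, g x • f x = 0) :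
    ∀ᵐ x ∂(volume.restrict (Ioo a b)), f x = 0 := by
  rw [ae_restrict_iff' measurableSet_Ioo]
  refine IsOpen.ae_eq_zero_of_integral_contDiff_smul_eq_zero isOpen_Ioo hf.locallyIntegrableOn ?_
  intro g hg _ hs
  rw [← h g hg hs]
  refine (setIntegral_eq_integral_of_forall_compl_eq_zero fun x hx => ?_).symm
  rw [image_eq_zero_of_notMem_tsupport fun hx' => hx (hs hx'), zero_smul]

/-- By the product formula the vanishing cosine moments annihilate all powers of cos πz. This
function is injective on [0,1], so Stone–Weierstrass makes its polynomials uniformly dense, and f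
annihilates every test function. -/
theorem ae_eq_zero_of_integral_cos [CompleteSpace F] {f : ℝ → F}
    (hf : IntegrableOn f (Ioo 0 1))
    (h : ∀ l : ℕ, ∫ z in Ioo (0 : ℝ) 1, Real.cos (l * Real.pi * z) • f z = 0) :
    ∀ᵐ z ∂(volume.restrict (Ioo (0 : ℝ) 1)), f z = 0 := by
  have hpow : ∀ k l : ℕ, ∫ z in Ioo (0 : ℝ) 1,
      (Real.cos (Real.pi * z) ^ k * Real.cos (l * Real.pi * z)) • f z = 0 := by
    intro k
    induction k with
    | zero => simpa using h
    | succ k ih =>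
      intro l
      rcases l with _ | l
      -- At l = 0 the product formula would ask for the index l - 1; here one factor cos πz is
      -- simply read as wave number 1.
      · rw [← ih 1]; congr 1; funext z; simp [pow_succ]
      · have e : ∀ z : ℝ, (Real.cos (Real.pi * z) ^ (k + 1) *
            Real.cos ((l + 1 : ℕ) * Real.pi * z)) • f z =
            (1 / 2 : ℝ) • ((Real.cos (Real.pi * z) ^ k * Real.cos ((l + 2 : ℕ) * Real.pi * z)) • f z)
            + (1 / 2 : ℝ) • ((Real.cos (Real.pi * z) ^ k * Real.cos (l * Real.pi * z)) • f z) := by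
          intro z
          rw [smul_smul, smul_smul, ← add_smul]
          congr 1
          have h1 : ((l + 2 : ℕ) : ℝ) * Real.pi * z = (l + 1 : ℕ) * Real.pi * z + Real.pi * z := by
            push_cast; ring
          have h2 : (l : ℝ) * Real.pi * z = (l + 1 : ℕ) * Real.pi * z - Real.pi * z := by
            push_cast; ring
          rw [h1, h2, Real.cos_add, Real.cos_sub]
          ring
        simp_rw [e]
        rw [integral_add, integral_smul, integral_smul, ih, ih]
        · simp
        · exact (IntegrableOn.continuous_smul hf (by fun_prop)).smul _
        · exact (IntegrableOn.continuous_smul hf (by fun_prop)).smul _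
  refine ae_eq_zero_of_integral_contDiff_Ioo hf fun g hg _ =>
    integral_smul_eq_zero_of_approx hf hg.continuous fun ε hε => ?_
  let c : C(Icc (0 : ℝ) 1, ℝ) := ⟨fun z => Real.cos (Real.pi * z), by fun_prop⟩
  have hsep : (Algebra.adjoin ℝ {c}).SeparatesPoints := by
    intro x y hxy
    refine ⟨c, ⟨c, Algebra.subset_adjoin rfl, rfl⟩, fun hc => hxy ?_⟩
    have := Real.injOn_cos ⟨mul_nonneg Real.pi_pos.le x.2.1, by nlinarith [x.2.2, Real.pi_pos]⟩
      ⟨mul_nonneg Real.pi_pos.le y.2.1, by nlinarith [y.2.2, Real.pi_pos]⟩ hc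
    exact Subtype.ext (mul_left_cancel₀ Real.pi_pos.ne' this)
  obtain ⟨q, hq⟩ := ContinuousMap.exists_mem_subalgebra_near_continuous_of_separatesPoints _ hsep
    (fun z : Icc (0 : ℝ) 1 => g z) (hg.continuous.comp continuous_subtype_val) ε hε
  obtain ⟨q, hqm⟩ := q
  rw [Algebra.adjoin_singleton_eq_range_aeval] at hqm
  obtain ⟨P, rfl⟩ := hqm
  refine ⟨fun z => P.eval (Real.cos (Real.pi * z)), by fun_prop, fun x hx => ?_, ?_⟩
  · have := (hq ⟨x, Ioo_subset_Icc_self hx⟩).le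
    rw [abs_sub_comm]
    have e : (Polynomial.aeval c P) ⟨x, Ioo_subset_Icc_self hx⟩ =
        P.eval (Real.cos (Real.pi * x)) := by
      have := Polynomial.aeval_algHom_apply
        (ContinuousMap.evalAlgHom ℝ ℝ (⟨x, Ioo_subset_Icc_self hx⟩ : Icc (0 : ℝ) 1)) c P
      exact this.symm
    simpa [e] using this
  · simp_rw [Polynomial.eval_eq_sum_range, Finset.sum_smul]
    rw [integral_finsetSum]
    · refine Finset.sum_eq_zero fun k _ => ?_
      simp_rw [mul_smul]
      rw [integral_smul]
      have := hpow k 0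
      simp only [Nat.cast_zero, zero_mul, Real.cos_zero, mul_one] at this
      rw [this, smul_zero]
    · intro k _
      exact IntegrableOn.continuous_smul hf (by fun_prop)

/-- Trigonometric polynomials are dense in the continuous functions on the circle. Real and
imaginary parts of each exponential are combinations of two modes ±n, so f annihilates both parts of
every trigonometric polynomial. -/
theorem ae_eq_zero_of_integral_xMode [CompleteSpace F] {α : ℝ} (hα : 0 < α) {f : ℝ → F}
    (hf : IntegrableOn f (Ioo 0 (2 * Real.pi / α)))
    (h : ∀ n : ℤ, ∫ x in Ioo (0 : ℝ) (2 * Real.pi / α), xMode α n x • f x = 0) :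
    ∀ᵐ x ∂(volume.restrict (Ioo (0 : ℝ) (2 * Real.pi / α))), f x = 0 := by
  have hT : 0 < 2 * Real.pi / α := by positivity
  have cx := continuous_xMode α
  have hlin : ∀ (a b : ℝ) (n : ℤ), ∫ x in Ioo (0 : ℝ) (2 * Real.pi / α),
      (a * xMode α n x + b * xMode α (-n) x) • f x = 0 := by
    intro a b n
    rw [integral_comb_smul hf (cx n) (cx (-n)), h, h]
    simp
  refine ae_eq_zero_of_integral_contDiff_Ioo hf fun g hg hs =>
    integral_smul_eq_zero_of_approx hf hg.continuous fun ε hε => ?_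
  set T := 2 * Real.pi / α with hTdef
  have : Fact (0 < T) := ⟨hT⟩
  have hg0 : ∀ x, x ∉ Ioo 0 T → g x = 0 := fun x hx =>
    image_eq_zero_of_notMem_tsupport fun hx' => hx (hs hx')
  -- The test function vanishes at both ends of the period, so its periodic extension is continuous.
  let G : C(AddCircle T, ℂ) := ⟨AddCircle.liftIco T 0 fun x => (g x : ℂ),
    AddCircle.liftIco_zero_continuous (by rw [hg0 0 (by simp), hg0 T (by simp)])
      (by have := hg.continuous; fun_prop)⟩
  have hG : G ∈ (Submodule.span ℂ (range (@fourier T))).topologicalClosure := by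
    rw [span_fourier_closure_eq_top]; trivial
  obtain ⟨q, hq, hqG⟩ := Metric.mem_closure_iff.mp hG ε hε
  have hre : ∀ φ : C(AddCircle T, ℂ), Continuous fun x : ℝ => (φ (x : AddCircle T)).re := fun φ =>
    Complex.continuous_re.comp (φ.continuous.comp (AddCircle.continuous_mk' T))
  have him : ∀ φ : C(AddCircle T, ℂ), Continuous fun x : ℝ => (φ (x : AddCircle T)).im := fun φ =>
    Complex.continuous_im.comp (φ.continuous.comp (AddCircle.continuous_mk' T))
  have hspan : ∀ φ ∈ Submodule.span ℂ (range (@fourier T)),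
      (∫ x in Ioo (0 : ℝ) T, (φ (x : AddCircle T)).re • f x = 0) ∧
        ∫ x in Ioo (0 : ℝ) T, (φ (x : AddCircle T)).im • f x = 0 := by
    intro φ hφ
    induction hφ using Submodule.span_induction with
    | mem φ hφ =>
      obtain ⟨n, rfl⟩ := hφ
      obtain ⟨a, b, c, d, habcd⟩ := exists_cos_sin_eq_xMode hα n
      have e : ∀ x : ℝ, (fourier n (x : AddCircle T) : ℂ) =
          Complex.exp (((n * α * x : ℝ) : ℂ) * Complex.I) := by
        intro x
        rw [fourier_coe_apply, hTdef]
        congr 1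
        push_cast
        have : (α : ℂ) ≠ 0 := by exact_mod_cast hα.ne'
        have : (Real.pi : ℂ) ≠ 0 := by exact_mod_cast Real.pi_ne_zero
        field_simp
      constructor
      · rw [← hlin a b n]; congr 1; funext x
        rw [e, Complex.exp_ofReal_mul_I_re, (habcd x).1]
      · rw [← hlin c d n]; congr 1; funext x
        rw [e, Complex.exp_ofReal_mul_I_im, (habcd x).2]
    | zero => simp
    | add φ χ _ _ h1 h2 =>
      have e1 := integral_comb_smul hf (hre φ) (hre χ) 1 1
      have e2 := integral_comb_smul hf (him φ) (him χ) 1 1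
      simp only [one_mul, h1.1, h1.2, h2.1, h2.2, smul_zero, add_zero] at e1 e2
      exact ⟨by simpa using e1, by simpa using e2⟩
    | smul a φ _ h1 =>
      have e1 := integral_comb_smul hf (hre φ) (him φ) a.re (-a.im)
      have e2 := integral_comb_smul hf (him φ) (hre φ) a.re a.im
      simp only [h1.1, h1.2, smul_zero, add_zero] at e1 e2
      refine ⟨?_, by simpa [Complex.mul_im] using e2⟩
      rw [← e1]; congr 1; funext x; simp [Complex.mul_re, sub_eq_add_neg]
  -- The test function is real, so passing to the real part of the approximant loses nothing.
  refine ⟨fun x => (q (x : AddCircle T)).re, ?_, fun x hx => ?_, (hspan q hq).1⟩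
  · exact hre q
  · have h1 := (ContinuousMap.dist_apply_le_dist (f := G) (g := q) (x : AddCircle T)).trans hqG.le
    have h2 : G (x : AddCircle T) = g x :=
      AddCircle.liftIco_zero_coe_apply (f := fun x => (g x : ℂ)) (Ioo_subset_Ico_self hx)
    rw [h2, dist_eq_norm] at h1
    have h3 := (Complex.abs_re_le_norm _).trans h1
    simpa using h3

end completeness

end DoubleDiffusive

end

noncomputable section

namespace DoubleDiffusive

/-! ### Integration over the cell -/

theorem cellMeasure_eq_prod (α : ℝ) : cellMeasure α =
    (volume.restrict (Ioo 0 (2 * Real.pi / α))).prod (volume.restrict (Ioo (0 : ℝ) 1)) := by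
  rw [cellMeasure, Measure.prod_restrict, Measure.volume_eq_prod]

theorem ae_cell_mem (α : ℝ) :
    ∀ᵐ p ∂(cellMeasure α), p ∈ Ioo 0 (2 * Real.pi / α) ×ˢ Ioo (0 : ℝ) 1 :=
  ae_restrict_mem (measurableSet_Ioo.prod measurableSet_Ioo)

theorem integral_cell_mul (α : ℝ) (a b : ℝ → ℝ) :
    ∫ p, a p.1 * b p.2 ∂(cellMeasure α) =
      (∫ x in Ioo 0 (2 * Real.pi / α), a x) * ∫ z in Ioo (0 : ℝ) 1, b z := by
  rw [cellMeasure_eq_prod]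
  exact integral_prod_mul a b

theorem integrable_of_continuous {α : ℝ} {g : ℝ × ℝ → ℝ} (hg : Continuous g) :
    Integrable g (cellMeasure α) := by
  obtain ⟨C, hC⟩ := exists_bound (α := α) hg
  exact Integrable.of_bound hg.aestronglyMeasurable C hC

theorem IsTest.mul {α : ℝ} {φ χ : ℝ × ℝ → ℝ} (h : IsTest α φ) (h' : IsTest α χ) :
    IsTest α (fun p => φ p * χ p) :=
  ⟨h.1.mul h'.1, fun x z => by simp only [h.2 x z, h'.2 x z]⟩

theorem dir_mul {α : ℝ} {φ χ : ℝ × ℝ → ℝ} (h : IsTest α φ) (h' : IsTest α χ) (e p : ℝ × ℝ) :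
    dir e (fun p => φ p * χ p) p = dir e φ p * χ p + φ p * dir e χ p := by
  have h1 : DifferentiableAt ℝ φ p := (h.1.differentiable (by simp)) p
  have h2 : DifferentiableAt ℝ χ p := (h'.1.differentiable (by simp)) p
  unfold dir
  rw [fderiv_fun_mul h1 h2]
  simp
  ring

theorem IsTest.hasDerivAt_fst {α : ℝ} {φ : ℝ × ℝ → ℝ} (h : IsTest α φ) (x z : ℝ) :
    HasDerivAt (fun x => φ (x, z)) (dir ex φ (x, z)) x := by
  have h1 : HasFDerivAt φ (fderiv ℝ φ (x, z)) (x, z) :=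
    ((h.1.differentiable (by simp)) (x, z)).hasFDerivAt
  exact h1.comp_hasDerivAt x ((hasDerivAt_id x).prodMk (hasDerivAt_const x z))

theorem IsTest.hasDerivAt_snd {α : ℝ} {φ : ℝ × ℝ → ℝ} (h : IsTest α φ) (x z : ℝ) :
    HasDerivAt (fun z => φ (x, z)) (dir ez φ (x, z)) z := by
  have h1 : HasFDerivAt φ (fderiv ℝ φ (x, z)) (x, z) :=
    ((h.1.differentiable (by simp)) (x, z)).hasFDerivAt
  exact h1.comp_hasDerivAt z ((hasDerivAt_const z x).prodMk (hasDerivAt_id z))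

theorem IsTest.integral_dir_ex {α : ℝ} (hα : 0 < α) {g : ℝ × ℝ → ℝ} (h : IsTest α g) :
    ∫ p, dir ex g p ∂(cellMeasure α) = 0 := by
  have hi := integrable_of_continuous (α := α) (h.continuous_dir ex)
  rw [cellMeasure_eq_prod] at hi ⊢
  rw [integral_prod_symm _ hi]
  refine integral_eq_zero_of_ae (Eventually.of_forall fun z => ?_)
  refine integral_sub_eq_zero_of_hasDerivAt (F := fun x => g (x, z)) (by positivity)
    (fun x => h.hasDerivAt_fst x z) ((h.continuous_dir ex).comp (by fun_prop)) ?_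
  simpa using (h.2 0 z).symm

theorem IsTest.integral_dir_ez {α : ℝ} {g : ℝ × ℝ → ℝ} (h : IsTest α g)
    (h01 : ∀ x, g (x, 0) = g (x, 1)) :
    ∫ p, dir ez g p ∂(cellMeasure α) = 0 := by
  have hi := integrable_of_continuous (α := α) (h.continuous_dir ez)
  rw [cellMeasure_eq_prod] at hi ⊢
  rw [integral_prod _ hi]
  refine integral_eq_zero_of_ae (Eventually.of_forall fun x => ?_)
  exact integral_sub_eq_zero_of_hasDerivAt (F := fun z => g (x, z)) zero_le_one
    (fun z => h.hasDerivAt_snd x z) ((h.continuous_dir ez).comp (by fun_prop)) (h01 x)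

/-! ### Continuous functions as elements of `L²` -/

section emb

variable {𝕜 : Type} [RCLike 𝕜] {α : ℝ}

theorem memLp_of_continuous {c : ℝ × ℝ → ℝ} (hc : Continuous c) :
    MemLp (fun p => (c p : 𝕜)) 2 (cellMeasure α) := by
  obtain ⟨C, hC⟩ := exists_bound (α := α) hc
  exact MemLp.of_bound (RCLike.continuous_ofReal.comp hc).aestronglyMeasurable C
    (by filter_upwards [hC] with p hp; simpa using hp)

open scoped Classical in
variable (𝕜 α) in
/-- A real function as an element of `L²` (and `0` if it is not square integrable). -/
def emb (c : ℝ × ℝ → ℝ) : ScalarL2 𝕜 α :=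
  if h : MemLp (fun p => (c p : 𝕜)) 2 (cellMeasure α) then h.toLp _ else 0

theorem coeFn_emb {c : ℝ × ℝ → ℝ} (hc : Continuous c) :
    (emb 𝕜 α c : ℝ × ℝ → 𝕜) =ᵐ[cellMeasure α] fun p => (c p : 𝕜) := by
  rw [emb, dif_pos (memLp_of_continuous hc)]
  exact MemLp.coeFn_toLp _

theorem inner_emb {c : ℝ × ℝ → ℝ} (hc : Continuous c) (f : ScalarL2 𝕜 α) :
    inner 𝕜 (emb 𝕜 α c) f = pair c f := by
  rw [L2.inner_def, pair]
  refine integral_congr_ae ?_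
  filter_upwards [coeFn_emb (𝕜 := 𝕜) (α := α) hc] with p hp
  simp [hp, RCLike.real_smul_eq_coe_mul, mul_comm]

theorem pair_emb (c : ℝ × ℝ → ℝ) {d : ℝ × ℝ → ℝ} (hd : Continuous d) :
    pair c (emb 𝕜 α d) = ((∫ p, c p * d p ∂(cellMeasure α) : ℝ) : 𝕜) := by
  rw [pair, ← integral_ofReal]
  refine integral_congr_ae ?_
  filter_upwards [coeFn_emb (𝕜 := 𝕜) (α := α) hd] with p hp
  simp [hp, RCLike.real_smul_eq_coe_mul]

theorem emb_const_mul (r : ℝ) {c : ℝ × ℝ → ℝ} (hc : Continuous c) :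
    emb 𝕜 α (fun p => r * c p) = (r : 𝕜) • emb 𝕜 α c := by
  refine Lp.ext ?_
  filter_upwards [coeFn_emb (𝕜 := 𝕜) (α := α) hc, Lp.coeFn_smul (r : 𝕜) (emb 𝕜 α c),
    coeFn_emb (𝕜 := 𝕜) (α := α) (c := fun p => r * c p) (continuous_const.mul hc)]
    with p h1 h2 h3
  rw [h2, h3, Pi.smul_apply, h1]; simp

theorem pair_const_mul (r : ℝ) (c : ℝ × ℝ → ℝ) (f : ScalarL2 𝕜 α) :
    pair (fun p => r * c p) f = (r : 𝕜) * pair c f := by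
  rw [pair, pair, ← integral_const_mul]
  congr 1; funext p
  simp [RCLike.real_smul_eq_coe_mul, mul_assoc]

/-- The product rule under the integral. The direction and the boundary behaviour enter only through
the vanishing of the total derivative, which is periodicity in x or agreement of the product at the
two walls. -/
theorem pair_dir_emb {e : ℝ × ℝ} {φ c : ℝ × ℝ → ℝ} (hφ : IsTest α φ) (hc : IsTest α c)
    (h : ∫ p, dir e (fun p => φ p * c p) p ∂(cellMeasure α) = 0) :
    pair (dir e φ) (emb 𝕜 α c) = -pair φ (emb 𝕜 α (dir e c)) := by
  rw [pair_emb _ hc.continuous, pair_emb _ (hc.continuous_dir e), ← RCLike.ofReal_neg]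
  congr 1
  rw [integral_congr_ae (Eventually.of_forall (dir_mul hφ hc e)), integral_add] at h
  · linarith
  · exact integrable_of_continuous ((hφ.continuous_dir e).mul hc.continuous)
  · exact integrable_of_continuous (hφ.continuous.mul (hc.continuous_dir e))

theorem weakDeriv_emb_ex (hα : 0 < α) {c : ℝ × ℝ → ℝ} (hc : IsTest α c) :
    WeakDeriv ex (emb 𝕜 α c) (emb 𝕜 α (dir ex c)) := fun _ hφ =>
  pair_dir_emb hφ.1 hc ((hφ.1.mul hc).integral_dir_ex hα)

theorem weakDeriv_emb_ez {c : ℝ × ℝ → ℝ} (hc : IsTest α c) :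
    WeakDeriv ez (emb 𝕜 α c) (emb 𝕜 α (dir ez c)) := by
  rintro φ ⟨hφ, ε, hε, h0⟩
  refine pair_dir_emb hφ hc ((hφ.mul hc).integral_dir_ez fun x => ?_)
  rw [h0 x 0 (Or.inl hε), h0 x 1 (Or.inr (by linarith))]
  simp

theorem zeroTraceDeriv_emb {c : ℝ × ℝ → ℝ} (hc : IsTest α c)
    (h0 : ∀ x, c (x, 0) = 0) (h1 : ∀ x, c (x, 1) = 0) :
    ZeroTraceDeriv (emb 𝕜 α c) (emb 𝕜 α (dir ez c)) := fun φ hφ =>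
  pair_dir_emb hφ hc ((hφ.mul hc).integral_dir_ez fun x => by simp [h0, h1])

end emb

/-! ### Products of trigonometric modes -/

/-- The product of the mode `n` in `x` and the sine mode `l` in `z`. -/
def sMode (α : ℝ) (n : ℤ) (l : ℕ) (p : ℝ × ℝ) : ℝ := xMode α n p.1 * sinMode l p.2

/-- The product of the mode `n` in `x` and the cosine mode `l` in `z`. -/
def cMode (α : ℝ) (n : ℤ) (l : ℕ) (p : ℝ × ℝ) : ℝ := xMode α n p.1 * cosMode l p.2

section prodModes

variable {α : ℝ}

theorem isTest_sMode (hα : 0 < α) (n : ℤ) (l : ℕ) : IsTest α (sMode α n l) :=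
  ⟨((contDiff_xMode α n).comp contDiff_fst).mul ((contDiff_sinMode l).comp contDiff_snd),
    fun x z => by simp [sMode, xMode_periodic hα]⟩

theorem isTest_cMode (hα : 0 < α) (n : ℤ) (l : ℕ) : IsTest α (cMode α n l) :=
  ⟨((contDiff_xMode α n).comp contDiff_fst).mul ((contDiff_cosMode l).comp contDiff_snd),
    fun x z => by simp [cMode, xMode_periodic hα]⟩

theorem continuous_sMode (n : ℤ) (l : ℕ) : Continuous (sMode α n l) :=
  ((continuous_xMode α n).comp continuous_fst).mul ((continuous_sinMode l).comp continuous_snd)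

theorem continuous_cMode (n : ℤ) (l : ℕ) : Continuous (cMode α n l) :=
  ((continuous_xMode α n).comp continuous_fst).mul ((continuous_cosMode l).comp continuous_snd)

theorem dir_ex_sMode (hα : 0 < α) (n : ℤ) (l : ℕ) :
    dir ex (sMode α n l) = fun p => n * α * sMode α (-n) l p := by
  funext ⟨x, z⟩
  refine ((isTest_sMode hα n l).hasDerivAt_fst x z).unique ?_
  exact ((hasDerivAt_xMode α n x).mul_const (sinMode l z)).congr_deriv (by simp [sMode]; ring)

theorem dir_ez_sMode (hα : 0 < α) (n : ℤ) (l : ℕ) :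
    dir ez (sMode α n l) = fun p => l * Real.pi * cMode α n l p := by
  funext ⟨x, z⟩
  refine ((isTest_sMode hα n l).hasDerivAt_snd x z).unique ?_
  exact ((hasDerivAt_sinMode l z).const_mul (xMode α n x)).congr_deriv (by simp [cMode]; ring)

theorem dir_ex_cMode (hα : 0 < α) (n : ℤ) (l : ℕ) :
    dir ex (cMode α n l) = fun p => n * α * cMode α (-n) l p := by
  funext ⟨x, z⟩
  refine ((isTest_cMode hα n l).hasDerivAt_fst x z).unique ?_
  exact ((hasDerivAt_xMode α n x).mul_const (cosMode l z)).congr_deriv (by simp [cMode]; ring)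

theorem dir_ez_cMode (hα : 0 < α) (n : ℤ) (l : ℕ) :
    dir ez (cMode α n l) = fun p => -(l * Real.pi) * sMode α n l p := by
  funext ⟨x, z⟩
  refine ((isTest_cMode hα n l).hasDerivAt_snd x z).unique ?_
  exact ((hasDerivAt_cosMode l z).const_mul (xMode α n x)).congr_deriv (by simp [sMode]; ring)

theorem integral_sMode_mul (hα : 0 < α) (n m : ℤ) {l : ℕ} (k : ℕ) (hl : l ≠ 0) :
    ∫ p, sMode α n l p * sMode α m k p ∂(cellMeasure α) = if n = m ∧ l = k then 1 else 0 := by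
  have e : ∀ p : ℝ × ℝ, sMode α n l p * sMode α m k p =
      (fun x => xMode α n x * xMode α m x) p.1 * (fun z => sinMode l z * sinMode k z) p.2 := by
    intro p; simp only [sMode]; ring
  rw [funext e, integral_cell_mul α (fun x => xMode α n x * xMode α m x) fun z => sinMode l z * sinMode k z,
    integral_xMode_mul hα, integral_sinMode_mul l k hl]
  split_ifs <;> simp_all

theorem integral_cMode_mul (hα : 0 < α) (n m : ℤ) {l : ℕ} (k : ℕ) (hl : l ≠ 0) :
    ∫ p, cMode α n l p * cMode α m k p ∂(cellMeasure α) = if n = m ∧ l = k then 1 else 0 := by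
  have e : ∀ p : ℝ × ℝ, cMode α n l p * cMode α m k p =
      (fun x => xMode α n x * xMode α m x) p.1 * (fun z => cosMode l z * cosMode k z) p.2 := by
    intro p; simp only [cMode]; ring
  rw [funext e, integral_cell_mul α (fun x => xMode α n x * xMode α m x) fun z => cosMode l z * cosMode k z,
    integral_xMode_mul hα, integral_cosMode_mul l k hl]
  split_ifs <;> simp_all

variable {𝕜 : Type} [RCLike 𝕜]

theorem pair_sMode_emb (hα : 0 < α) (n m : ℤ) {l : ℕ} (k : ℕ) (hl : l ≠ 0) :
    pair (sMode α n l) (emb 𝕜 α (sMode α m k)) = if n = m ∧ l = k then 1 else 0 := by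
  rw [pair_emb _ (continuous_sMode m k), integral_sMode_mul hα n m k hl]
  split_ifs <;> simp

theorem pair_cMode_emb (hα : 0 < α) (n m : ℤ) {l : ℕ} (k : ℕ) (hl : l ≠ 0) :
    pair (cMode α n l) (emb 𝕜 α (cMode α m k)) = if n = m ∧ l = k then 1 else 0 := by
  rw [pair_emb _ (continuous_cMode m k), integral_cMode_mul hα n m k hl]
  split_ifs <;> simp

theorem orthonormal_sMode (hα : 0 < α) :
    Orthonormal 𝕜 fun q : ℤ × ℕ => emb 𝕜 α (sMode α q.1 (q.2 + 1)) := by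
  classical
  rw [orthonormal_iff_ite]
  intro q r
  rw [inner_emb (continuous_sMode _ _), pair_sMode_emb hα _ _ _ (by omega)]
  simp [Prod.ext_iff]

theorem orthonormal_cMode (hα : 0 < α) :
    Orthonormal 𝕜 fun q : ℤ × ℕ => emb 𝕜 α (cMode α q.1 (q.2 + 1)) := by
  classical
  rw [orthonormal_iff_ite]
  intro q r
  rw [inner_emb (continuous_cMode _ _), pair_cMode_emb hα _ _ _ (by omega)]
  simp [Prod.ext_iff]

/-- By Fubini each cosine coefficient in z is an integrable function of x with vanishing modes,
hence zero almost everywhere. There are countably many coefficients, so for almost every x all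
cosine moments of f(x,·) vanish at once. -/
theorem ae_eq_zero_of_integral_cMode (hα : 0 < α) {f : ℝ × ℝ → 𝕜} (hm : StronglyMeasurable f)
    (hf : Integrable f (cellMeasure α))
    (h : ∀ n l, ∫ p, cMode α n l p • f p ∂(cellMeasure α) = 0) : f =ᵐ[cellMeasure α] 0 := by
  have hI : ∀ l, Integrable (fun p => cosMode l p.2 • f p) (cellMeasure α) := fun l => by
    have hc : Continuous fun p : ℝ × ℝ => cosMode l p.2 := (continuous_cosMode l).comp continuous_snd
    obtain ⟨C, hC⟩ := exists_bound (α := α) hc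
    exact hf.bdd_smul C hc.aestronglyMeasurable hC
  have hI2 : ∀ n l, Integrable (fun p => cMode α n l p • f p) (cellMeasure α) := fun n l => by
    obtain ⟨C, hC⟩ := exists_bound (α := α) (continuous_cMode (α := α) n l)
    exact hf.bdd_smul C (continuous_cMode n l).aestronglyMeasurable hC
  rw [cellMeasure_eq_prod] at hf hI hI2 h ⊢
  have h1 : ∀ l : ℕ, ∀ᵐ x ∂(volume.restrict (Ioo (0 : ℝ) (2 * Real.pi / α))),
      ∫ z in Ioo (0 : ℝ) 1, cosMode l z • f (x, z) = 0 := by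
    intro l
    refine ae_eq_zero_of_integral_xMode hα (hI l).integral_prod_left fun n => ?_
    rw [← h n l, integral_prod _ (hI2 n l)]
    congr 1; funext x
    rw [← integral_smul]
    simp only [cMode, mul_smul]
  refine (Measure.ae_prod_iff_ae_ae (p := fun p => f p = 0)
    (measurableSet_eq_fun hm.measurable measurable_const)).mpr ?_
  filter_upwards [ae_all_iff.mpr h1, hf.prod_right_ae] with x hx hi
  refine ae_eq_zero_of_integral_cos hi fun l => ?_
  have e := hx l
  simp only [cosMode, mul_smul] at e
  rw [integral_smul] at e
  exact (smul_eq_zero.mp e).resolve_left (by positivity)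

theorem eq_zero_of_pair_cMode (hα : 0 < α) (f : ScalarL2 𝕜 α)
    (h : ∀ n l, pair (cMode α n l) f = 0) : f = 0 := by
  refine Lp.ext ?_
  filter_upwards [ae_eq_zero_of_integral_cMode hα (Lp.stronglyMeasurable f)
    ((Lp.memLp f).integrable (by norm_num)) h, Lp.coeFn_zero 𝕜 2 (cellMeasure α)] with p h1 h2
  rw [h1, h2]

/-- Sine completeness follows from cosine completeness applied to sin(πz) f: its cosine coefficients
are combinations of sine coefficients of f, and sin πz has no zero in (0,1). -/
theorem eq_zero_of_pair_sMode (hα : 0 < α) (f : ScalarL2 𝕜 α)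
    (h : ∀ n l, pair (sMode α n (l + 1)) f = 0) : f = 0 := by
  have h' : ∀ n l, pair (sMode α n l) f = 0 := by
    intro n l
    rcases l with _ | l
    · have : sMode α n 0 = fun _ => 0 := by funext p; simp [sMode, sinMode]
      rw [this, pair]; simp
    · exact h n l
  have hc : Continuous fun p : ℝ × ℝ => Real.sin (Real.pi * p.2) := by fun_prop
  have key := ae_eq_zero_of_integral_cMode (𝕜 := 𝕜) hα
    (f := fun p => Real.sin (Real.pi * p.2) • f p)
    (hc.stronglyMeasurable.smul (Lp.stronglyMeasurable f)) (integrable_pair hc f) fun n l => by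
      have e : ∀ p : ℝ × ℝ, cMode α n l p • Real.sin (Real.pi * p.2) • f p =
          (1 / 2 : ℝ) • (sMode α n (l + 1) p • f p) +
          -- For l ≥ 1 this is cos(lπz) sin(πz) = (sin((l+1)πz) - sin((l-1)πz))/2. For l = 0 the two
          -- halves are the same sine with equal signs.
          (if l = 0 then 1 / 2 else -1 / 2 : ℝ) • (sMode α n (if l = 0 then 1 else l - 1) p • f p) := by
        intro p
        rw [smul_smul, smul_smul, smul_smul, ← add_smul]
        congr 1
        simp only [cMode, sMode, sinMode, cosMode]
        rcases l with _ | l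
        · simp; ring
        · simp only [Nat.add_eq_zero_iff, one_ne_zero, and_false, if_false, Nat.add_sub_cancel]
          have h1 : ((l + 1 + 1 : ℕ) : ℝ) * Real.pi * p.2 =
              (l + 1 : ℕ) * Real.pi * p.2 + Real.pi * p.2 := by push_cast; ring
          have h2 : (l : ℝ) * Real.pi * p.2 = (l + 1 : ℕ) * Real.pi * p.2 - Real.pi * p.2 := by
            push_cast; ring
          rw [h1, h2, Real.sin_add, Real.sin_sub]
          ring
      simp_rw [e]
      rw [integral_add, integral_smul, integral_smul]
      · have h1 := h' n (l + 1)
        have h2 := h' n (if l = 0 then 1 else l - 1)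
        rw [pair] at h1 h2
        rw [h1, h2]; simp
      · exact Integrable.fun_smul _ (integrable_pair (continuous_sMode n _) f)
      · exact Integrable.fun_smul _ (integrable_pair (continuous_sMode n _) f)
  refine Lp.ext ?_
  filter_upwards [key, ae_cell_mem α, Lp.coeFn_zero 𝕜 2 (cellMeasure α)] with p h1 h2 h3
  have hs : Real.sin (Real.pi * p.2) ≠ 0 := by
    refine (Real.sin_pos_of_pos_of_lt_pi (mul_pos Real.pi_pos h2.2.1) ?_).ne'
    nlinarith [h2.2.2, Real.pi_pos]
  rw [h3]
  exact (smul_eq_zero.mp h1).resolve_left hs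

end prodModes

end DoubleDiffusive

end

noncomputable section

namespace DoubleDiffusive

/-! ### Weak derivatives tested up to the walls -/

section cutoff

/-- A smooth function of `z` that vanishes outside `(0,1)` and tends to `1` inside as `k → ∞`. -/
def cutoff (k : ℕ) (z : ℝ) : ℝ := Real.smoothTransition (k * (z * (1 - z)) - 1)

theorem contDiff_cutoff (k : ℕ) : ContDiff ℝ ∞ (cutoff k) :=
  Real.smoothTransition.contDiff.comp (by fun_prop)

theorem cutoff_mem (k : ℕ) (z : ℝ) : |cutoff k z| ≤ 1 := by
  rw [cutoff, abs_of_nonneg (Real.smoothTransition.nonneg _)]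
  exact Real.smoothTransition.le_one _

theorem deriv_smoothTransition_eq_zero {y : ℝ} (h : y < 0 ∨ 1 < y) :
    deriv Real.smoothTransition y = 0 := by
  rcases h with h | h
  · have : Real.smoothTransition =ᶠ[𝓝 y] fun _ => 0 := by
      filter_upwards [Iio_mem_nhds h] with x hx
      exact Real.smoothTransition.zero_of_nonpos hx.le
    rw [this.deriv_eq]; simp
  · have : Real.smoothTransition =ᶠ[𝓝 y] fun _ => 1 := by
      filter_upwards [Ioi_mem_nhds h] with x hx
      exact Real.smoothTransition.one_of_one_le hx.le
    rw [this.deriv_eq]; simp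

/-- In the cutoff, y + 1 equals k z(1-z). The bound thus says that the derivative of the k-th cutoff
times z(1-z) is bounded uniformly in k. -/
theorem exists_bound_deriv_smoothTransition :
    ∃ B : ℝ, ∀ y, |deriv Real.smoothTransition y * (y + 1)| ≤ B := by
  have hc : Continuous (deriv Real.smoothTransition) :=
    (Real.smoothTransition.contDiff (n := 1)).continuous_deriv le_rfl
  obtain ⟨B, hB⟩ := (isCompact_Icc (a := (0 : ℝ)) (b := 1)).exists_bound_of_continuousOn
    (f := fun y => deriv Real.smoothTransition y * (y + 1)) (by fun_prop)
  refine ⟨max B 0, fun y => ?_⟩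
  by_cases hy : y ∈ Icc (0 : ℝ) 1
  · exact (hB y hy).trans (le_max_left _ _)
  · rw [deriv_smoothTransition_eq_zero, zero_mul, abs_zero]
    · exact le_max_right _ _
    · rw [mem_Icc, not_and_or, not_le, not_le] at hy; exact hy

theorem hasDerivAt_cutoff (k : ℕ) (z : ℝ) :
    HasDerivAt (cutoff k)
      (deriv Real.smoothTransition (k * (z * (1 - z)) - 1) * (k * (1 - 2 * z))) z := by
  have h1 : HasDerivAt Real.smoothTransition
      (deriv Real.smoothTransition (k * (z * (1 - z)) - 1)) (k * (z * (1 - z)) - 1) :=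
    ((Real.smoothTransition.contDiff (n := 1)).differentiable (by simp) _).hasDerivAt
  have h2 : HasDerivAt (fun z : ℝ => (k : ℝ) * (z * (1 - z)) - 1) (k * (1 - 2 * z)) z := by
    have := (((hasDerivAt_id z).mul ((hasDerivAt_id z).const_sub 1)).const_mul (k : ℝ)).sub_const 1
    exact this.congr_deriv (by simp only [id]; ring)
  exact h1.comp z h2

variable {α : ℝ}

theorem isTest_cutoff (k : ℕ) : IsTest α fun p => cutoff k p.2 :=
  ⟨(contDiff_cutoff k).comp contDiff_snd, fun _ _ => rfl⟩

theorem IsTest.mul_cutoff {φ : ℝ × ℝ → ℝ} (h : IsTest α φ) (k : ℕ) :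
    IsInteriorTest α fun p => φ p * cutoff k p.2 := by
  -- Below height 1/(k+1) one has k z(1-z) ≤ 1, where the transition function still vanishes; k + 1
  -- instead of k covers k = 0.
  refine ⟨h.mul (isTest_cutoff k), 1 / (k + 1), by positivity, fun x z hz => ?_⟩
  have hk : (0 : ℝ) ≤ k := Nat.cast_nonneg k
  have key : ∀ w : ℝ, w < 1 / (k + 1) → (k : ℝ) * (w * (1 - w)) - 1 ≤ 0 := by
    intro w hw
    rw [lt_div_iff₀ (by positivity)] at hw
    nlinarith [mul_nonneg hk (sq_nonneg w), mul_nonneg hk (sq_nonneg (w - 1)), sq_nonneg w]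
  have : cutoff k z = 0 := by
    refine Real.smoothTransition.zero_of_nonpos ?_
    rcases hz with hz | hz
    · exact key z hz
    · have := key (1 - z) (by linarith)
      linarith [show (1 - z) * (1 - (1 - z)) = z * (1 - z) by ring]
  simp [this]

theorem eventually_one_lt {z : ℝ} (hz : z ∈ Ioo (0 : ℝ) 1) :
    ∀ᶠ k : ℕ in atTop, 1 < (k : ℝ) * (z * (1 - z)) - 1 := by
  have hpos : 0 < z * (1 - z) := mul_pos hz.1 (by linarith [hz.2])
  have := (tendsto_natCast_atTop_atTop (R := ℝ)).atTop_mul_const hpos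
  filter_upwards [this.eventually_gt_atTop 2] with k hk
  linarith

variable {𝕜 : Type} [RCLike 𝕜]

theorem tendsto_pair {c : ℕ → ℝ × ℝ → ℝ} {d : ℝ × ℝ → ℝ} (C : ℝ) (hc : ∀ k, Continuous (c k))
    (hb : ∀ k, ∀ x z, z ∈ Ioo (0 : ℝ) 1 → x ∈ Ioo 0 (2 * Real.pi / α) → |c k (x, z)| ≤ C)
    (hl : ∀ x z, z ∈ Ioo (0 : ℝ) 1 → ∀ᶠ k in atTop, c k (x, z) = d (x, z)) (f : ScalarL2 𝕜 α) :
    Tendsto (fun k => pair (c k) f) atTop (𝓝 (pair d f)) := by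
  have hf : Integrable f (cellMeasure α) := (Lp.memLp f).integrable (by norm_num)
  refine tendsto_integral_of_dominated_convergence (fun p => C * ‖f p‖)
    (fun k => (integrable_pair (hc k) f).1) (hf.norm.const_mul C) (fun k => ?_) ?_
  · filter_upwards [ae_cell_mem α] with p hp
    rw [norm_smul]
    exact mul_le_mul_of_nonneg_right (hb k p.1 p.2 hp.2 hp.1) (norm_nonneg _)
  · filter_upwards [ae_cell_mem α] with p hp
    refine tendsto_const_nhds.congr' ?_
    filter_upwards [hl p.1 p.2 hp.2] with k hk
    rw [show c k p = d p from hk]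

theorem exists_bound_cell {c : ℝ × ℝ → ℝ} (hc : Continuous c) :
    ∃ C : ℝ, 0 ≤ C ∧ ∀ x z, z ∈ Ioo (0 : ℝ) 1 → x ∈ Ioo 0 (2 * Real.pi / α) → |c (x, z)| ≤ C := by
  have hK : IsCompact (Icc (0 : ℝ) (2 * Real.pi / α) ×ˢ Icc (0 : ℝ) 1) :=
    isCompact_Icc.prod isCompact_Icc
  obtain ⟨C, hC⟩ := hK.exists_bound_of_continuousOn hc.continuousOn
  exact ⟨max C 0, le_max_right _ _, fun x z hz hx =>
    (hC (x, z) ⟨Ioo_subset_Icc_self hx, Ioo_subset_Icc_self hz⟩).trans (le_max_left _ _)⟩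

theorem tendsto_pair_mul_cutoff {φ : ℝ × ℝ → ℝ} (hφ : Continuous φ) (f : ScalarL2 𝕜 α) :
    Tendsto (fun k => pair (fun p => φ p * cutoff k p.2) f) atTop (𝓝 (pair φ f)) := by
  obtain ⟨C, hC0, hC⟩ := exists_bound_cell (α := α) hφ
  refine tendsto_pair C (fun k => hφ.mul (isTest_cutoff (α := α) k).continuous)
    (fun k x z hz hx => ?_) (fun x z hz => ?_) f
  · change |φ (x, z) * cutoff k z| ≤ C
    rw [abs_mul]
    exact (mul_le_mul (hC x z hz hx) (cutoff_mem k z) (abs_nonneg _) hC0).trans (mul_one C).le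
  · filter_upwards [eventually_one_lt hz] with k hk
    simp [cutoff, Real.smoothTransition.one_of_one_le hk.le]

theorem dir_ex_cutoff (k : ℕ) : dir ex (fun p : ℝ × ℝ => cutoff k p.2) = fun _ => 0 := by
  funext ⟨x, z⟩
  exact ((isTest_cutoff (α := 0) k).hasDerivAt_fst x z).unique (hasDerivAt_const x (cutoff k z))

theorem dir_ez_cutoff (k : ℕ) (x z : ℝ) : dir ez (fun p : ℝ × ℝ => cutoff k p.2) (x, z) =
    deriv Real.smoothTransition (k * (z * (1 - z)) - 1) * (k * (1 - 2 * z)) :=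
  ((isTest_cutoff (α := 0) k).hasDerivAt_snd x z).unique (hasDerivAt_cutoff k z)

/-- The cutoff depends on z alone and commutes with ∂/∂x, so it can be removed in the limit with no
error term: x-derivatives may be tested by functions that do not vanish at the walls. -/
theorem WeakDeriv.pair_dir_ex {f g : ScalarL2 𝕜 α} (h : WeakDeriv ex f g) {φ : ℝ × ℝ → ℝ}
    (hφ : IsTest α φ) : pair (dir ex φ) f = -pair φ g := by
  refine tendsto_nhds_unique (tendsto_pair_mul_cutoff (hφ.continuous_dir ex) f)
    (((tendsto_pair_mul_cutoff hφ.continuous g).neg).congr fun k => ?_)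
  rw [← h _ (hφ.mul_cutoff k)]
  congr 1
  funext p
  rw [dir_mul hφ (isTest_cutoff k), dir_ex_cutoff]
  simp

/-- Removing the cutoff leaves the error φ χ_k′. It is uniformly bounded, because φ is O(z(1-z))
while χ_k′ is O(k) and lives where k z(1-z) is of order 1. At every interior point it is eventually
0, so dominated convergence applies. -/
theorem WeakDeriv.pair_dir_ez {f g : ScalarL2 𝕜 α} (h : WeakDeriv ez f g) {φ : ℝ × ℝ → ℝ}
    (hφ : IsTest α φ) {C : ℝ}
    (hC : ∀ x z, z ∈ Ioo (0 : ℝ) 1 → |φ (x, z)| ≤ C * (z * (1 - z))) :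
    pair (dir ez φ) f = -pair φ g := by
  refine tendsto_nhds_unique ?_ (((tendsto_pair_mul_cutoff hφ.continuous g).neg).congr fun k =>
    (h _ (hφ.mul_cutoff k)).symm)
  obtain ⟨D, hD0, hD⟩ := exists_bound_cell (α := α) (hφ.continuous_dir ez)
  obtain ⟨B, hB⟩ := exists_bound_deriv_smoothTransition
  have hC0 : 0 ≤ C := by
    have := (abs_nonneg _).trans (hC 0 (1 / 2) (by norm_num))
    norm_num at this; linarith
  refine tendsto_pair (D + C * B) (fun k => (hφ.mul_cutoff k).1.continuous_dir ez)
    (fun k x z hz hx => ?_) (fun x z hz => ?_) f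
  · rw [dir_mul hφ (isTest_cutoff k), dir_ez_cutoff]
    refine (abs_add_le _ _).trans (add_le_add ?_ ?_)
    · rw [abs_mul]
      exact (mul_le_mul (hD x z hz hx) (cutoff_mem k z) (abs_nonneg _) hD0).trans (mul_one D).le
    · have hq : 0 ≤ z * (1 - z) := mul_nonneg hz.1.le (by linarith [hz.2])
      have h1 : |1 - 2 * z| ≤ 1 := by rw [abs_le]; constructor <;> linarith [hz.1, hz.2]
      have h2 := hB (k * (z * (1 - z)) - 1)
      rw [sub_add_cancel, abs_mul, abs_of_nonneg (show 0 ≤ (k : ℝ) * (z * (1 - z)) by positivity)]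
        at h2
      rw [abs_mul, abs_mul, abs_mul, Nat.abs_cast]
      -- The factor z(1-z) from φ is moved over to compensate the factor k from the derivative of
      -- the cutoff.
      calc _ ≤ C * (z * (1 - z)) *
            (|deriv Real.smoothTransition (k * (z * (1 - z)) - 1)| * (k * 1)) := by
            gcongr
            exact hC x z hz
        _ = C * (|deriv Real.smoothTransition (k * (z * (1 - z)) - 1)| * (k * (z * (1 - z)))) := by
            ring
        _ ≤ C * B := by gcongr
  · filter_upwards [eventually_one_lt hz] with k hk
    rw [dir_mul hφ (isTest_cutoff k), dir_ez_cutoff, deriv_smoothTransition_eq_zero (Or.inr hk)]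
    simp [cutoff, Real.smoothTransition.one_of_one_le hk.le]

/-- The sine is at most lπ times the distance to either wall, and the smaller of z and 1-z is at
most 2z(1-z). -/
theorem abs_sinMode_le (l : ℕ) {z : ℝ} (hz : z ∈ Ioo (0 : ℝ) 1) :
    |sinMode l z| ≤ 2 * √2 * (l * Real.pi) * (z * (1 - z)) := by
  have h1 : |Real.sin (l * Real.pi * z)| ≤ l * Real.pi * z := by
    have hz' := hz.1.le
    exact (Real.abs_sin_le_abs).trans (abs_of_nonneg (by positivity)).le
  have h2 : |Real.sin (l * Real.pi * z)| ≤ l * Real.pi * (1 - z) := by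
    have hz' : 0 ≤ 1 - z := by linarith [hz.2]
    have e : |Real.sin (l * Real.pi * z)| = |Real.sin (l * Real.pi * (1 - z))| := by
      have : l * Real.pi * (1 - z) = l * Real.pi - l * Real.pi * z := by ring
      rw [this, Real.sin_nat_mul_pi_sub]
      simp [abs_mul]
    rw [e]
    exact (Real.abs_sin_le_abs).trans (abs_of_nonneg (by positivity)).le
  rw [sinMode, abs_mul, abs_of_nonneg (Real.sqrt_nonneg 2)]
  have h3 : |Real.sin (l * Real.pi * z)| ≤ 2 * (l * Real.pi) * (z * (1 - z)) := by
    have hl : 0 ≤ (l : ℝ) * Real.pi := by positivity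
    rcases le_total z (1 / 2) with h | h
    · nlinarith [mul_nonneg (mul_nonneg hl hz.1.le) (show 0 ≤ 1 - 2 * z by linarith)]
    · nlinarith [mul_nonneg (mul_nonneg hl (show 0 ≤ 1 - z by linarith [hz.2]))
        (show 0 ≤ 2 * z - 1 by linarith)]
  calc _ ≤ √2 * (2 * (l * Real.pi) * (z * (1 - z))) := by gcongr
    _ = _ := by ring

/-- Sine modes vanish linearly at the walls, so they are admissible against any weak z-derivative,
without a boundary condition on f. -/
theorem WeakDeriv.pair_sMode_ez (hα : 0 < α) {f g : ScalarL2 𝕜 α} (h : WeakDeriv ez f g)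
    (n : ℤ) (l : ℕ) : pair (dir ez (sMode α n l)) f = -pair (sMode α n l) g := by
  obtain ⟨D, hD⟩ : ∃ D : ℝ, ∀ x, |xMode α n x| ≤ D := by
    refine ⟨√(α / (2 * Real.pi)) + √(α / Real.pi), fun x => ?_⟩
    have h1 := Real.sqrt_nonneg (α / (2 * Real.pi))
    have h2 := Real.sqrt_nonneg (α / Real.pi)
    unfold xMode
    split_ifs
    · rw [abs_of_nonneg h1]; linarith
    · rw [abs_mul, abs_of_nonneg h2]
      nlinarith [Real.abs_cos_le_one (n * α * x)]
    · rw [abs_mul, abs_of_nonneg h2]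
      nlinarith [Real.abs_sin_le_one (n * α * x)]
  refine h.pair_dir_ez (isTest_sMode hα n l) (C := D * (2 * √2 * (l * Real.pi)))
    fun x z hz => ?_
  have hD0 := (abs_nonneg _).trans (hD 0)
  rw [sMode, abs_mul, mul_assoc]
  exact mul_le_mul (hD x) (abs_sinMode_le l hz) (abs_nonneg _) hD0

end cutoff

end DoubleDiffusive

end

noncomputable section

namespace DoubleDiffusive

/-! ### An orthonormal basis of `H` -/

/-- Sine and cosine of the angle between the wave vector and the vertical. -/
def dirX (α : ℝ) (p : ℤ × ℕ) : ℝ := p.1 * α / √(gammaSq α p.1 (p.2 + 1))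

/-- See `dirX`. -/
def dirZ (α : ℝ) (p : ℤ × ℕ) : ℝ := (p.2 + 1 : ℕ) * Real.pi / √(gammaSq α p.1 (p.2 + 1))

theorem gammaSq_ge (α : ℝ) (n : ℤ) (l : ℕ) : (l : ℝ) ^ 2 * Real.pi ^ 2 ≤ gammaSq α n l := by
  unfold gammaSq
  nlinarith [mul_nonneg (sq_nonneg (n : ℝ)) (sq_nonneg α)]

theorem gammaSq_pos (α : ℝ) (n : ℤ) {l : ℕ} (hl : 1 ≤ l) : 0 < gammaSq α n l := by
  refine lt_of_lt_of_le ?_ (gammaSq_ge α n l)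
  have : (0 : ℝ) < l := by exact_mod_cast hl
  positivity

theorem dirX_sq_add_dirZ_sq (α : ℝ) (p : ℤ × ℕ) : dirX α p ^ 2 + dirZ α p ^ 2 = 1 := by
  have h := gammaSq_pos α p.1 (l := p.2 + 1) (by omega)
  rw [dirX, dirZ, div_pow, div_pow, Real.sq_sqrt h.le, ← add_div, div_eq_one_iff_eq h.ne']
  unfold gammaSq; ring

theorem dirX_sq (α : ℝ) (p : ℤ × ℕ) :
    dirX α p ^ 2 = (p.1 : ℝ) ^ 2 * α ^ 2 / gammaSq α p.1 (p.2 + 1) := by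
  rw [dirX, div_pow, Real.sq_sqrt (gammaSq_pos α p.1 (l := p.2 + 1) (by omega)).le, mul_pow]

theorem abs_dirX_le (α : ℝ) (p : ℤ × ℕ) : |dirX α p| ≤ 1 := by
  have := dirX_sq_add_dirZ_sq α p
  rw [← sq_le_one_iff_abs_le_one]; nlinarith [sq_nonneg (dirZ α p)]

theorem abs_dirZ_le (α : ℝ) (p : ℤ × ℕ) : |dirZ α p| ≤ 1 := by
  have := dirX_sq_add_dirZ_sq α p
  rw [← sq_le_one_iff_abs_le_one]; nlinarith [sq_nonneg (dirX α p)]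

/-- The scalar mode in the component `c` of the basis fields with wave numbers `p`. -/
def compFn (α : ℝ) (c : Fin 4) (p : ℤ × ℕ) : ℝ × ℝ → ℝ :=
  if c = 0 then cMode α (-p.1) (p.2 + 1) else sMode α p.1 (p.2 + 1)

/-- The coefficient of the scalar mode in the component `c` of the `k`-th basis field. -/
def compCoef (α : ℝ) (p : ℤ × ℕ) (c : Fin 4) (k : Fin 3) : ℝ :=
  ![![dirZ α p, 0, 0], ![dirX α p, 0, 0], ![0, 1, 0], ![0, 0, 1]] c k

theorem abs_compCoef_le (α : ℝ) (p : ℤ × ℕ) (c : Fin 4) (k : Fin 3) : |compCoef α p c k| ≤ 1 := by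
  fin_cases c <;> fin_cases k <;> simp [compCoef, abs_dirX_le, abs_dirZ_le]

section basis

variable {𝕜 : Type} [RCLike 𝕜] {α : ℝ}

theorem isTest_compFn (hα : 0 < α) (c : Fin 4) (p : ℤ × ℕ) : IsTest α (compFn α c p) := by
  unfold compFn; split_ifs
  · exact isTest_cMode hα _ _
  · exact isTest_sMode hα _ _

theorem continuous_compFn (c : Fin 4) (p : ℤ × ℕ) : Continuous (compFn α c p) := by
  unfold compFn; split_ifs
  · exact continuous_cMode _ _
  · exact continuous_sMode _ _

theorem orthonormal_compFn (hα : 0 < α) (c : Fin 4) :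
    Orthonormal 𝕜 fun p : ℤ × ℕ => emb 𝕜 α (compFn α c p) := by
  unfold compFn; split_ifs
  · refine (orthonormal_cMode hα).comp (fun p : ℤ × ℕ => (-p.1, p.2)) fun p q h => ?_
    simp only [Prod.mk.injEq, neg_inj] at h
    exact Prod.ext h.1 h.2
  · exact orthonormal_sMode hα

theorem pair_compFn_emb (hα : 0 < α) (c : Fin 4) (p q : ℤ × ℕ) :
    pair (compFn α c p) (emb 𝕜 α (compFn α c q)) = if p = q then 1 else 0 := by
  classical
  rw [← inner_emb (continuous_compFn c p)]
  exact orthonormal_iff_ite.mp (orthonormal_compFn hα c) p q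

variable (𝕜 α) in
/-- The basis fields. -/
def basisField (i : (ℤ × ℕ) × Fin 3) : Fields 𝕜 α :=
  WithLp.toLp 2 fun c => (compCoef α i.1 c i.2 : 𝕜) • emb 𝕜 α (compFn α c i.1)

theorem basisField_apply (i : (ℤ × ℕ) × Fin 3) (c : Fin 4) :
    basisField 𝕜 α i c = (compCoef α i.1 c i.2 : 𝕜) • emb 𝕜 α (compFn α c i.1) := rfl

theorem inner_basisField (i : (ℤ × ℕ) × Fin 3) (ψ : Fields 𝕜 α) :
    inner 𝕜 (basisField 𝕜 α i) ψ =
      ∑ c, (compCoef α i.1 c i.2 : 𝕜) * pair (compFn α c i.1) (ψ c) := by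
  rw [PiLp.inner_apply]
  refine Finset.sum_congr rfl fun c _ => ?_
  rw [basisField_apply, inner_smul_left, inner_emb (continuous_compFn c i.1), RCLike.conj_ofReal]

theorem orthonormal_basisField (hα : 0 < α) : Orthonormal 𝕜 (basisField 𝕜 α) := by
  classical
  rw [orthonormal_iff_ite]
  rintro ⟨p, k⟩ ⟨q, m⟩
  rw [inner_basisField]
  simp only [basisField_apply, pair_smul, pair_compFn_emb hα]
  by_cases h : p = q
  · subst h
    have h1 : (dirZ α p : 𝕜) * dirZ α p + (dirX α p : 𝕜) * dirX α p = 1 := by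
      have := dirX_sq_add_dirZ_sq α p
      rw [← RCLike.ofReal_mul, ← RCLike.ofReal_mul, ← RCLike.ofReal_add, ← RCLike.ofReal_one]
      congr 1; linarith
    fin_cases k <;> fin_cases m <;> simp [Fin.sum_univ_four, compCoef, h1]
  · simp [h]

theorem integral_cosMode {l : ℕ} (hl : l ≠ 0) : ∫ z in Ioo (0 : ℝ) 1, cosMode l z = 0 := by
  have h1 : ∫ z in Ioo (0 : ℝ) 1, l * Real.pi * cosMode l z = 0 :=
    integral_sub_eq_zero_of_hasDerivAt zero_le_one (hasDerivAt_sinMode l)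
      (continuous_const.mul (continuous_cosMode l)) (by simp)
  rw [integral_const_mul] at h1
  exact (mul_eq_zero.mp h1).resolve_left (by positivity)

theorem basisField_mem (hα : 0 < α) (i : (ℤ × ℕ) × Fin 3) : basisField 𝕜 α i ∈ H 𝕜 α := by
  obtain ⟨⟨n, l⟩, k⟩ := i
  refine ⟨fun φ hφ => ?_, ?_⟩
  · have h0 : pair (dir ex φ) (emb 𝕜 α (cMode α (-n) (l + 1))) =
        ((n * α : ℝ) : 𝕜) * pair φ (emb 𝕜 α (cMode α n (l + 1))) := by
      rw [pair_dir_emb hφ (isTest_cMode hα _ _)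
        ((hφ.mul (isTest_cMode hα _ _)).integral_dir_ex hα), dir_ex_cMode hα,
        emb_const_mul _ (continuous_cMode _ _), pair_smul, neg_neg]
      push_cast; ring
    have h1 : pair (dir ez φ) (emb 𝕜 α (sMode α n (l + 1))) =
        -((((l + 1 : ℕ) * Real.pi : ℝ) : 𝕜) * pair φ (emb 𝕜 α (cMode α n (l + 1)))) := by
      rw [pair_dir_emb hφ (isTest_sMode hα _ _)
        ((hφ.mul (isTest_sMode hα _ _)).integral_dir_ez fun x => by simp [sMode]), dir_ez_sMode hα,
        emb_const_mul _ (continuous_cMode _ _), pair_smul]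
    rw [basisField_apply, basisField_apply, pair_smul, pair_smul]
    have e0 : compFn α 0 (n, l) = cMode α (-n) (l + 1) := rfl
    have e1 : compFn α 1 (n, l) = sMode α n (l + 1) := rfl
    -- The wave vector is proportional to (dirX, dirZ) and the velocity amplitude is perpendicular
    -- to it up to sign, which is incompressibility of a single mode.
    have key : dirZ α (n, l) * (n * α) = dirX α (n, l) * ((l + 1 : ℕ) * Real.pi) := by
      rw [dirX, dirZ]; ring
    have key' := congrArg (fun r : ℝ => (r : 𝕜)) key
    simp only [RCLike.ofReal_mul] at key'
    simp only [e0, e1, h0, h1, RCLike.ofReal_mul]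
    fin_cases k
    · simp only [compCoef]
      simp only [Fin.zero_eta, Matrix.cons_val_zero, Matrix.cons_val_one]
      linear_combination pair φ (emb 𝕜 α (cMode α n (l + 1))) * key'
    · simp [compCoef]
    · simp [compCoef]
  · rw [basisField_apply, pair_smul]
    have e0 : compFn α 0 (n, l) = cMode α (-n) (l + 1) := rfl
    rw [e0, pair_emb _ (continuous_cMode _ _)]
    simp only [one_mul, cMode]
    rw [integral_cell_mul, integral_cosMode (by omega)]
    simp

/-- The basis fields as elements of `H`. -/
def basisVec (𝕜 : Type) [RCLike 𝕜] {α : ℝ} (hα : 0 < α) (i : (ℤ × ℕ) × Fin 3) : H 𝕜 α :=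
  ⟨basisField 𝕜 α i, basisField_mem hα i⟩

theorem orthonormal_basisVec (hα : 0 < α) : Orthonormal 𝕜 (basisVec 𝕜 hα) := by
  classical
  rw [orthonormal_iff_ite]
  exact orthonormal_iff_ite.mp (orthonormal_basisField hα)

/-- For each wave vector the velocity has two scalar coefficients. Orthogonality to the basis field
and to the gradient of a cosine mode are two equations for them, with an orthogonal 2 × 2 matrix, so
both vanish. Temperature and salinity are plain sine series. -/
theorem eq_zero_of_inner_basisVec (hα : 0 < α) (ψ : H 𝕜 α)
    (h : ∀ i, inner 𝕜 (basisVec 𝕜 hα i) ψ = 0) : ψ = 0 := by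
  have h' : ∀ i : (ℤ × ℕ) × Fin 3, ∑ c, (compCoef α i.1 c i.2 : 𝕜) *
      pair (compFn α c i.1) ((ψ : Fields 𝕜 α) c) = 0 := fun i => by
    rw [← inner_basisField]; exact h i
  have hT : (ψ : Fields 𝕜 α) 2 = 0 := eq_zero_of_pair_sMode hα _ fun n l => by
    simpa [Fin.sum_univ_four, compCoef, compFn] using h' ((n, l), 1)
  have hS : (ψ : Fields 𝕜 α) 3 = 0 := eq_zero_of_pair_sMode hα _ fun n l => by
    simpa [Fin.sum_univ_four, compCoef, compFn] using h' ((n, l), 2)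
  obtain ⟨hdiv, hmean⟩ := ψ.2
  have hvel : ∀ n l, pair (cMode α (-n) (l + 1)) ((ψ : Fields 𝕜 α) 0) = 0 ∧
      pair (sMode α n (l + 1)) ((ψ : Fields 𝕜 α) 1) = 0 := by
    intro n l
    have h0 : (dirZ α (n, l) : 𝕜) * pair (cMode α (-n) (l + 1)) ((ψ : Fields 𝕜 α) 0) +
        (dirX α (n, l) : 𝕜) * pair (sMode α n (l + 1)) ((ψ : Fields 𝕜 α) 1) = 0 := by
      simpa [Fin.sum_univ_four, compCoef, compFn] using h' ((n, l), 0)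
    have h1 := hdiv _ (isTest_cMode hα n (l + 1))
    rw [dir_ex_cMode hα, dir_ez_cMode hα, pair_const_mul, pair_const_mul] at h1
    have hg : (0 : ℝ) < √(gammaSq α n (l + 1)) :=
      Real.sqrt_pos.mpr (gammaSq_pos α n (by omega))
    have ex : (n * α : ℝ) = dirX α (n, l) * √(gammaSq α n (l + 1)) := by
      rw [dirX]; field_simp
    have ez : ((l + 1 : ℕ) * Real.pi : ℝ) = dirZ α (n, l) * √(gammaSq α n (l + 1)) := by
      rw [dirZ]; field_simp
    rw [ex, ez] at h1
    have hg' : (√(gammaSq α n (l + 1)) : 𝕜) ≠ 0 := by exact_mod_cast hg.ne'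
    have h2 : (dirX α (n, l) : 𝕜) * pair (cMode α (-n) (l + 1)) ((ψ : Fields 𝕜 α) 0) -
        (dirZ α (n, l) : 𝕜) * pair (sMode α n (l + 1)) ((ψ : Fields 𝕜 α) 1) = 0 := by
      refine (mul_eq_zero.mp (?_ : (√(gammaSq α n (l + 1)) : 𝕜) * _ = 0)).resolve_left hg'
      rw [← h1]; push_cast; ring
    have h3 : (dirX α (n, l) : 𝕜) ^ 2 + (dirZ α (n, l) : 𝕜) ^ 2 = 1 := by
      exact_mod_cast congrArg (fun r : ℝ => (r : 𝕜)) (dirX_sq_add_dirZ_sq α (n, l))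
    constructor
    · linear_combination (dirZ α (n, l) : 𝕜) * h0 + (dirX α (n, l) : 𝕜) * h2 -
        pair (cMode α (-n) (l + 1)) ((ψ : Fields 𝕜 α) 0) * h3
    · linear_combination (dirX α (n, l) : 𝕜) * h0 - (dirZ α (n, l) : 𝕜) * h2 -
        pair (sMode α n (l + 1)) ((ψ : Fields 𝕜 α) 1) * h3
  have hw : (ψ : Fields 𝕜 α) 1 = 0 := eq_zero_of_pair_sMode hα _ fun n l => (hvel n l).2
  have hu : (ψ : Fields 𝕜 α) 0 = 0 := eq_zero_of_pair_cMode hα _ fun n l => by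
    -- The part of u constant in z is not seen by the basis: gradients of functions of x alone kill
    -- it for n ≠ 0, and the condition ∫ u = 0 kills it for n = 0.
    rcases l with _ | l
    · rcases eq_or_ne n 0 with rfl | hn
      · have e : cMode α 0 0 = fun _ => (√(α / (2 * Real.pi)) * √2) * 1 := by
          funext p; simp [cMode, xMode, cosMode]
        rw [e, pair_const_mul, hmean, mul_zero]
      · have h1 := hdiv _ (isTest_cMode hα (-n) 0)
        rw [dir_ex_cMode hα, dir_ez_cMode hα, pair_const_mul, pair_const_mul, neg_neg] at h1
        have hn' : (((-n : ℤ) : ℝ) * α) ≠ 0 := by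
          have : (n : ℝ) ≠ 0 := by exact_mod_cast hn
          push_cast; exact mul_ne_zero (neg_ne_zero.mpr this) hα.ne'
        simp only [Nat.cast_zero, zero_mul, neg_zero, RCLike.ofReal_zero, add_zero] at h1
        exact (mul_eq_zero.mp h1).resolve_left (by exact_mod_cast hn')
    · have := (hvel (-n) l).1
      rwa [neg_neg] at this
  refine Subtype.ext ?_
  ext1 c
  fin_cases c
  · exact hu
  · exact hw
  · exact hT
  · exact hS

/-- The basis fields form an orthonormal basis of `H`. -/
def basisH (𝕜 : Type) [RCLike 𝕜] {α : ℝ} (hα : 0 < α) :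
    HilbertBasis ((ℤ × ℕ) × Fin 3) 𝕜 (H 𝕜 α) :=
  HilbertBasis.mkOfOrthogonalEqBot (orthonormal_basisVec hα) <| by
    rw [Submodule.eq_bot_iff]
    intro ψ hψ
    refine eq_zero_of_inner_basisVec hα ψ fun i => ?_
    exact (Submodule.mem_orthogonal _ _).mp hψ _ (Submodule.subset_span ⟨i, rfl⟩)

@[simp] theorem coe_basisH (hα : 0 < α) : ⇑(basisH 𝕜 hα) = basisVec 𝕜 hα :=
  HilbertBasis.coe_mkOfOrthogonalEqBot _ _

theorem ext_inner_basisVec (hα : 0 < α) {ψ χ : H 𝕜 α}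
    (h : ∀ i, inner 𝕜 (basisVec 𝕜 hα i) ψ = inner 𝕜 (basisVec 𝕜 hα i) χ) : ψ = χ :=
  sub_eq_zero.mp (eq_zero_of_inner_basisVec hα _ fun i => by rw [inner_sub_right, h, sub_self])

end basis

end DoubleDiffusive

end

noncomputable section

namespace DoubleDiffusive

/-! ### Fourier coefficients of `L ψ` -/

section coefficients

variable {𝕜 : Type} [RCLike 𝕜] {α : ℝ}

theorem pair_sub {c : ℝ × ℝ → ℝ} (hc : Continuous c) (f g : ScalarL2 𝕜 α) :
    pair c (f - g) = pair c f - pair c g := by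
  have := pair_add hc (f - g) g
  rw [sub_add_cancel] at this
  rw [this, add_sub_cancel_right]

/-- Integrating by parts twice in z meets two boundary terms: the first vanishes because the sine
test does, the second because f has zero trace. -/
theorem pair_sMode_lap (hα : 0 < α) {f fx fxx fz fzz : ScalarL2 𝕜 α} (hx : WeakDeriv ex f fx)
    (hxx : WeakDeriv ex fx fxx) (hz : ZeroTraceDeriv f fz) (hzz : WeakDeriv ez fz fzz)
    (n : ℤ) (l : ℕ) :
    pair (sMode α n l) (fxx + fzz) = -(gammaSq α n l : 𝕜) * pair (sMode α n l) f := by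
  have h1 := hxx.pair_dir_ex (isTest_sMode hα n l)
  have h2 := hx.pair_dir_ex (isTest_sMode hα (-n) l)
  have h3 := hzz.pair_sMode_ez hα n l
  have h4 := hz _ (isTest_cMode hα n l)
  rw [dir_ex_sMode hα, pair_const_mul] at h1 h2
  rw [dir_ez_sMode hα, pair_const_mul] at h3
  rw [dir_ez_cMode hα, pair_const_mul] at h4
  rw [neg_neg] at h2
  rw [pair_add (continuous_sMode n l), gammaSq]
  push_cast at h1 h2 h3 h4 ⊢
  linear_combination h1 - (n * α : 𝕜) * h2 + h3 - (l * Real.pi : 𝕜) * h4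

/-- The roles are exchanged relative to the sine case: the cosine test needs zero trace of the
z-derivative, and the sine produced next needs no condition on f. This is where ∂u/∂z = 0 at the
walls enters. -/
theorem pair_cMode_lap (hα : 0 < α) {f fx fxx fz fzz : ScalarL2 𝕜 α} (hx : WeakDeriv ex f fx)
    (hxx : WeakDeriv ex fx fxx) (hz : WeakDeriv ez f fz) (hzz : ZeroTraceDeriv fz fzz)
    (n : ℤ) (l : ℕ) :
    pair (cMode α n l) (fxx + fzz) = -(gammaSq α n l : 𝕜) * pair (cMode α n l) f := by
  have h1 := hxx.pair_dir_ex (isTest_cMode hα n l)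
  have h2 := hx.pair_dir_ex (isTest_cMode hα (-n) l)
  have h3 := hz.pair_sMode_ez hα n l
  have h4 := hzz _ (isTest_cMode hα n l)
  rw [dir_ex_cMode hα, pair_const_mul] at h1 h2
  rw [dir_ez_sMode hα, pair_const_mul] at h3
  rw [dir_ez_cMode hα, pair_const_mul] at h4
  rw [neg_neg] at h2
  rw [pair_add (continuous_cMode n l), gammaSq]
  push_cast at h1 h2 h3 h4 ⊢
  linear_combination h1 - (n * α : 𝕜) * h2 + h4 + (l * Real.pi : 𝕜) * h3

theorem gammaSq_neg (α : ℝ) (n : ℤ) (l : ℕ) : gammaSq α (-n) l = gammaSq α n l := by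
  simp [gammaSq]

theorem IsRegular.pair_compFn_lap (hα : 0 < α) {ψ ψx ψz ψxx ψxz ψzz : Fields 𝕜 α}
    (h : IsRegular ψ ψx ψz ψxx ψxz ψzz) (c : Fin 4) (p : ℤ × ℕ) :
    pair (compFn α c p) ((ψxx + ψzz) c) =
      -(gammaSq α p.1 (p.2 + 1) : 𝕜) * pair (compFn α c p) (ψ c) := by
  rw [PiLp.add_apply]
  fin_cases c
  · have := pair_cMode_lap hα (h.dx 0) (h.dxx 0) (h.dz 0) h.uz_zero (-p.1) (p.2 + 1)
    rwa [gammaSq_neg] at this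
  · exact pair_sMode_lap hα (h.dx 1) (h.dxx 1) h.w_zero (h.dzz 1) p.1 (p.2 + 1)
  · exact pair_sMode_lap hα (h.dx 2) (h.dxx 2) h.T_zero (h.dzz 2) p.1 (p.2 + 1)
  · exact pair_sMode_lap hα (h.dx 3) (h.dxx 3) h.S_zero (h.dzz 3) p.1 (p.2 + 1)

/-- The matrix of `L` in the basis fields with wave numbers `p`. -/
def blockMatrix (α σ τ η lam : ℝ) (p : ℤ × ℕ) : Matrix (Fin 3) (Fin 3) ℝ :=
  !![-(σ * gammaSq α p.1 (p.2 + 1)), σ * lam * dirX α p, -(σ * η * dirX α p);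
    dirX α p, -gammaSq α p.1 (p.2 + 1), 0;
    dirX α p, 0, -(τ * gammaSq α p.1 (p.2 + 1))]

/-- Divergence-free velocity has one degree of freedom per wave vector, so the coefficient of w is
recovered from the velocity coordinate. This closes the temperature and salinity equations, where w
is the forcing, in these coordinates. -/
theorem pair_compFn_one (hα : 0 < α) (ψ : H 𝕜 α) (p : ℤ × ℕ) :
    pair (compFn α 1 p) ((ψ : Fields 𝕜 α) 1) =
      (dirX α p : 𝕜) * inner 𝕜 (basisVec 𝕜 hα (p, 0)) ψ := by
  have h1 := ψ.2.1 _ (isTest_cMode hα p.1 (p.2 + 1))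
  rw [dir_ex_cMode hα, dir_ez_cMode hα, pair_const_mul, pair_const_mul] at h1
  have hg : (0 : ℝ) < √(gammaSq α p.1 (p.2 + 1)) :=
    Real.sqrt_pos.mpr (gammaSq_pos α p.1 (by omega))
  have ex : (p.1 * α : ℝ) = dirX α p * √(gammaSq α p.1 (p.2 + 1)) := by
    rw [dirX]; field_simp
  have ez : ((p.2 + 1 : ℕ) * Real.pi : ℝ) = dirZ α p * √(gammaSq α p.1 (p.2 + 1)) := by
    rw [dirZ]; field_simp
  rw [ex, ez] at h1
  have hg' : (√(gammaSq α p.1 (p.2 + 1)) : 𝕜) ≠ 0 := by exact_mod_cast hg.ne'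
  have h2 : (dirX α p : 𝕜) * pair (cMode α (-p.1) (p.2 + 1)) ((ψ : Fields 𝕜 α) 0) -
      (dirZ α p : 𝕜) * pair (sMode α p.1 (p.2 + 1)) ((ψ : Fields 𝕜 α) 1) = 0 := by
    refine (mul_eq_zero.mp (?_ : (√(gammaSq α p.1 (p.2 + 1)) : 𝕜) * _ = 0)).resolve_left hg'
    rw [← h1]; push_cast; ring
  have h3 : (dirX α p : 𝕜) ^ 2 + (dirZ α p : 𝕜) ^ 2 = 1 := by
    exact_mod_cast congrArg (fun r : ℝ => (r : 𝕜)) (dirX_sq_add_dirZ_sq α p)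
  have h4 : inner 𝕜 (basisVec 𝕜 hα (p, 0)) ψ =
      (dirZ α p : 𝕜) * pair (cMode α (-p.1) (p.2 + 1)) ((ψ : Fields 𝕜 α) 0) +
        (dirX α p : 𝕜) * pair (sMode α p.1 (p.2 + 1)) ((ψ : Fields 𝕜 α) 1) := by
    refine (inner_basisField (p, 0) (ψ : Fields 𝕜 α)).trans ?_
    simp [Fin.sum_univ_four, compCoef, compFn]
  rw [h4]
  change pair (sMode α p.1 (p.2 + 1)) ((ψ : Fields 𝕜 α) 1) = _
  linear_combination -(dirZ α p : 𝕜) * h2 -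
    pair (sMode α p.1 (p.2 + 1)) ((ψ : Fields 𝕜 α) 1) * h3

theorem inner_basisVec_of_mem_opGraph (hα : 0 < α) {σ τ η lam : ℝ} {q : H 𝕜 α × H 𝕜 α}
    (hq : q ∈ opGraph 𝕜 α σ τ η lam) (p : ℤ × ℕ) (m : Fin 3) :
    inner 𝕜 (basisVec 𝕜 hα (p, m)) q.2 =
      ∑ k, (blockMatrix α σ τ η lam p m k : 𝕜) * inner 𝕜 (basisVec 𝕜 hα (p, k)) q.1 := by
  obtain ⟨ψ, F⟩ := q
  obtain ⟨ψx, ψz, ψxx, ψxz, ψzz, hreg, hF⟩ := hq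
  dsimp only at hreg hF ⊢
  have hcomp : inner 𝕜 (basisVec 𝕜 hα (p, m)) F =
      ∑ c, (compCoef α p c m : 𝕜) *
        pair (compFn α c p) (rhs σ τ η lam (ψ : Fields 𝕜 α) (ψxx + ψzz) c) := by
    -- The basis field lies in H, so the orthogonal projection can be dropped from the inner
    -- product.
    rw [hF, Submodule.inner_orthogonalProjectionOnto_eq_of_mem_left]
    exact inner_basisField (p, m) _
  have hlap := fun c => hreg.pair_compFn_lap hα c p
  have hw := pair_compFn_one hα ψ p
  have h0 : inner 𝕜 (basisVec 𝕜 hα (p, 0)) ψ =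
      (dirZ α p : 𝕜) * pair (compFn α 0 p) ((ψ : Fields 𝕜 α) 0) +
        (dirX α p : 𝕜) * pair (compFn α 1 p) ((ψ : Fields 𝕜 α) 1) := by
    refine (inner_basisField (p, 0) (ψ : Fields 𝕜 α)).trans ?_
    simp [Fin.sum_univ_four, compCoef]
  have h1 : inner 𝕜 (basisVec 𝕜 hα (p, 1)) ψ = pair (compFn α 2 p) ((ψ : Fields 𝕜 α) 2) := by
    refine (inner_basisField (p, 1) (ψ : Fields 𝕜 α)).trans ?_
    simp [Fin.sum_univ_four, compCoef]
  have h2 : inner 𝕜 (basisVec 𝕜 hα (p, 2)) ψ = pair (compFn α 3 p) ((ψ : Fields 𝕜 α) 3) := by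
    refine (inner_basisField (p, 2) (ψ : Fields 𝕜 α)).trans ?_
    simp [Fin.sum_univ_four, compCoef]
  have e12 : compFn α 2 p = compFn α 1 p := rfl
  have e13 : compFn α 3 p = compFn α 1 p := rfl
  have hc := continuous_compFn (α := α) 1 p
  rw [hcomp, Fin.sum_univ_four, Fin.sum_univ_three]
  simp only [rhs, Matrix.cons_val_zero, Matrix.cons_val_one, Matrix.cons_val]
  have l0 := hlap 0
  have l1 := hlap 1
  have l2 := hlap 2
  have l3 := hlap 3
  rw [e12] at l2 h1
  rw [e13] at l3 h2
  rw [e12, e13]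
  simp only [pair_sub hc, pair_add hc, pair_smul, l0, l1, l2, l3, ← h1, ← h2]
  fin_cases m
  · simp only [blockMatrix, compCoef, Fin.zero_eta, Matrix.of_apply, Matrix.cons_val_zero,
      Matrix.cons_val_one, Matrix.cons_val, RCLike.ofReal_zero, RCLike.ofReal_neg,
      RCLike.ofReal_mul]
    rw [h0]
    ring
  · simp only [blockMatrix, compCoef, Fin.mk_one, Matrix.of_apply, Matrix.cons_val_zero,
      Matrix.cons_val_one, Matrix.cons_val, RCLike.ofReal_zero, RCLike.ofReal_neg,
      RCLike.ofReal_one]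
    rw [hw]
    ring
  · simp only [blockMatrix, compCoef, Fin.reduceFinMk, Matrix.of_apply, Matrix.cons_val_zero,
      Matrix.cons_val_one, Matrix.cons_val, RCLike.ofReal_zero, RCLike.ofReal_neg,
      RCLike.ofReal_mul, RCLike.ofReal_one]
    rw [hw]
    ring

/-- The operator built from the relation has it as its graph only if the relation is single-valued.
It is, since the coefficients of the image are determined by those of the argument. -/
theorem L_graph (hα : 0 < α) (σ τ η lam : ℝ) :
    (L 𝕜 α σ τ η lam).graph = opGraph 𝕜 α σ τ η lam := by
  refine Submodule.toLinearPMap_graph_eq _ fun q hq h0 => ?_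
  refine eq_zero_of_inner_basisVec hα _ fun i => ?_
  rw [inner_basisVec_of_mem_opGraph hα hq i.1 i.2, h0]
  simp

theorem mem_opGraph_apply (hα : 0 < α) {σ τ η lam : ℝ} {ψ : H 𝕜 α}
    (h : ψ ∈ (L 𝕜 α σ τ η lam).domain) :
    (ψ, L 𝕜 α σ τ η lam ⟨ψ, h⟩) ∈ opGraph 𝕜 α σ τ η lam := by
  rw [← L_graph hα]
  exact (L 𝕜 α σ τ η lam).mem_graph ⟨ψ, h⟩

theorem inner_basisVec_L (hα : 0 < α) {σ τ η lam : ℝ} {ψ : H 𝕜 α}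
    (h : ψ ∈ (L 𝕜 α σ τ η lam).domain) (p : ℤ × ℕ) (m : Fin 3) :
    inner 𝕜 (basisVec 𝕜 hα (p, m)) (L 𝕜 α σ τ η lam ⟨ψ, h⟩) =
      ∑ k, (blockMatrix α σ τ η lam p m k : 𝕜) * inner 𝕜 (basisVec 𝕜 hα (p, k)) ψ :=
  inner_basisVec_of_mem_opGraph hα (mem_opGraph_apply hα h) p m

theorem IsRegular.mem_domain (σ τ η lam : ℝ) {ψ : H 𝕜 α}
    {ψx ψz ψxx ψxz ψzz : Fields 𝕜 α} (h : IsRegular (ψ : Fields 𝕜 α) ψx ψz ψxx ψxz ψzz) :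
    ψ ∈ (L 𝕜 α σ τ η lam).domain :=
  ⟨(ψ, (H 𝕜 α).orthogonalProjectionOnto (rhs σ τ η lam (ψ : Fields 𝕜 α) (ψxx + ψzz))),
    ⟨ψx, ψz, ψxx, ψxz, ψzz, h, rfl⟩, rfl⟩

/-! ### Regularity of Fourier series -/

theorem hasSum_pair {ι : Type*} {c : ℝ × ℝ → ℝ} (hc : Continuous c) {f : ι → ScalarL2 𝕜 α}
    {F : ScalarL2 𝕜 α} (h : HasSum f F) : HasSum (fun i => pair c (f i)) (pair c F) := by
  let P : ScalarL2 𝕜 α →ₗ[𝕜] 𝕜 :=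
    { toFun := pair c, map_add' := pair_add hc, map_smul' := fun a f => by simp [pair_smul] }
  exact h.map P (continuous_pair hc)

/-- Both sides of the defining identity are continuous in L², so series may be differentiated
termwise as soon as the differentiated series converges. -/
theorem WeakDeriv.hasSum {ι : Type*} {e : ℝ × ℝ} {f g : ι → ScalarL2 𝕜 α} {F G : ScalarL2 𝕜 α}
    (hf : HasSum f F) (hg : HasSum g G) (h : ∀ i, WeakDeriv e (f i) (g i)) : WeakDeriv e F G := by
  intro φ hφ
  refine (hasSum_pair (hφ.1.continuous_dir e) hf).unique ?_
  simpa only [fun i => h i φ hφ] using (hasSum_pair hφ.1.continuous hg).neg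

theorem ZeroTraceDeriv.hasSum {ι : Type*} {f g : ι → ScalarL2 𝕜 α} {F G : ScalarL2 𝕜 α}
    (hf : HasSum f F) (hg : HasSum g G) (h : ∀ i, ZeroTraceDeriv (f i) (g i)) :
    ZeroTraceDeriv F G := by
  intro φ hφ
  refine (hasSum_pair (hφ.continuous_dir ez) hf).unique ?_
  simpa only [fun i => h i φ hφ] using (hasSum_pair hφ.continuous hg).neg

theorem Orthonormal.summable_smul {ι E : Type*} [NormedAddCommGroup E] [InnerProductSpace 𝕜 E]
    [CompleteSpace E] {v : ι → E} (hv : Orthonormal 𝕜 v) {b : ι → 𝕜}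
    (hb : Summable fun i => ‖b i‖ ^ 2) : Summable fun i => b i • v i := by
  have := (hv.orthogonalFamily.summable_iff_norm_sq_summable b).mpr hb
  simpa using this

theorem IsTest.dir {φ : ℝ × ℝ → ℝ} (h : IsTest α φ) (e : ℝ × ℝ) : IsTest α (dir e φ) := by
  refine ⟨(h.1.fderiv_right (m := ∞) (by simp)).clm_apply contDiff_const, fun x z => ?_⟩
  have e1 : (fun p : ℝ × ℝ => φ (p + (2 * Real.pi / α, 0))) = φ := by
    funext ⟨x, z⟩
    simpa using h.2 x z
  have e2 := fderiv_comp_add_right (𝕜 := ℝ) (f := φ) (x := (x, z)) (2 * Real.pi / α, (0 : ℝ))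
  rw [e1] at e2
  unfold DoubleDiffusive.dir
  rw [e2]
  simp

theorem dir_const_mul {φ : ℝ × ℝ → ℝ} (h : IsTest α φ) (r : ℝ) (e : ℝ × ℝ) :
    dir e (fun p => r * φ p) = fun p => r * dir e φ p := by
  funext p
  have h1 : DifferentiableAt ℝ φ p := (h.1.differentiable (by simp)) p
  unfold dir
  rw [fderiv_const_mul h1]
  simp

theorem orthonormal_sMode_neg (hα : 0 < α) :
    Orthonormal 𝕜 fun q : ℤ × ℕ => emb 𝕜 α (sMode α (-q.1) (q.2 + 1)) := by
  refine (orthonormal_sMode hα).comp (fun p : ℤ × ℕ => (-p.1, p.2)) fun p q h => ?_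
  simp only [Prod.mk.injEq, neg_inj] at h
  exact Prod.ext h.1 h.2

theorem orthonormal_cMode_neg (hα : 0 < α) :
    Orthonormal 𝕜 fun q : ℤ × ℕ => emb 𝕜 α (cMode α (-q.1) (q.2 + 1)) := by
  refine (orthonormal_cMode hα).comp (fun p : ℤ × ℕ => (-p.1, p.2)) fun p q h => ?_
  simp only [Prod.mk.injEq, neg_inj] at h
  exact Prod.ext h.1 h.2

/-- A derivative of order one or two carries an orthonormal family of modes to multiples, of size at
most γ², of another orthonormal family. Summability of (γ²|A|)² is thus enough for all of them. -/
theorem summable_smul_emb {A : ℤ × ℕ → 𝕜}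
    (hA : Summable fun p : ℤ × ℕ => (gammaSq α p.1 (p.2 + 1) * ‖A p‖) ^ 2)
    {t : ℤ × ℕ → ℝ × ℝ → ℝ} (ht : Orthonormal 𝕜 fun p => emb 𝕜 α (t p))
    (hc : ∀ p, Continuous (t p)) {g : ℤ × ℕ → ℝ × ℝ → ℝ} (ρ : ℤ × ℕ → ℝ)
    (hg : ∀ p, g p = fun x => ρ p * t p x) (hρ : ∀ p, |ρ p| ≤ gammaSq α p.1 (p.2 + 1)) :
    Summable fun p => A p • emb 𝕜 α (g p) := by
  have : Summable fun p => (A p * (ρ p : 𝕜)) • emb 𝕜 α (t p) := by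
    refine Orthonormal.summable_smul ht (Summable.of_nonneg_of_le (fun _ => by positivity)
      (fun p => ?_) hA)
    rw [norm_mul, RCLike.norm_ofReal]
    have := hρ p
    rw [mul_comm]
    gcongr
  refine this.congr fun p => ?_
  rw [hg, emb_const_mul _ (hc p), smul_smul]

/-- First-order factors are dominated by γ² as well because lπ ≥ 1. -/
theorem wave_bounds (α : ℝ) (n : ℤ) (l : ℕ) (hl : 1 ≤ l) :
    |n * α| ≤ gammaSq α n l ∧ |l * Real.pi| ≤ gammaSq α n l ∧
    |n * α * (n * α)| ≤ gammaSq α n l ∧ |n * α * (l * Real.pi)| ≤ gammaSq α n l ∧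
    |l * Real.pi * (l * Real.pi)| ≤ gammaSq α n l := by
  have h1 : (1 : ℝ) ≤ l * Real.pi := by
    have h1 : (1 : ℝ) ≤ l := by exact_mod_cast hl
    nlinarith [Real.pi_gt_three]
  have e : gammaSq α n l = (n * α) ^ 2 + (l * Real.pi) ^ 2 := by unfold gammaSq; ring
  rw [e]
  generalize (n * α : ℝ) = a at *
  generalize (l * Real.pi : ℝ) = b at *
  refine ⟨abs_le.mpr ⟨?_, ?_⟩, abs_le.mpr ⟨?_, ?_⟩, abs_le.mpr ⟨?_, ?_⟩, abs_le.mpr ⟨?_, ?_⟩,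
    abs_le.mpr ⟨?_, ?_⟩⟩ <;> nlinarith [sq_nonneg (a - b), sq_nonneg (a + b), sq_nonneg a,
      sq_nonneg (a - 1), sq_nonneg (a + 1)]

theorem compFn_derivs (hα : 0 < α) (c : Fin 4) {A : ℤ × ℕ → 𝕜}
    (hA : Summable fun p : ℤ × ℕ => (gammaSq α p.1 (p.2 + 1) * ‖A p‖) ^ 2) :
    Summable (fun p => A p • emb 𝕜 α (dir ex (compFn α c p))) ∧
    Summable (fun p => A p • emb 𝕜 α (dir ez (compFn α c p))) ∧
    Summable (fun p => A p • emb 𝕜 α (dir ex (dir ex (compFn α c p)))) ∧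
    Summable (fun p => A p • emb 𝕜 α (dir ez (dir ex (compFn α c p)))) ∧
    Summable (fun p => A p • emb 𝕜 α (dir ez (dir ez (compFn α c p)))) := by
  have hb := fun p : ℤ × ℕ => wave_bounds α p.1 (p.2 + 1) (by omega)
  by_cases h0 : c = 0
  · have e : ∀ p, compFn α c p = cMode α (-p.1) (p.2 + 1) := fun p => by simp [compFn, h0]
    simp only [e]
    refine ⟨summable_smul_emb hA (orthonormal_cMode hα) (fun p => continuous_cMode _ _)
        (fun p => -(p.1 * α)) (fun p => ?_) fun p => ?_,
      summable_smul_emb hA (orthonormal_sMode_neg hα) (fun p => continuous_sMode _ _)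
        (fun p => -((p.2 + 1 : ℕ) * Real.pi)) (fun p => ?_) fun p => ?_,
      summable_smul_emb hA (orthonormal_cMode_neg hα) (fun p => continuous_cMode _ _)
        (fun p => -(p.1 * α * (p.1 * α))) (fun p => ?_) fun p => ?_,
      summable_smul_emb hA (orthonormal_sMode hα) (fun p => continuous_sMode _ _)
        (fun p => p.1 * α * ((p.2 + 1 : ℕ) * Real.pi)) (fun p => ?_) fun p => ?_,
      summable_smul_emb hA (orthonormal_cMode_neg hα) (fun p => continuous_cMode _ _)
        (fun p => -((p.2 + 1 : ℕ) * Real.pi * ((p.2 + 1 : ℕ) * Real.pi))) (fun p => ?_) fun p => ?_⟩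
    · rw [dir_ex_cMode hα, neg_neg]; funext x; push_cast; ring
    · rw [abs_neg]; exact (hb p).1
    · rw [dir_ez_cMode hα]
    · rw [abs_neg]; exact (hb p).2.1
    · rw [dir_ex_cMode hα, neg_neg, dir_const_mul (isTest_cMode hα _ _), dir_ex_cMode hα]
      funext x; push_cast; ring
    · rw [abs_neg]; exact (hb p).2.2.1
    · rw [dir_ex_cMode hα, neg_neg, dir_const_mul (isTest_cMode hα _ _), dir_ez_cMode hα]
      funext x; push_cast; ring
    · exact (hb p).2.2.2.1
    · rw [dir_ez_cMode hα, dir_const_mul (isTest_sMode hα _ _), dir_ez_sMode hα]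
      funext x; push_cast; ring
    · rw [abs_neg]; exact (hb p).2.2.2.2
  · have e : ∀ p, compFn α c p = sMode α p.1 (p.2 + 1) := fun p => by simp [compFn, h0]
    simp only [e]
    refine ⟨summable_smul_emb hA (orthonormal_sMode_neg hα) (fun p => continuous_sMode _ _)
        (fun p => p.1 * α) (fun p => ?_) fun p => ?_,
      summable_smul_emb hA (orthonormal_cMode hα) (fun p => continuous_cMode _ _)
        (fun p => (p.2 + 1 : ℕ) * Real.pi) (fun p => ?_) fun p => ?_,
      summable_smul_emb hA (orthonormal_sMode hα) (fun p => continuous_sMode _ _)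
        (fun p => -(p.1 * α * (p.1 * α))) (fun p => ?_) fun p => ?_,
      summable_smul_emb hA (orthonormal_cMode_neg hα) (fun p => continuous_cMode _ _)
        (fun p => p.1 * α * ((p.2 + 1 : ℕ) * Real.pi)) (fun p => ?_) fun p => ?_,
      summable_smul_emb hA (orthonormal_sMode hα) (fun p => continuous_sMode _ _)
        (fun p => -((p.2 + 1 : ℕ) * Real.pi * ((p.2 + 1 : ℕ) * Real.pi))) (fun p => ?_) fun p => ?_⟩
    · rw [dir_ex_sMode hα]
    · exact (hb p).1
    · rw [dir_ez_sMode hα]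
    · exact (hb p).2.1
    · rw [dir_ex_sMode hα, dir_const_mul (isTest_sMode hα _ _), dir_ex_sMode hα, neg_neg]
      funext x; push_cast; ring
    · rw [abs_neg]; exact (hb p).2.2.1
    · rw [dir_ex_sMode hα, dir_const_mul (isTest_sMode hα _ _), dir_ez_sMode hα]
      funext x; push_cast; ring
    · exact (hb p).2.2.2.1
    · rw [dir_ez_sMode hα, dir_const_mul (isTest_cMode hα _ _), dir_ez_cMode hα]
      funext x; push_cast; ring
    · rw [abs_neg]; exact (hb p).2.2.2.2

theorem isRegular_of_hasSum (hα : 0 < α) {ψ : Fields 𝕜 α} {A : Fin 4 → ℤ × ℕ → 𝕜}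
    (hA : ∀ c, Summable fun p : ℤ × ℕ => (gammaSq α p.1 (p.2 + 1) * ‖A c p‖) ^ 2)
    (h : ∀ c, HasSum (fun p => A c p • emb 𝕜 α (compFn α c p)) (ψ c)) :
    ∃ ψx ψz ψxx ψxz ψzz : Fields 𝕜 α, IsRegular ψ ψx ψz ψxx ψxz ψzz := by
  have hs := fun c => compFn_derivs hα c (hA c)
  have ht := isTest_compFn hα
  have hz1 : ∀ c ≠ 0, ∀ p x z, (z = 0 ∨ z = 1) → compFn α c p (x, z) = 0 := by
    rintro c hc p x z (rfl | rfl) <;> simp [compFn, hc, sMode]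
  have hz2 : ∀ p x z, (z = 0 ∨ z = 1) → dir ez (compFn α 0 p) (x, z) = 0 := by
    intro p x z hz
    have e : compFn α 0 p = cMode α (-p.1) (p.2 + 1) := rfl
    rw [e, dir_ez_cMode hα]
    rcases hz with rfl | rfl <;> simp [sMode]
  have hzt : ∀ c, c ≠ 0 → ZeroTraceDeriv (ψ c) (∑' p, A c p • emb 𝕜 α (dir ez (compFn α c p))) :=
    fun c hc => ZeroTraceDeriv.hasSum (h c) (hs c).2.1.hasSum fun p =>
      (zeroTraceDeriv_emb (ht c p) (fun x => hz1 c hc p x 0 (Or.inl rfl))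
        fun x => hz1 c hc p x 1 (Or.inr rfl)).smul _
  refine ⟨WithLp.toLp 2 fun c => ∑' p, A c p • emb 𝕜 α (dir ex (compFn α c p)),
    WithLp.toLp 2 fun c => ∑' p, A c p • emb 𝕜 α (dir ez (compFn α c p)),
    WithLp.toLp 2 fun c => ∑' p, A c p • emb 𝕜 α (dir ex (dir ex (compFn α c p))),
    WithLp.toLp 2 fun c => ∑' p, A c p • emb 𝕜 α (dir ez (dir ex (compFn α c p))),
    WithLp.toLp 2 fun c => ∑' p, A c p • emb 𝕜 α (dir ez (dir ez (compFn α c p))),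
    fun c => ?_, fun c => ?_, fun c => ?_, fun c => ?_, fun c => ?_, hzt 1 (by decide),
    hzt 2 (by decide), hzt 3 (by decide), ?_⟩
  · exact WeakDeriv.hasSum (h c) (hs c).1.hasSum fun p => (weakDeriv_emb_ex hα (ht c p)).smul _
  · exact WeakDeriv.hasSum (h c) (hs c).2.1.hasSum fun p => (weakDeriv_emb_ez (ht c p)).smul _
  · exact WeakDeriv.hasSum (hs c).1.hasSum (hs c).2.2.1.hasSum fun p =>
      (weakDeriv_emb_ex hα ((ht c p).dir ex)).smul _
  · exact WeakDeriv.hasSum (hs c).1.hasSum (hs c).2.2.2.1.hasSum fun p =>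
      (weakDeriv_emb_ez ((ht c p).dir ex)).smul _
  · exact WeakDeriv.hasSum (hs c).2.1.hasSum (hs c).2.2.2.2.hasSum fun p =>
      (weakDeriv_emb_ez ((ht c p).dir ez)).smul _
  · exact ZeroTraceDeriv.hasSum (hs 0).2.1.hasSum (hs 0).2.2.2.2.hasSum fun p =>
      (zeroTraceDeriv_emb ((ht 0 p).dir ez) (fun x => hz2 p x 0 (Or.inl rfl))
        fun x => hz2 p x 1 (Or.inr rfl)).smul _

theorem mem_domain_of_summable (hα : 0 < α) (σ τ η lam : ℝ) {ψ : H 𝕜 α}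
    (h : ∀ k, Summable fun p : ℤ × ℕ =>
      (gammaSq α p.1 (p.2 + 1) * ‖(inner 𝕜 (basisVec 𝕜 hα (p, k)) ψ : 𝕜)‖) ^ 2) :
    ψ ∈ (L 𝕜 α σ τ η lam).domain := by
  have hsum : HasSum (fun i => (inner 𝕜 (basisVec 𝕜 hα i) ψ : 𝕜) • basisVec 𝕜 hα i) ψ := by
    have := (basisH 𝕜 hα).hasSum_repr ψ
    simpa [HilbertBasis.repr_apply_apply] using this
  have hcomp : ∀ c, HasSum (fun i => (inner 𝕜 (basisVec 𝕜 hα i) ψ : 𝕜) • basisField 𝕜 α i c)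
      ((ψ : Fields 𝕜 α) c) := fun c =>
    hsum.mapL ((PiLp.proj 2 (fun _ : Fin 4 => ScalarL2 𝕜 α) c).comp (H 𝕜 α).subtypeL)
  let A : Fin 4 → ℤ × ℕ → 𝕜 := fun c p =>
    ∑ k, (inner 𝕜 (basisVec 𝕜 hα (p, k)) ψ : 𝕜) * (compCoef α p c k : 𝕜)
  have hA : ∀ c, Summable fun p : ℤ × ℕ => (gammaSq α p.1 (p.2 + 1) * ‖A c p‖) ^ 2 := by
    intro c
    -- The constant 3 is from the Cauchy–Schwarz inequality for the sum over the three basis fields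
    -- of a wave vector.
    refine Summable.of_nonneg_of_le (fun _ => by positivity) (fun p => ?_)
      ((summable_sum (s := Finset.univ) fun k _ => h k).mul_left 3)
    have hg := (gammaSq_pos α p.1 (l := p.2 + 1) (by omega)).le
    have h1 : ‖A c p‖ ≤ ∑ k, ‖(inner 𝕜 (basisVec 𝕜 hα (p, k)) ψ : 𝕜)‖ := by
      refine (norm_sum_le _ _).trans (Finset.sum_le_sum fun k _ => ?_)
      rw [norm_mul, RCLike.norm_ofReal]
      exact mul_le_of_le_one_right (norm_nonneg _) (abs_compCoef_le α p c k)
    calc _ ≤ (gammaSq α p.1 (p.2 + 1) *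
          ∑ k, ‖(inner 𝕜 (basisVec 𝕜 hα (p, k)) ψ : 𝕜)‖) ^ 2 := by gcongr
      _ ≤ _ := by
        rw [Finset.mul_sum]
        refine sq_sum_le_card_mul_sum_sq.trans ?_
        simp
  have hS : ∀ c, HasSum (fun p => A c p • emb 𝕜 α (compFn α c p)) ((ψ : Fields 𝕜 α) c) := by
    intro c
    refine (hcomp c).prod_fiberwise fun p => ?_
    have := hasSum_fintype fun k : Fin 3 =>
      (inner 𝕜 (basisVec 𝕜 hα (p, k)) ψ : 𝕜) • basisField 𝕜 α (p, k) c
    simp only [basisField_apply, smul_smul, ← Finset.sum_smul] at this ⊢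
    exact this
  obtain ⟨_, _, _, _, _, hreg⟩ := isRegular_of_hasSum hα hA hS
  exact hreg.mem_domain σ τ η lam

end coefficients

end DoubleDiffusive

end

noncomputable section

namespace DoubleDiffusive

/-! ### Fourier blocks and wave numbers -/

section blocks

variable {𝕜 : Type} [RCLike 𝕜] {α : ℝ}

/-- The elements of `H` with wave numbers `(j,l)`, over `ℝ` or `ℂ`. -/
def HasWave (j : ℤ) (l : ℕ) (ψ : H 𝕜 α) : Prop :=
  ∃ c s : Fin 4 → 𝕜, ∀ i : Fin 4,
    ((ψ : Fields 𝕜 α) i : ℝ × ℝ → 𝕜) =ᵐ[cellMeasure α] fun p =>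
      (c i * (Real.cos (j * α * p.1) : 𝕜) + s i * (Real.sin (j * α * p.1) : 𝕜)) *
        (if i = 0 then (Real.cos (l * Real.pi * p.2) : 𝕜) else (Real.sin (l * Real.pi * p.2) : 𝕜))

/-- Each component is a combination of the modes j and -j with z-wave number l, so orthonormality of
the scalar modes gives the claim; basis indices count z-wave numbers from 0, hence the shift by one.
-/
theorem HasWave.inner_eq_zero (hα : 0 < α) {j : ℤ} {l : ℕ} {ψ : H 𝕜 α} (h : HasWave j l ψ)
    {p : ℤ × ℕ} (hp : ¬(p.1.natAbs = j.natAbs ∧ p.2 + 1 = l)) (k : Fin 3) :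
    inner 𝕜 (basisVec 𝕜 hα (p, k)) ψ = 0 := by
  obtain ⟨cc, ss, h⟩ := h
  obtain ⟨a, b, c, d, habcd⟩ := exists_cos_sin_eq_xMode hα j
  refine (inner_basisField (p, k) (ψ : Fields 𝕜 α)).trans (Finset.sum_eq_zero fun i _ => ?_)
  suffices hz : pair (compFn α i p) ((ψ : Fields 𝕜 α) i) = 0 by rw [hz, mul_zero]
  let base : ℤ → ℝ × ℝ → ℝ := fun n => if i = 0 then cMode α n l else sMode α n l
  have hbase : ∀ n, Continuous (base n) := fun n => by
    dsimp only [base]; split_ifs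
    · exact continuous_cMode _ _
    · exact continuous_sMode _ _
  have h2 : (√2 : 𝕜) ≠ 0 := by exact_mod_cast (by positivity : √2 ≠ 0)
  have hψ : (ψ : Fields 𝕜 α) i =
      ((cc i * a + ss i * c) / (√2 : 𝕜)) • emb 𝕜 α (base j) +
        ((cc i * b + ss i * d) / (√2 : 𝕜)) • emb 𝕜 α (base (-j)) := by
    refine Lp.ext ?_
    filter_upwards [h i, coeFn_emb (𝕜 := 𝕜) (α := α) (hbase j),
      coeFn_emb (𝕜 := 𝕜) (α := α) (hbase (-j)),
      Lp.coeFn_add (((cc i * a + ss i * c) / (√2 : 𝕜)) • emb 𝕜 α (base j))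
        (((cc i * b + ss i * d) / (√2 : 𝕜)) • emb 𝕜 α (base (-j))),
      Lp.coeFn_smul ((cc i * a + ss i * c) / (√2 : 𝕜)) (emb 𝕜 α (base j)),
      Lp.coeFn_smul ((cc i * b + ss i * d) / (√2 : 𝕜)) (emb 𝕜 α (base (-j)))]
      with q h1 h3 h4 h5 h6 h7
    rw [h1, h5, Pi.add_apply, h6, h7, Pi.smul_apply, Pi.smul_apply, h3, h4, (habcd q.1).1,
      (habcd q.1).2]
    dsimp only [base]
    split_ifs
    · simp only [cMode, cosMode, smul_eq_mul, RCLike.ofReal_add, RCLike.ofReal_mul]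
      field_simp
      ring
    · simp only [sMode, sinMode, smul_eq_mul, RCLike.ofReal_add, RCLike.ofReal_mul]
      field_simp
      ring
  have key : ∀ n : ℤ, n.natAbs = j.natAbs → pair (compFn α i p) (emb 𝕜 α (base n)) = 0 := by
    intro n hn
    dsimp only [base, compFn]
    split_ifs
    · rw [pair_cMode_emb hα _ _ _ (by omega), if_neg]
      rintro ⟨rfl, h3⟩
      exact hp ⟨by simpa using hn, h3⟩
    · rw [pair_sMode_emb hα _ _ _ (by omega), if_neg]
      rintro ⟨rfl, h3⟩
      exact hp ⟨hn, h3⟩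
  rw [hψ, pair_add (continuous_compFn i p), pair_smul, pair_smul, key j rfl,
    key (-j) (Int.natAbs_neg j)]
  simp

theorem hasWave_of_mem_E {j : ℤ} {l : ℕ} {ψ : H 𝕜 α} (h : ψ ∈ E 𝕜 α j l) : HasWave j l ψ := by
  unfold E at h
  split_ifs at h with hj
  · obtain ⟨c, hc⟩ := h
    refine ⟨![c 2, 0, c 0, c 1], 0, fun i => (hc i).trans (Eventually.of_forall fun q => ?_)⟩
    fin_cases i <;> simp [Fin.sum_univ_three, zeroModes, hj]
  · obtain ⟨c, hc⟩ := h
    refine ⟨![c 0 * (l * Real.pi / (j * α) : ℝ), c 3, c 4, c 5],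
      ![-(c 3 * (l * Real.pi / (j * α) : ℝ)), c 0, c 1, c 2],
      fun i => (hc i).trans (Eventually.of_forall fun q => ?_)⟩
    fin_cases i <;> simp [Fin.sum_univ_six, modes] <;> ring

theorem coeFn_basisVec (hα : 0 < α) (i : (ℤ × ℕ) × Fin 3) (c : Fin 4) :
    ((basisVec 𝕜 hα i : Fields 𝕜 α) c : ℝ × ℝ → 𝕜) =ᵐ[cellMeasure α]
      fun q => ((compCoef α i.1 c i.2 * compFn α c i.1 q : ℝ) : 𝕜) := by
  change (basisField 𝕜 α i c : ℝ × ℝ → 𝕜) =ᵐ[cellMeasure α] _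
  rw [basisField_apply]
  filter_upwards [coeFn_emb (𝕜 := 𝕜) (α := α) (continuous_compFn c i.1),
    Lp.coeFn_smul (compCoef α i.1 c i.2 : 𝕜) (emb 𝕜 α (compFn α c i.1))] with q h1 h2
  rw [h2, Pi.smul_apply, h1, smul_eq_mul, RCLike.ofReal_mul]

theorem basisVec_mem_fieldSpan (hα : 0 < α) (i : (ℤ × ℕ) × Fin 3) {n : ℕ}
    {v : Fin n → ℝ × ℝ → Fin 4 → ℝ} (c : Fin n → ℝ)
    (h : ∀ j q, compCoef α i.1 j i.2 * compFn α j i.1 q = ∑ k, c k * v k q j) :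
    basisVec 𝕜 hα i ∈ fieldSpan 𝕜 α v :=
  ⟨fun k => (c k : 𝕜), fun j => (coeFn_basisVec hα i j).trans (Eventually.of_forall fun q => by
    simp only [h]; push_cast; rfl)⟩

theorem basisVec_mem_E (hα : 0 < α) {j n : ℤ} (hn : n.natAbs = j.natAbs) (l : ℕ) (k : Fin 3) :
    basisVec 𝕜 hα ((n, l), k) ∈ E 𝕜 α j (l + 1) := by
  unfold E
  split_ifs with hj
  · have hn0 : n = 0 := by rw [hj] at hn; simpa using hn
    subst hn0
    set r := √(α / (2 * Real.pi)) * √2 with hr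
    have hx : ∀ x, xMode α 0 x = √(α / (2 * Real.pi)) := fun x => by simp [xMode]
    have h1 : dirX α (0, l) = 0 := by simp [dirX]
    refine basisVec_mem_fieldSpan hα _
      (![![0, 0, dirZ α (0, l) * r], ![r, 0, 0], ![0, r, 0]] k) fun c q => ?_
    fin_cases k <;> fin_cases c <;>
      simp [Fin.sum_univ_three, zeroModes, compCoef, compFn, h1, hx, cMode, sMode, hr, sinMode,
        cosMode, mul_assoc]
  · have hn0 : n ≠ 0 := by rintro rfl; simp at hn; omega
    obtain ⟨a, b, hab⟩ := exists_xMode_eq_cos_sin α j n hn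
    have hj' : (j : ℝ) ≠ 0 := by exact_mod_cast hj
    have hn' : (n : ℝ) ≠ 0 := by exact_mod_cast hn0
    have hnj : (n : ℝ) ^ 2 = j ^ 2 := by
      rcases Int.natAbs_eq_natAbs_iff.mp hn with rfl | rfl <;> simp
    -- The velocity field couples the modes n and -n. The second is obtained by differentiating the
    -- expression of the first in cos jαx and sin jαx.
    have hneg : ∀ x, xMode α (-n) x =
        n / j * (b * Real.cos (j * α * x) - a * Real.sin (j * α * x)) := by
      intro x
      have h0 : HasDerivAt (fun x : ℝ => (j : ℝ) * α * x) (j * α) x := by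
        simpa using (hasDerivAt_id x).const_mul ((j : ℝ) * α)
      have h1 := (h0.cos.const_mul a).add (h0.sin.const_mul b)
      have h2 := (hasDerivAt_xMode α n x).unique
        (h1.congr_of_eventuallyEq (Eventually.of_forall hab))
      have h3 : n * xMode α (-n) x = j * (b * Real.cos (j * α * x) - a * Real.sin (j * α * x)) := by
        refine mul_left_cancel₀ hα.ne' ?_
        linear_combination h2
      rw [div_mul_eq_mul_div, eq_div_iff hj']
      refine mul_left_cancel₀ hn' ?_
      linear_combination (j : ℝ) * h3 -
        (b * Real.cos (j * α * x) - a * Real.sin (j * α * x)) * hnj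
    have hdir : dirZ α (n, l) * (n / j) = (l + 1 : ℕ) * Real.pi / (j * α) * dirX α (n, l) := by
      rw [dirZ, dirX]; field_simp
    refine basisVec_mem_fieldSpan hα _ (![![dirX α (n, l) * √2 * b, 0, 0, dirX α (n, l) * √2 * a, 0, 0],
      ![0, √2 * b, 0, 0, √2 * a, 0], ![0, 0, √2 * b, 0, 0, √2 * a]] k) fun c q => ?_
    rw [Fin.sum_univ_six]
    fin_cases k <;> fin_cases c <;>
      simp [modes, compCoef, compFn, hab, hneg, cMode, sMode, sinMode, cosMode]
    · push_cast at hdir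
      linear_combination √2 * Real.cos ((l + 1) * Real.pi * q.2) *
        (b * Real.cos (j * α * q.1) - a * Real.sin (j * α * q.1)) * hdir
    all_goals ring

/-- The Fourier expansion collapses to the finitely many basis vectors at ±j; for j = 0 the two
indices coincide and the finite set drops the repetition. -/
theorem mem_of_inner_eq_zero (hα : 0 < α) {j : ℤ} {l : ℕ} {ψ : H 𝕜 α} (S : Submodule 𝕜 (H 𝕜 α))
    (hS : ∀ n : ℤ, n.natAbs = j.natAbs → ∀ k, basisVec 𝕜 hα ((n, l), k) ∈ S)
    (h : ∀ p : ℤ × ℕ, ¬(p.1.natAbs = j.natAbs ∧ p.2 = l) → ∀ k,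
      inner 𝕜 (basisVec 𝕜 hα (p, k)) ψ = 0) : ψ ∈ S := by
  have hsum : HasSum (fun i => (inner 𝕜 (basisVec 𝕜 hα i) ψ : 𝕜) • basisVec 𝕜 hα i) ψ := by
    have := (basisH 𝕜 hα).hasSum_repr ψ
    simpa [HilbertBasis.repr_apply_apply] using this
  let s : Finset ((ℤ × ℕ) × Fin 3) := (({j, -j} : Finset ℤ) ×ˢ {l}) ×ˢ Finset.univ
  have h1 : HasSum (fun i => (inner 𝕜 (basisVec 𝕜 hα i) ψ : 𝕜) • basisVec 𝕜 hα i)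
      (∑ i ∈ s, (inner 𝕜 (basisVec 𝕜 hα i) ψ : 𝕜) • basisVec 𝕜 hα i) := by
    refine hasSum_sum_of_ne_finset_zero fun i hi => ?_
    rw [h i.1 ?_ i.2, zero_smul]
    rintro ⟨h2, h3⟩
    refine hi ?_
    have := Int.natAbs_eq_natAbs_iff.mp h2
    simp [s, Prod.ext_iff, h3, this]
  rw [hsum.unique h1]
  refine Submodule.sum_mem _ fun i hi => Submodule.smul_mem _ _ ?_
  obtain ⟨⟨n, m⟩, k⟩ := i
  simp only [s, Finset.mem_product, Finset.mem_insert, Finset.mem_singleton, Finset.mem_univ,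
    and_true] at hi
  obtain ⟨hn, rfl⟩ := hi
  refine hS n ?_ k
  rcases hn with rfl | rfl <;> simp

theorem mem_E_of_inner (hα : 0 < α) {j : ℤ} {l : ℕ} {ψ : H 𝕜 α}
    (h : ∀ p : ℤ × ℕ, ¬(p.1.natAbs = j.natAbs ∧ p.2 = l) → ∀ k,
      inner 𝕜 (basisVec 𝕜 hα (p, k)) ψ = 0) : ψ ∈ E 𝕜 α j (l + 1) :=
  mem_of_inner_eq_zero hα _ (fun _ hn k => basisVec_mem_E hα hn l k) h

/-- Having given wave numbers leaves the amplitudes of u and w free. Membership in H ties them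
together, which is why the larger-looking class is no larger than the block. -/
theorem mem_E_iff_hasWave (hα : 0 < α) {j : ℤ} {l : ℕ} {ψ : H 𝕜 α} :
    ψ ∈ E 𝕜 α j (l + 1) ↔ HasWave j (l + 1) ψ :=
  ⟨hasWave_of_mem_E, fun h => mem_E_of_inner hα fun p hp k =>
    h.inner_eq_zero hα (fun h' => hp ⟨h'.1, by omega⟩) k⟩

theorem mem_E_iff_inner (hα : 0 < α) {j : ℤ} {l : ℕ} {ψ : H 𝕜 α} :
    ψ ∈ E 𝕜 α j (l + 1) ↔ ∀ p : ℤ × ℕ, ¬(p.1.natAbs = j.natAbs ∧ p.2 = l) → ∀ k,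
      inner 𝕜 (basisVec 𝕜 hα (p, k)) ψ = 0 :=
  ⟨fun h p hp k => (hasWave_of_mem_E h).inner_eq_zero hα (fun h' => hp ⟨h'.1, by omega⟩) k,
    mem_E_of_inner hα⟩

theorem mem_domain_of_mem_E (hα : 0 < α) (σ τ η lam : ℝ) {j : ℤ} {l : ℕ} {ψ : H 𝕜 α}
    (h : ψ ∈ E 𝕜 α j (l + 1)) : ψ ∈ (L 𝕜 α σ τ η lam).domain := by
  rw [mem_E_iff_inner hα] at h
  refine mem_domain_of_summable hα σ τ η lam fun k =>
    summable_of_ne_finset_zero (s := ({j, -j} : Finset ℤ) ×ˢ {l}) fun p hp => ?_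
  rw [h p ?_ k]
  · simp
  · rintro ⟨h2, h3⟩
    have := Int.natAbs_eq_natAbs_iff.mp h2
    exact hp (by simp [Prod.ext_iff, h3, this])

theorem L_mem_E (hα : 0 < α) {σ τ η lam : ℝ} {j : ℤ} {l : ℕ} {ψ : H 𝕜 α}
    (h : ψ ∈ E 𝕜 α j (l + 1)) (hd : ψ ∈ (L 𝕜 α σ τ η lam).domain) :
    L 𝕜 α σ τ η lam ⟨ψ, hd⟩ ∈ E 𝕜 α j (l + 1) := by
  rw [mem_E_iff_inner hα] at h ⊢
  intro p hp k
  rw [inner_basisVec_L hα hd]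
  exact Finset.sum_eq_zero fun m _ => by rw [h p hp m, mul_zero]

end blocks

end DoubleDiffusive

end

noncomputable section

namespace DoubleDiffusive

/-! ### Root vectors and the blocks of `L` -/

section rootVectors

variable {𝕜 : Type} [RCLike 𝕜] {α : ℝ}

/-- The element of `H` with given coordinates in the block with wave numbers `p`. -/
def blockVec (𝕜 : Type) [RCLike 𝕜] {α : ℝ} (hα : 0 < α) (p : ℤ × ℕ) : (Fin 3 → 𝕜) →ₗ[𝕜] H 𝕜 α :=
  Fintype.linearCombination 𝕜 fun k => basisVec 𝕜 hα (p, k)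

theorem blockVec_apply (hα : 0 < α) (p : ℤ × ℕ) (c : Fin 3 → 𝕜) :
    blockVec 𝕜 hα p c = ∑ k, c k • basisVec 𝕜 hα (p, k) := rfl

theorem blockVec_single (hα : 0 < α) (p : ℤ × ℕ) (k : Fin 3) :
    blockVec 𝕜 hα p (Pi.single k 1) = basisVec 𝕜 hα (p, k) := by
  simp [blockVec_apply, Pi.single_apply]

theorem inner_blockVec (hα : 0 < α) (p q : ℤ × ℕ) (c : Fin 3 → 𝕜) (m : Fin 3) :
    inner 𝕜 (basisVec 𝕜 hα (q, m)) (blockVec 𝕜 hα p c) = if q = p then c m else 0 := by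
  classical
  rw [blockVec_apply, inner_sum]
  have ho := orthonormal_iff_ite.mp (orthonormal_basisVec (𝕜 := 𝕜) hα)
  have e : ∀ k, inner 𝕜 (basisVec 𝕜 hα (q, m)) (c k • basisVec 𝕜 hα (p, k)) =
      c k * if (q, m) = (p, k) then 1 else 0 := fun k => by
    rw [inner_smul_right (basisVec 𝕜 hα (q, m)) (basisVec 𝕜 hα (p, k)) (c k), ho]
  simp only [e, Prod.mk.injEq]
  by_cases h : q = p <;> simp [h]

theorem blockVec_mem_E (hα : 0 < α) {j n : ℤ} (hn : n.natAbs = j.natAbs) (l : ℕ) (c : Fin 3 → 𝕜) :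
    blockVec 𝕜 hα (n, l) c ∈ E 𝕜 α j (l + 1) := by
  rw [blockVec_apply]
  exact Submodule.sum_mem _ fun k _ => Submodule.smul_mem _ _ (basisVec_mem_E hα hn l k)

theorem blockVec_mem_domain (hα : 0 < α) (σ τ η lam : ℝ) (p : ℤ × ℕ) (c : Fin 3 → 𝕜) :
    blockVec 𝕜 hα p c ∈ (L 𝕜 α σ τ η lam).domain :=
  mem_domain_of_mem_E hα σ τ η lam (blockVec_mem_E hα (j := p.1) rfl p.2 c)

theorem L_blockVec (hα : 0 < α) (σ τ η lam : ℝ) (p : ℤ × ℕ) (c : Fin 3 → 𝕜)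
    (h : blockVec 𝕜 hα p c ∈ (L 𝕜 α σ τ η lam).domain) :
    L 𝕜 α σ τ η lam ⟨blockVec 𝕜 hα p c, h⟩ =
      blockVec 𝕜 hα p (((blockMatrix α σ τ η lam p).map (RCLike.ofReal : ℝ → 𝕜)).mulVec c) := by
  refine ext_inner_basisVec hα fun i => ?_
  obtain ⟨q, m⟩ := i
  rw [inner_basisVec_L hα h, inner_blockVec]
  simp only [inner_blockVec]
  by_cases hq : q = p
  · subst hq; simp [Matrix.mulVec, dotProduct]
  · simp [hq]

theorem coeFn_blockVec (hα : 0 < α) (p : ℤ × ℕ) (c : Fin 3 → 𝕜) (i : Fin 4) :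
    ((blockVec 𝕜 hα p c : Fields 𝕜 α) i : ℝ × ℝ → 𝕜) =ᵐ[cellMeasure α]
      fun q => ∑ k, c k * ((compCoef α p i k * compFn α i p q : ℝ) : 𝕜) := by
  have e : (blockVec 𝕜 hα p c : Fields 𝕜 α) i =
      (∑ k, c k * (compCoef α p i k : 𝕜)) • emb 𝕜 α (compFn α i p) := by
    rw [blockVec_apply, Finset.sum_smul]
    simp only [Submodule.coe_sum, Submodule.coe_smul, WithLp.ofLp_sum, Finset.sum_apply,
      PiLp.smul_apply, mul_smul]
    rfl
  rw [e]
  filter_upwards [coeFn_emb (𝕜 := 𝕜) (α := α) (continuous_compFn i p),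
    Lp.coeFn_smul (∑ k, c k * (compCoef α p i k : 𝕜)) (emb 𝕜 α (compFn α i p))] with q h1 h2
  rw [h2, Pi.smul_apply, h1, smul_eq_mul, Finset.sum_mul]
  simp only [RCLike.ofReal_mul, mul_assoc]

theorem isComplexCombination_blockVec (hα : 0 < α) (p : ℤ × ℕ) (c : Fin 3 → ℂ) :
    IsComplexCombination (blockVec ℂ hα p c) (blockVec ℝ hα p fun k => (c k).re)
      (blockVec ℝ hα p fun k => (c k).im) := by
  intro i
  filter_upwards [coeFn_blockVec hα p c i, coeFn_blockVec hα p (fun k => (c k).re) i,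
    coeFn_blockVec hα p (fun k => (c k).im) i] with q h1 h2 h3
  rw [h1, h2, h3]
  push_cast
  rw [Finset.mul_sum, ← Finset.sum_add_distrib]
  refine Finset.sum_congr rfl fun k _ => ?_
  simp only [Complex.coe_algebraMap, RCLike.ofReal_real_eq_id, id_eq]
  linear_combination -((compCoef α p i k : ℂ) * (compFn α i p q : ℂ)) * Complex.re_add_im (c k)

/-- The complex matrix of `L - β` in a block. -/
def shiftedBlock (α σ τ η lam : ℝ) (p : ℤ × ℕ) (β : ℂ) : Matrix (Fin 3) (Fin 3) ℂ :=
  (blockMatrix α σ τ η lam p).map (RCLike.ofReal : ℝ → ℂ) - β • (1 : Matrix (Fin 3) (Fin 3) ℂ)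

/-- Expanding the determinant gives the cubic once j²α²/γ² is recognized as the square of `dirX`. -/
theorem f_eq_det (α σ τ η lam : ℝ) (p : ℤ × ℕ) (β : ℂ) :
    f α σ τ η lam p.1 (p.2 + 1) β = -(shiftedBlock α σ τ η lam p β).det := by
  have h1 : gammaSq α p.1 (p.2 + 1) ≠ 0 := (gammaSq_pos α p.1 (l := p.2 + 1) (by omega)).ne'
  have h2 : σ * (p.1 : ℝ) ^ 2 * α ^ 2 / gammaSq α p.1 (p.2 + 1) = σ * dirX α p ^ 2 := by
    rw [dirX_sq]; ring
  have h3 : σ * (p.1 : ℝ) ^ 2 * α ^ 2 = σ * dirX α p ^ 2 * gammaSq α p.1 (p.2 + 1) := by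
    rw [dirX_sq]; field_simp
  unfold f
  rw [h2, h3]
  simp [shiftedBlock, blockMatrix, Matrix.det_fin_three]
  ring

theorem f_congr (α σ τ η lam : ℝ) {j n : ℤ} (hn : n.natAbs = j.natAbs) (l : ℕ) (β : ℂ) :
    f α σ τ η lam n l β = f α σ τ η lam j l β := by
  rcases Int.natAbs_eq_natAbs_iff.mp hn with rfl | rfl
  · rfl
  · simp [f, gammaSq]

/-- A power with nontrivial kernel has determinant zero, hence so has the matrix itself. Nonzero
generalized eigenvectors thus belong automatically to zeros of f. -/
theorem f_eq_zero_of_mulVec (α σ τ η lam : ℝ) (p : ℤ × ℕ) (β : ℂ) {k : ℕ} {c : Fin 3 → ℂ}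
    (hc : c ≠ 0) (h : (shiftedBlock α σ τ η lam p β ^ k).mulVec c = 0) :
    f α σ τ η lam p.1 (p.2 + 1) β = 0 := by
  have h1 : (shiftedBlock α σ τ η lam p β ^ k).det = 0 :=
    Matrix.exists_mulVec_eq_zero_iff.mp ⟨c, hc, h⟩
  rw [Matrix.det_pow] at h1
  rw [f_eq_det, eq_zero_of_pow_eq_zero h1, neg_zero]

theorem powKer_blockVec (hα : 0 < α) (σ τ η lam : ℝ) (p : ℤ × ℕ) (β : ℂ) (k : ℕ) :
    ∀ c : Fin 3 → ℂ, (shiftedBlock α σ τ η lam p β ^ k).mulVec c = 0 →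
      PowKer (L ℂ α σ τ η lam) β k (blockVec ℂ hα p c) := by
  induction k with
  | zero =>
    intro c hc
    rw [pow_zero, Matrix.one_mulVec] at hc
    rw [hc, map_zero]; rfl
  | succ k ih =>
    intro c hc
    refine ⟨blockVec_mem_domain hα σ τ η lam p c, ?_⟩
    have e : L ℂ α σ τ η lam ⟨blockVec ℂ hα p c, blockVec_mem_domain hα σ τ η lam p c⟩ -
        β • blockVec ℂ hα p c = blockVec ℂ hα p ((shiftedBlock α σ τ η lam p β).mulVec c) := by
      rw [L_blockVec hα, shiftedBlock, Matrix.sub_mulVec, map_sub, Matrix.smul_mulVec,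
        Matrix.one_mulVec, map_smul]
    rw [e]
    refine ih _ ?_
    rwa [Matrix.mulVec_mulVec, ← pow_succ]

/-- The real and imaginary parts of the generalized eigenvectors of a block. -/
def rootSet (α σ τ η lam : ℝ) (p : ℤ × ℕ) : Set (Fin 3 → ℝ) :=
  {v | ∃ (c : Fin 3 → ℂ) (β : ℂ) (k : ℕ), f α σ τ η lam p.1 (p.2 + 1) β = 0 ∧
    (shiftedBlock α σ τ η lam p β ^ k).mulVec c = 0 ∧
    ((v = fun i => (c i).re) ∨ v = fun i => (c i).im)}

theorem isRootVector_blockVec (hα : 0 < α) {σ τ η lam : ℝ} {j n : ℤ} (hn : n.natAbs = j.natAbs)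
    {l : ℕ} {v : Fin 3 → ℝ} (hv : v ∈ rootSet α σ τ η lam (n, l)) :
    IsRootVector α σ τ η lam j (l + 1) (blockVec ℝ hα (n, l) v) := by
  obtain ⟨c, β, k, hf, hk, hv⟩ := hv
  have h1 : HasWaveNumbers j (l + 1) (blockVec ℂ hα (n, l) c) :=
    hasWave_of_mem_E (blockVec_mem_E hα hn l c)
  have h2 := powKer_blockVec hα σ τ η lam (n, l) β k c hk
  have h3 : f α σ τ η lam j (l + 1) β = 0 := by rw [← f_congr α σ τ η lam hn]; exact hf
  have h4 := isComplexCombination_blockVec hα (n, l) c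
  rcases hv with rfl | rfl
  · exact ⟨_, _, β, k, Or.inl h4, h1, h3, h2⟩
  · exact ⟨_, _, β, k, Or.inr h4, h1, h3, h2⟩

/-- Over ℂ the generalized eigenspaces of the block span everything. Taking real parts is real
linear and maps ℂ³ onto ℝ³, so real parts of generalized eigenvectors span ℝ³. -/
theorem span_rootSet (α σ τ η lam : ℝ) (p : ℤ × ℕ) :
    Submodule.span ℝ (rootSet α σ τ η lam p) = ⊤ := by
  set A := (blockMatrix α σ τ η lam p).map (RCLike.ofReal : ℝ → ℂ) with hA
  have hpow : ∀ (β : ℂ) (k : ℕ), (Matrix.toLin' A - algebraMap ℂ (Module.End ℂ (Fin 3 → ℂ)) β) ^ k =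
      Matrix.toLin' (shiftedBlock α σ τ η lam p β ^ k) := by
    intro β k
    rw [Matrix.toLin'_pow]
    congr 1
    rw [shiftedBlock, map_sub, map_smul, Matrix.toLin'_one, Algebra.algebraMap_eq_smul_one]
    rfl
  have key : ∀ c : Fin 3 → ℂ,
      (fun i => (c i).re) ∈ Submodule.span ℝ (rootSet α σ τ η lam p) := by
    intro c
    have hc : c ∈ ⨆ μ, Module.End.maxGenEigenspace (Matrix.toLin' A) μ := by
      rw [Module.End.iSup_maxGenEigenspace_eq_top]; trivial
    induction hc using Submodule.iSup_induction' with
    | mem β c hc =>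
      obtain ⟨k, hk⟩ := (Module.End.mem_maxGenEigenspace _ _ _).mp hc
      have hk' : (shiftedBlock α σ τ η lam p β ^ k).mulVec c = 0 := by
        rw [← Matrix.toLin'_apply, ← hpow, Algebra.algebraMap_eq_smul_one]; exact hk
      -- For a zero vector β need not be an eigenvalue, so it is put into the span directly.
      by_cases h0 : c = 0
      · rw [h0]; exact Submodule.zero_mem _
      · exact Submodule.subset_span
          ⟨c, β, k, f_eq_zero_of_mulVec α σ τ η lam p β h0 hk', hk', Or.inl rfl⟩
    | zero => exact Submodule.zero_mem _
    | add c d _ _ h1 h2 => exact Submodule.add_mem _ h1 h2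
  rw [eq_top_iff]
  intro v _
  have := key fun i => (v i : ℂ)
  simpa using this

theorem hasWave_of_isComplexCombination {j : ℤ} {l : ℕ} {ψ : H ℂ α} {x y : H ℝ α}
    (hψ : HasWave j l ψ) (h : IsComplexCombination ψ x y) : HasWave j l x ∧ HasWave j l y := by
  obtain ⟨c, s, hcs⟩ := hψ
  refine ⟨⟨fun i => (c i).re, fun i => (s i).re, fun i => ?_⟩,
    ⟨fun i => (c i).im, fun i => (s i).im, fun i => ?_⟩⟩
  · filter_upwards [hcs i, h i] with q h1 h2
    rw [h1] at h2
    have := congrArg Complex.re h2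
    split_ifs at this ⊢ <;> simpa [-Complex.ofReal_cos, -Complex.ofReal_sin] using this.symm
  · filter_upwards [hcs i, h i] with q h1 h2
    rw [h1] at h2
    have := congrArg Complex.im h2
    split_ifs at this ⊢ <;> simpa [-Complex.ofReal_cos, -Complex.ofReal_sin] using this.symm

/-- One inclusion uses only the wave numbers, which pass to real and imaginary parts; the other uses
that root vectors span each of the blocks at ±j. -/
theorem rootSpace_eq_E (hα : 0 < α) (σ τ η lam : ℝ) (j : ℤ) (l : ℕ) :
    rootSpace α σ τ η lam j (l + 1) = E ℝ α j (l + 1) := by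
  refine le_antisymm (Submodule.span_le.mpr ?_) fun ψ hψ => ?_
  · rintro x ⟨ψ, y, β, k, hc, hw, -, -⟩
    refine (mem_E_iff_hasWave hα).mpr ?_
    rcases hc with hc | hc
    · exact (hasWave_of_isComplexCombination hw hc).1
    · exact (hasWave_of_isComplexCombination hw hc).2
  · refine mem_of_inner_eq_zero hα _ (fun n hn k => ?_) ((mem_E_iff_inner hα).mp hψ)
    have hle : Submodule.span ℝ (rootSet α σ τ η lam (n, l)) ≤
        (rootSpace α σ τ η lam j (l + 1)).comap (blockVec ℝ hα (n, l)) :=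
      Submodule.span_le.mpr fun v hv => Submodule.subset_span (isRootVector_blockVec hα hn hv)
    rw [span_rootSet] at hle
    rw [← blockVec_single]
    exact hle Submodule.mem_top

end rootVectors

end DoubleDiffusive

end

noncomputable section

namespace DoubleDiffusive

/-! ### Stability of the blocks below the critical value -/

section stability

/-- The Routh–Hurwitz criterion. A root x + iy with x ≥ 0 is excluded by positivity of the
coefficients if y = 0. Otherwise the imaginary part determines y², and eliminating it leaves an
equation for x all of whose terms are nonnegative and whose constant term a₁a₂ - a₃ is positive. -/
theorem re_neg_of_cubic {a₁ a₂ a₃ : ℝ} (h1 : 0 < a₁) (h3 : 0 < a₃) (h : a₃ < a₁ * a₂) {β : ℂ}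
    (hβ : β ^ 3 + a₁ * β ^ 2 + a₂ * β + a₃ = 0) : β.re < 0 := by
  have h2 : 0 < a₂ := by
    by_contra hneg
    nlinarith
  obtain ⟨x, y⟩ := β
  have hre := congrArg Complex.re hβ
  have him := congrArg Complex.im hβ
  simp [pow_succ] at hre him
  change x < 0
  by_contra hx
  push Not at hx
  have him' : y * (3 * x ^ 2 - y ^ 2 + 2 * a₁ * x + a₂) = 0 := by linear_combination him
  rcases mul_eq_zero.mp him' with hy | hy
  · subst hy
    nlinarith [mul_nonneg h2.le hx, mul_nonneg h1.le (sq_nonneg x), pow_nonneg hx 3]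
  · have hy2 : y ^ 2 = 3 * x ^ 2 + 2 * a₁ * x + a₂ := by linarith
    have key : 8 * x ^ 3 + 8 * a₁ * x ^ 2 + (2 * a₂ + 2 * a₁ ^ 2) * x + (a₁ * a₂ - a₃) = 0 := by
      linear_combination -hre + (-3 * x - a₁) * hy2
    have := mul_nonneg (show 0 ≤ 2 * a₂ + 2 * a₁ ^ 2 by positivity) hx
    nlinarith [mul_nonneg h1.le (sq_nonneg x), pow_nonneg hx 3]

/-- With q = j²α² and b = l²π², the difference (q+b)³ - (27/4) b² q is (q - b/2)²(q + 4b). Equality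
at q = b/2 and b = π² is the critical mode, with α² = π²/2 and j = ±1. -/
theorem cube_gammaSq_ge (α : ℝ) (j : ℤ) {l : ℕ} (hl : 1 ≤ l) :
    27 / 4 * Real.pi ^ 4 * ((j : ℝ) ^ 2 * α ^ 2) ≤ gammaSq α j l ^ 3 := by
  have hq : 0 ≤ (j : ℝ) ^ 2 * α ^ 2 := by positivity
  have hb : Real.pi ^ 2 ≤ (l : ℝ) ^ 2 * Real.pi ^ 2 := by
    have : (1 : ℝ) ≤ l := by exact_mod_cast hl
    exact le_mul_of_one_le_left (by positivity) (one_le_pow₀ this)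
  unfold gammaSq
  generalize (j : ℝ) ^ 2 * α ^ 2 = q at *
  generalize (l : ℝ) ^ 2 * Real.pi ^ 2 = b at *
  have hb0 : 0 ≤ b := (sq_nonneg _).trans hb
  have h1 : Real.pi ^ 4 ≤ b ^ 2 := by
    calc Real.pi ^ 4 = (Real.pi ^ 2) ^ 2 := by ring
      _ ≤ b ^ 2 := by gcongr
  have h2 : (q + b) ^ 3 - 27 / 4 * b ^ 2 * q = (q - b / 2) ^ 2 * (q + 4 * b) := by ring
  have h3 : 0 ≤ (q - b / 2) ^ 2 * (q + 4 * b) := by positivity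
  nlinarith [mul_le_mul_of_nonneg_right h1 hq]

variable {σ τ η lam : ℝ}

/-- With R = 27π⁴/4, positivity of the constant coefficient is λ < η/τ + R combined with γ⁶ ≥ R q.
The Hurwitz inequality a₃ < a₁a₂ is a bound on (σ+1)λ - (σ+τ)η, and η < η_c makes it a consequence
of λ < λ_c. -/
theorem re_neg_of_f_eq_zero (α : ℝ) (hσ : 1 < σ) (hτ1 : τ < 1) (hτ0 : 0 < τ) (hη : η < etaC σ τ)
    (hlam : lam < lamC τ η) (j : ℤ) {l : ℕ} (hl : 1 ≤ l) {β : ℂ}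
    (hβ : f α σ τ η lam j l β = 0) : β.re < 0 := by
  have hg := gammaSq_pos α j hl
  have hcube := cube_gammaSq_ge α j hl
  have hq : 0 ≤ (j : ℝ) ^ 2 * α ^ 2 := by positivity
  have hR : (0 : ℝ) < 27 / 4 * Real.pi ^ 4 := by positivity
  have hσ0 : 0 < σ := by linarith
  unfold f at hβ
  unfold etaC at hη
  unfold lamC at hlam
  rw [mul_assoc σ ((j : ℝ) ^ 2) (α ^ 2)] at hβ
  generalize (j : ℝ) ^ 2 * α ^ 2 = q at *
  generalize gammaSq α j l = g at *
  generalize 27 / 4 * Real.pi ^ 4 = R at *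
  have h1 : τ * lam < η + τ * R := by
    have := mul_lt_mul_of_pos_left hlam hτ0
    have e : τ * (η / τ + R) = η + τ * R := by field_simp
    linarith
  have h2 : σ * η * (1 - τ) < R * τ ^ 2 * (σ + 1) := by
    have h1τ : 0 < 1 - τ := by linarith
    have := mul_lt_mul_of_pos_left hη (mul_pos hσ0 h1τ)
    have e : σ * (1 - τ) * (R * τ ^ 2 * (1 + σ⁻¹) * (1 - τ)⁻¹) = R * τ ^ 2 * (σ + 1) := by
      field_simp
    linarith
  have hg3 : 0 < g ^ 3 := by positivity
  -- After multiplication by τ, replacing λ by its bound leaves η with the factor σ(1-τ)(σ+1+τ),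
  -- exactly what the bound on η controls. The right side is the coefficient of γ⁶ in a₁a₂ - a₃,
  -- times R.
  have hD : σ * ((σ + 1) * lam - (σ + τ) * η) < R * ((σ + 1) * (σ + τ) * (1 + τ)) := by
    refine lt_of_mul_lt_mul_left ?_ hτ0.le
    have e1 := mul_lt_mul_of_pos_left h1 (show 0 < σ * (σ + 1) by positivity)
    have e2 := mul_lt_mul_of_pos_right h2 (show 0 < σ + 1 + τ by positivity)
    nlinarith
  refine re_neg_of_cubic (by positivity) ?_ ?_ hβ
  · rcases hq.eq_or_lt with rfl | hq'
    · have : 0 < σ * τ * g ^ 3 := by positivity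
      simpa using this
    · have e1 := mul_lt_mul_of_pos_left h1 (mul_pos hσ0 hq')
      have e2 := mul_le_mul_of_nonneg_left hcube (mul_pos hσ0 hτ0).le
      nlinarith
  · have e : (σ + τ + 1) * g * ((σ + τ + σ * τ) * g ^ 2 - σ * q / g * (lam - η)) =
        (σ + τ + 1) * (σ + τ + σ * τ) * g ^ 3 - (σ + τ + 1) * (σ * q * (lam - η)) := by
      field_simp
    rw [e]
    have hP : 0 < (σ + 1) * (σ + τ) * (1 + τ) := by positivity
    -- For q = 0 the coupling disappears and the strict inequality comes from γ⁶ > 0 instead.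
    rcases hq.eq_or_lt with rfl | hq'
    · nlinarith [mul_pos hP hg3]
    · have e1 := mul_lt_mul_of_pos_left hD hq'
      have e2 := mul_le_mul_of_nonneg_left hcube hP.le
      nlinarith

/-- The real inner product on `ℂ³`. -/
def reInner : (Fin 3 → ℂ) →ₗ[ℝ] (Fin 3 → ℂ) →ₗ[ℝ] ℝ :=
  LinearMap.mk₂ ℝ (fun y z => ∑ i, ((y i).re * (z i).re + (y i).im * (z i).im))
    (fun y y' z => by simp [← Finset.sum_add_distrib]; congr 1; funext; ring)
    (fun r y z => by simp [Finset.mul_sum]; congr 1; funext; ring)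
    (fun y z z' => by simp [← Finset.sum_add_distrib]; congr 1; funext; ring)
    (fun r y z => by simp [Finset.mul_sum]; congr 1; funext; ring)

theorem reInner_apply (y z : Fin 3 → ℂ) :
    reInner y z = ∑ i, ((y i).re * (z i).re + (y i).im * (z i).im) := rfl

theorem reInner_comm (y z : Fin 3 → ℂ) : reInner y z = reInner z y := by
  simp only [reInner_apply]; congr 1; funext; ring

theorem reInner_self_nonneg (y : Fin 3 → ℂ) : 0 ≤ reInner y y := by
  rw [reInner_apply]
  exact Finset.sum_nonneg fun i _ => add_nonneg (mul_self_nonneg _) (mul_self_nonneg _)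

theorem reInner_smul_self (β : ℂ) (y : Fin 3 → ℂ) : reInner (β • y) y = β.re * reInner y y := by
  simp only [reInner_apply, Finset.mul_sum]
  congr 1; funext i; simp; ring

theorem reInner_self_pos {y : Fin 3 → ℂ} (h : y ≠ 0) : 0 < reInner y y := by
  refine (reInner_self_nonneg y).lt_of_ne fun h0 => h ?_
  rw [reInner_apply] at h0
  have := (Finset.sum_eq_zero_iff_of_nonneg fun i _ =>
    add_nonneg (mul_self_nonneg (y i).re) (mul_self_nonneg (y i).im)).mp h0.symm
  funext i
  have hi := this i (Finset.mem_univ i)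
  exact Complex.ext (by simp; nlinarith [mul_self_nonneg (y i).re, mul_self_nonneg (y i).im])
    (by simp; nlinarith [mul_self_nonneg (y i).re, mul_self_nonneg (y i).im])

/-- Young's inequality with weight r, obtained by expanding the square of r z - y. -/
theorem reInner_le {r : ℝ} (hr : 0 < r) (y z : Fin 3 → ℂ) :
    reInner y z ≤ r / 2 * reInner z z + (2 * r)⁻¹ * reInner y y := by
  have h := reInner_self_nonneg (r • z - y)
  simp only [map_sub, LinearMap.sub_apply, map_smul, LinearMap.smul_apply, smul_eq_mul] at h
  rw [reInner_comm z y] at h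
  have e : r / 2 * reInner z z + (2 * r)⁻¹ * reInner y y - reInner y z =
      (2 * r)⁻¹ * (r * (r * reInner z z) - r * reInner y z - (r * reInner y z - reInner y y)) := by
    field_simp
    ring
  have : 0 ≤ (2 * r)⁻¹ *
      (r * (r * reInner z z) - r * reInner y z - (r * reInner y z - reInner y y)) :=
    mul_nonneg (by positivity) (by linarith)
  linarith

/-- Cayley–Hamilton in factored form. Roots are listed with multiplicity, so no diagonalizability is
needed. -/
theorem exists_factor_charpoly (A : Matrix (Fin 3) (Fin 3) ℂ) :
    ∃ β : Fin 3 → ℂ, (∀ i, (A - β i • (1 : Matrix (Fin 3) (Fin 3) ℂ)).det = 0) ∧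
      (A - β 0 • 1) * ((A - β 1 • 1) * (A - β 2 • 1)) = 0 := by
  have hs := IsAlgClosed.splits A.charpoly
  have hcard : Multiset.card A.charpoly.roots = 3 := by
    rw [← hs.natDegree_eq_card_roots, Matrix.charpoly_natDegree_eq_dim, Fintype.card_fin]
  obtain ⟨x, y, z, hxyz⟩ := Multiset.card_eq_three.mp hcard
  have hprod := hs.eq_prod_roots_of_monic A.charpoly_monic
  rw [hxyz] at hprod
  have hroot : ∀ w ∈ A.charpoly.roots, (A - w • (1 : Matrix (Fin 3) (Fin 3) ℂ)).det = 0 := by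
    intro w hw
    have h1 := (Polynomial.mem_roots'.mp hw).2
    rw [Polynomial.IsRoot, Matrix.eval_charpoly] at h1
    have e : A - w • (1 : Matrix (Fin 3) (Fin 3) ℂ) = -(Matrix.scalar (Fin 3) w - A) := by
      rw [Matrix.scalar_apply, ← Matrix.smul_one_eq_diagonal, neg_sub]
    rw [e, Matrix.det_neg, h1, mul_zero]
  refine ⟨![x, y, z], fun i => hroot _ ?_, ?_⟩
  · rw [hxyz]; fin_cases i <;> simp
  · have h := A.aeval_self_charpoly
    rw [hprod] at h
    simpa [Algebra.algebraMap_eq_smul_one] using h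

/-- Lyapunov's theorem for real `3 × 3` matrices. -/
theorem exists_lyapunov (M : Matrix (Fin 3) (Fin 3) ℝ)
    (hM : ∀ β : ℂ, (M.map (RCLike.ofReal : ℝ → ℂ) - β • (1 : Matrix (Fin 3) (Fin 3) ℂ)).det = 0 →
      β.re < 0) :
    ∃ Q : LinearMap.BilinForm ℝ (Fin 3 → ℝ), (∀ x y, Q x y = Q y x) ∧
      (∀ x, 0 ≤ Q x x) ∧ (∀ x, x ≠ 0 → 0 < Q x x) ∧ (∀ x, Q (M.mulVec x) x ≤ 0) ∧
      ∀ x, x ≠ 0 → Q (M.mulVec x) x < 0 := by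
  set A := M.map (RCLike.ofReal : ℝ → ℂ) with hA
  obtain ⟨β, hroot, hCH⟩ := exists_factor_charpoly A
  set r : Fin 3 → ℝ := fun i => -(β i).re with hr
  have hrpos : ∀ i, 0 < r i := fun i => by have := hM _ (hroot i); simp only [hr]; linarith
  let T₃ : (Fin 3 → ℝ) →ₗ[ℝ] (Fin 3 → ℂ) :=
    { toFun := fun x i => (x i : ℂ)
      map_add' := fun x y => by funext i; simp
      map_smul' := fun a x => by funext i; simp }
  let B : ℂ → (Fin 3 → ℂ) →ₗ[ℝ] (Fin 3 → ℂ) := fun b =>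
    (Matrix.toLin' (A - b • (1 : Matrix (Fin 3) (Fin 3) ℂ))).restrictScalars ℝ
  -- For y₃ = x, y₂ = (A-β₂)x and y₁ = (A-β₁)y₂, the matrix acts triangularly: A y₃ = β₂y₃ + y₂, A
  -- y₂ = β₁y₂ + y₁, and A y₁ = β₀y₁ by Cayley–Hamilton. This replaces a Schur or Jordan form.
  let T₂ := B (β 2) ∘ₗ T₃
  let T₁ := B (β 1) ∘ₗ T₂
  have hB : ∀ b y, B b y = A.mulVec y - b • y := fun b y => by
    simp [B]
  have hBA : ∀ b y, B b (A.mulVec y) = A.mulVec (B b y) := fun b y => by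
    rw [hB, hB, Matrix.mulVec_sub, Matrix.mulVec_smul]
  have e3 : ∀ x, T₃ (M.mulVec x) = A.mulVec (T₃ x) := fun x => by
    funext i; simp [T₃, hA, Matrix.mulVec, dotProduct]
  have e2 : ∀ x, T₂ (M.mulVec x) = A.mulVec (T₂ x) := fun x => by
    change B (β 2) (T₃ _) = _
    rw [e3, hBA]; rfl
  have e1 : ∀ x, T₁ (M.mulVec x) = A.mulVec (T₁ x) := fun x => by
    change B (β 1) (T₂ _) = _
    rw [e2, hBA]; rfl
  have d3 : ∀ x, A.mulVec (T₃ x) = β 2 • T₃ x + T₂ x := fun x => by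
    change _ = _ + B (β 2) (T₃ x)
    rw [hB]; abel
  have d2 : ∀ x, A.mulVec (T₂ x) = β 1 • T₂ x + T₁ x := fun x => by
    change _ = _ + B (β 1) (T₂ x)
    rw [hB]; abel
  have d1 : ∀ x, A.mulVec (T₁ x) = β 0 • T₁ x := fun x => by
    have h0 : B (β 0) (T₁ x) = 0 := by
      change (A - β 0 • (1 : Matrix (Fin 3) (Fin 3) ℂ)).mulVec ((A - β 1 • 1).mulVec
        ((A - β 2 • 1).mulVec (T₃ x))) = 0
      rw [Matrix.mulVec_mulVec, Matrix.mulVec_mulVec, Matrix.mul_assoc, hCH, Matrix.zero_mulVec]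
    rw [hB] at h0
    exact sub_eq_zero.mp h0
  have hinj : ∀ x, x ≠ 0 → T₃ x ≠ 0 := fun x hx h => hx <| by
    funext i
    have := congrFun h i
    simpa [T₃] using this
  -- The weights are large enough that the damping of each y absorbs what Young's inequality
  -- produces from the coupling one level higher.
  set w₂ := (r 1 * r 2)⁻¹ with hw2
  set w₁ := w₂ * (r 0 * r 1)⁻¹ with hw1
  have hw2p : 0 < w₂ := inv_pos.mpr (mul_pos (hrpos 1) (hrpos 2))
  have hw1p : 0 < w₁ := mul_pos hw2p (inv_pos.mpr (mul_pos (hrpos 0) (hrpos 1)))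
  let Q : LinearMap.BilinForm ℝ (Fin 3 → ℝ) :=
    reInner.compl₁₂ T₃ T₃ + w₂ • reInner.compl₁₂ T₂ T₂ + w₁ • reInner.compl₁₂ T₁ T₁
  have hQ : ∀ x y, Q x y = reInner (T₃ x) (T₃ y) + w₂ * reInner (T₂ x) (T₂ y) +
      w₁ * reInner (T₁ x) (T₁ y) := fun x y => rfl
  -- The term of y₃ alone makes the form definite, since y₃ is x itself; the other two only need to
  -- be nonnegative.
  have hpos : ∀ x, reInner (T₃ x) (T₃ x) ≤ Q x x := fun x => by
    rw [hQ]
    have h2 := mul_nonneg hw2p.le (reInner_self_nonneg (T₂ x))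
    have h1 := mul_nonneg hw1p.le (reInner_self_nonneg (T₁ x))
    linarith
  have hneg : ∀ x, Q (M.mulVec x) x ≤ -(r 2 / 2 * reInner (T₃ x) (T₃ x)) := fun x => by
    rw [hQ, e3, e2, e1, d3, d2, d1]
    simp only [map_add, LinearMap.add_apply, reInner_smul_self]
    have b3 := reInner_le (hrpos 2) (T₂ x) (T₃ x)
    have b2 := mul_le_mul_of_nonneg_left (reInner_le (hrpos 1) (T₁ x) (T₂ x)) hw2p.le
    have r0 : (β 0).re = -r 0 := by simp [hr]
    have r1 : (β 1).re = -r 1 := by simp [hr]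
    have r2 : (β 2).re = -r 2 := by simp [hr]
    rw [r0, r1, r2]
    have c2 : w₂ * r 1 = (r 2)⁻¹ := by
      rw [hw2]; have := (hrpos 1).ne'; have := (hrpos 2).ne'; field_simp
    have c1 : w₁ * r 0 = w₂ * (r 1)⁻¹ := by
      rw [hw1]; have := (hrpos 0).ne'; have := (hrpos 1).ne'; field_simp
    have n1 := mul_nonneg (mul_nonneg hw2p.le (inv_pos.mpr (hrpos 1)).le)
      (reInner_self_nonneg (T₁ x))
    have f2 : (2 * r 2)⁻¹ = (r 2)⁻¹ / 2 := by rw [mul_inv]; ring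
    have f1 : (2 * r 1)⁻¹ = (r 1)⁻¹ / 2 := by rw [mul_inv]; ring
    rw [f2, ← c2] at b3
    rw [f1] at b2
    have g1 : w₁ * (-r 0 * reInner (T₁ x) (T₁ x)) =
        -(w₂ * (r 1)⁻¹ * reInner (T₁ x) (T₁ x)) := by rw [← c1]; ring
    rw [g1]
    nlinarith
  refine ⟨Q, fun x y => ?_, fun x => (reInner_self_nonneg _).trans (hpos x), fun x hx =>
    (reInner_self_pos (hinj x hx)).trans_le (hpos x), fun x => (hneg x).trans ?_, fun x hx =>
    (hneg x).trans_lt ?_⟩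
  · rw [hQ, hQ, reInner_comm, reInner_comm (T₂ x), reInner_comm (T₁ x)]
  · have := mul_nonneg (hrpos 2).le (reInner_self_nonneg (T₃ x)); linarith
  · have := mul_pos (hrpos 2) (reInner_self_pos (hinj x hx)); linarith

variable {𝕜 : Type} [RCLike 𝕜] {α : ℝ}

/-- The coordinates in the block with wave numbers `p`. -/
def blockCoord (𝕜 : Type) [RCLike 𝕜] {α : ℝ} (hα : 0 < α) (p : ℤ × ℕ) :
    H 𝕜 α →ₗ[𝕜] (Fin 3 → 𝕜) :=
  LinearMap.pi fun k => (innerSL 𝕜 (basisVec 𝕜 hα (p, k))).toLinearMap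

theorem blockCoord_apply (hα : 0 < α) (p : ℤ × ℕ) (ψ : H 𝕜 α) (k : Fin 3) :
    blockCoord 𝕜 hα p ψ k = inner 𝕜 (basisVec 𝕜 hα (p, k)) ψ := rfl

theorem blockCoord_L (hα : 0 < α) {ψ : H 𝕜 α} (h : ψ ∈ (L 𝕜 α σ τ η lam).domain) (p : ℤ × ℕ) :
    blockCoord 𝕜 hα p (L 𝕜 α σ τ η lam ⟨ψ, h⟩) =
      ((blockMatrix α σ τ η lam p).map (RCLike.ofReal : ℝ → 𝕜)).mulVec (blockCoord 𝕜 hα p ψ) := by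
  funext m
  rw [blockCoord_apply, inner_basisVec_L hα h]
  rfl

theorem exists_blockCoord_ne_zero (hα : 0 < α) {j : ℤ} {l : ℕ} {ψ : H 𝕜 α}
    (h : ψ ∈ E 𝕜 α j (l + 1)) (h0 : ψ ≠ 0) :
    ∃ n : ℤ, (n = j ∨ n = -j) ∧ blockCoord 𝕜 hα (n, l) ψ ≠ 0 := by
  by_contra hcon
  push Not at hcon
  refine h0 (eq_zero_of_inner_basisVec hα ψ fun i => ?_)
  by_cases hi : i.1.1.natAbs = j.natAbs ∧ i.1.2 = l
  · obtain ⟨⟨n, m⟩, k⟩ := i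
    obtain ⟨h1, rfl⟩ := hi
    exact congrFun (hcon n (Int.natAbs_eq_natAbs_iff.mp h1)) k
  · exact (mem_E_iff_inner hα).mp h i.1 hi i.2

theorem re_neg_of_eigenvalue (hα : 0 < α) (hσ : 1 < σ) (hτ1 : τ < 1) (hτ0 : 0 < τ)
    (hη : η < etaC σ τ) (hlam : lam < lamC τ η) {j : ℤ} {l : ℕ} {β : ℂ} {ψ : H ℂ α}
    (h : ψ ∈ (L ℂ α σ τ η lam).domain) (hE : ψ ∈ E ℂ α j (l + 1)) (h0 : ψ ≠ 0)
    (hL : L ℂ α σ τ η lam ⟨ψ, h⟩ = β • ψ) : β.re < 0 := by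
  obtain ⟨n, -, hn⟩ := exists_blockCoord_ne_zero hα hE h0
  have h1 := blockCoord_L hα h (n, l)
  rw [hL, map_smul] at h1
  refine re_neg_of_f_eq_zero α hσ hτ1 hτ0 hη hlam n (l := l + 1) (by omega)
    (f_eq_zero_of_mulVec α σ τ η lam (n, l) β (k := 1) hn ?_)
  rw [pow_one, shiftedBlock, Matrix.sub_mulVec, ← h1, Matrix.smul_mulVec, Matrix.one_mulVec, sub_self]

/-- A vector of E has coordinates in the blocks at j and -j, and the Lyapunov forms of both are
added. At least one coordinate is nonzero, so one term is strict and the other has the right weak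
sign; for j = 0 the same form is merely counted twice. -/
theorem exists_bilinForm_neg (hα : 0 < α) (hσ : 1 < σ) (hτ1 : τ < 1) (hτ0 : 0 < τ)
    (hη : η < etaC σ τ) (hlam : lam < lamC τ η) (j : ℤ) (l : ℕ) :
    ∃ Q : LinearMap.BilinForm ℝ (H ℝ α), (∀ x y, Q x y = Q y x) ∧
      (∀ x ∈ E ℝ α j (l + 1), x ≠ 0 → 0 < Q x x) ∧
      ∀ (x : H ℝ α) (h : x ∈ (L ℝ α σ τ η lam).domain), x ∈ E ℝ α j (l + 1) → x ≠ 0 →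
        Q (L ℝ α σ τ η lam ⟨x, h⟩) x < 0 := by
  have hly := fun n : ℤ => exists_lyapunov (blockMatrix α σ τ η lam (n, l)) fun β hβ =>
    re_neg_of_f_eq_zero α hσ hτ1 hτ0 hη hlam n (l := l + 1) (by omega) (β := β) (by
      rw [f_eq_det α σ τ η lam (n, l)]; exact neg_eq_zero.mpr hβ)
  choose Q hsymm hnn hpos hnp hneg using hly
  have hM : ∀ (x : H ℝ α) (h : x ∈ (L ℝ α σ τ η lam).domain) (n : ℤ),
      blockCoord ℝ hα (n, l) (L ℝ α σ τ η lam ⟨x, h⟩) =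
        (blockMatrix α σ τ η lam (n, l)).mulVec (blockCoord ℝ hα (n, l) x) := fun x h n => by
    rw [blockCoord_L hα h]; congr 1
  refine ⟨(Q j).compl₁₂ (blockCoord ℝ hα (j, l)) (blockCoord ℝ hα (j, l)) +
    (Q (-j)).compl₁₂ (blockCoord ℝ hα (-j, l)) (blockCoord ℝ hα (-j, l)), fun x y => ?_,
    fun x hx h0 => ?_, fun x h hx h0 => ?_⟩
  · simp only [LinearMap.add_apply, LinearMap.compl₁₂_apply]
    rw [hsymm j, hsymm (-j)]
  · simp only [LinearMap.add_apply, LinearMap.compl₁₂_apply]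
    obtain ⟨n, rfl | rfl, hn⟩ := exists_blockCoord_ne_zero hα hx h0
    · exact add_pos_of_pos_of_nonneg (hpos n _ hn) (hnn _ _)
    · exact add_pos_of_nonneg_of_pos (hnn _ _) (hpos (-j) _ hn)
  · simp only [LinearMap.add_apply, LinearMap.compl₁₂_apply, hM x h]
    obtain ⟨n, rfl | rfl, hn⟩ := exists_blockCoord_ne_zero hα hx h0
    · exact add_neg_of_neg_of_nonpos (hneg n _ hn) (hnp _ _)
    · exact add_neg_of_nonpos_of_neg (hnp _ _) (hneg (-j) _ hn)

end stability

end DoubleDiffusive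

end

noncomputable section

namespace DoubleDiffusive

/-! ### Operators given by their matrix in the Fourier basis -/

section coordinates

variable {𝕜 : Type} [RCLike 𝕜]

theorem HilbertBasis.hasSum_norm_sq {ι X : Type*} [NormedAddCommGroup X] [InnerProductSpace 𝕜 X]
    (b : HilbertBasis ι 𝕜 X) (x : X) : HasSum (fun i => ‖inner 𝕜 (b i) x‖ ^ 2) (‖x‖ ^ 2) := by
  have h := RCLike.hasSum_re 𝕜 (b.hasSum_inner_mul_inner x x)
  rw [inner_self_eq_norm_sq] at h
  refine h.congr_fun fun i => ?_
  rw [← inner_conj_symm x (b i), RCLike.conj_mul, ← RCLike.ofReal_pow, RCLike.ofReal_re]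

/-- A bounded family of scalars and a permutation of indices define a bounded operator. -/
theorem HilbertBasis.exists_weightedShift {ι X : Type*} [NormedAddCommGroup X]
    [InnerProductSpace 𝕜 X] [CompleteSpace X] (b : HilbertBasis ι 𝕜 X) {ρ : ι → ι}
    (hρ : Function.Injective ρ) {m : ι → 𝕜} {C : ℝ} (hC : 0 ≤ C) (hm : ∀ i, ‖m i‖ ≤ C) :
    ∃ T : X →L[𝕜] X, (∀ i x, inner 𝕜 (b i) (T x) = m i * inner 𝕜 (b (ρ i)) x) ∧ ‖T‖ ≤ C := by
  have hle : ∀ x i, ‖m i * inner 𝕜 (b (ρ i)) x‖ ^ 2 ≤ C ^ 2 * ‖inner 𝕜 (b (ρ i)) x‖ ^ 2 :=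
    fun x i => by
      rw [norm_mul, mul_pow]
      gcongr
      exact hm i
  have hs' : ∀ x, Summable fun i => C ^ 2 * ‖inner 𝕜 (b (ρ i)) x‖ ^ 2 := fun x =>
    (((hasSum_norm_sq b x).summable.comp_injective hρ)).mul_left _
  have hs : ∀ x, Summable fun i => ‖m i * inner 𝕜 (b (ρ i)) x‖ ^ 2 := fun x =>
    (hs' x).of_nonneg_of_le (fun i => by positivity) (hle x)
  have hmem : ∀ x, Memℓp (fun i => m i * inner 𝕜 (b (ρ i)) x) 2 := fun x =>
    (memℓp_gen_iff (by norm_num)).mpr (by simpa using hs x)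
  let T₀ : X →ₗ[𝕜] X :=
    { toFun := fun x => b.repr.symm ⟨_, hmem x⟩
      map_add' := fun x y => by
        rw [← map_add]; congr 1; ext i
        simp only [inner_add_right, mul_add]
        rfl
      map_smul' := fun r x => by
        rw [RingHom.id_apply, ← map_smul]; congr 1; ext i
        simp [inner_smul_right]; ring }
  have hT : ∀ i x, inner 𝕜 (b i) (T₀ x) = m i * inner 𝕜 (b (ρ i)) x := fun i x => by
    rw [← b.repr_apply_apply]
    simp [T₀]
  have hbd : ∀ x, ‖T₀ x‖ ≤ C * ‖x‖ := fun x => by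
    refine (sq_le_sq₀ (norm_nonneg _) (by positivity)).mp ?_
    rw [mul_pow, ← (hasSum_norm_sq b (T₀ x)).tsum_eq, ← (hasSum_norm_sq b x).tsum_eq, ← tsum_mul_left]
    simp only [hT]
    refine ((hs x).tsum_le_tsum (hle x) (hs' x)).trans ?_
    exact tsum_comp_le_tsum_of_inj ((hasSum_norm_sq b x).summable.mul_left (C ^ 2))
      (fun i => by positivity) hρ
  exact ⟨T₀.mkContinuous C hbd, hT, T₀.mkContinuous_norm_le hC hbd⟩

variable {α : ℝ}

/-- A 3 × 3 block is the sum of its three cyclic diagonals, and each diagonal is a bounded weight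
composed with a permutation of the basis indices. -/
theorem exists_blockOp (hα : 0 < α) {V : ℤ × ℕ → Matrix (Fin 3) (Fin 3) 𝕜} {C : ℝ}
    (hV : ∀ p m k, ‖V p m k‖ ≤ C) :
    ∃ W : H 𝕜 α →L[𝕜] H 𝕜 α, ∀ p m ψ, inner 𝕜 (basisVec 𝕜 hα (p, m)) (W ψ) =
      ∑ k, V p m k * inner 𝕜 (basisVec 𝕜 hα (p, k)) ψ := by
  have hC : 0 ≤ C := (norm_nonneg _).trans (hV (0, 0) 0 0)
  have h : ∀ d : Fin 3, _ := fun d =>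
    HilbertBasis.exists_weightedShift (basisH 𝕜 hα) (ρ := fun i => (i.1, i.2 + d))
      (fun i j hij => by
        simp only [Prod.mk.injEq, add_left_inj] at hij
        exact Prod.ext hij.1 hij.2)
      (m := fun i => V i.1 i.2 (i.2 + d)) hC (fun i => hV _ _ _)
  choose T hT _ using h
  refine ⟨∑ d, T d, fun p m ψ => ?_⟩
  rw [_root_.sum_apply, inner_sum]
  simp only [coe_basisH] at hT
  simp only [hT]
  exact Fintype.sum_equiv (Equiv.addLeft m) _ _ fun d => rfl

end coordinates

/-! ### Sectoriality -/

section sectorial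

/-- The graph is the set where R(zx - y) = x, an equation between continuous functions. -/
theorem isClosed_of_isResolvent {X : Type*} [NormedAddCommGroup X] [NormedSpace ℂ X]
    {A : X →ₗ.[ℂ] X} {z : ℂ} {R : X →L[ℂ] X} (h : IsResolvent A z R) : A.IsClosed := by
  have e : (A.graph : Set (X × X)) = {p | R (z • p.1 - p.2) = p.1} := by
    ext ⟨x, y⟩
    simp only [SetLike.mem_coe, Set.mem_ofPred_eq, LinearPMap.mem_graph_iff]
    constructor
    · rintro ⟨u, rfl, rfl⟩
      exact h.2 u
    · intro hxy
      obtain ⟨hd, hz⟩ := h.1 (z • x - y)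
      have hd' : x ∈ A.domain := by rwa [hxy] at hd
      refine ⟨⟨x, hd'⟩, rfl, ?_⟩
      have e : (⟨R (z • x - y), hd⟩ : A.domain) = ⟨x, hd'⟩ := Subtype.ext hxy
      rw [e, hxy] at hz
      exact sub_right_injective hz
  rw [LinearPMap.IsClosed, e]
  exact isClosed_eq (by fun_prop) continuous_fst

/-- The inverse comes from the Neumann series; its norm bound from T = 1 - N T. -/
theorem exists_inverse_one_add {X : Type*} [NormedAddCommGroup X] [NormedSpace ℂ X]
    [CompleteSpace X] {N : X →L[ℂ] X} (hN : ‖N‖ ≤ 1 / 2) :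
    ∃ T : X →L[ℂ] X, (∀ x, T x + N (T x) = x) ∧ (∀ x, T (x + N x) = x) ∧ ‖T‖ ≤ 2 := by
  let U := Units.oneSub (-N) (by rw [norm_neg]; linarith)
  have hU : (U : X →L[ℂ] X) = 1 + N := by simp [U]
  have h1 : (1 + N) * ((U⁻¹ : (X →L[ℂ] X)ˣ) : X →L[ℂ] X) = 1 := by rw [← hU]; exact U.mul_inv
  have h2 : ((U⁻¹ : (X →L[ℂ] X)ˣ) : X →L[ℂ] X) * (1 + N) = 1 := by rw [← hU]; exact U.inv_mul
  refine ⟨((U⁻¹ : (X →L[ℂ] X)ˣ) : X →L[ℂ] X), fun x => DFunLike.congr_fun h1 x,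
    fun x => DFunLike.congr_fun h2 x, ?_⟩
  generalize ((U⁻¹ : (X →L[ℂ] X)ˣ) : X →L[ℂ] X) = T at h1
  have h3 : T = 1 - N * T := by rw [← h1]; noncomm_ring
  have h4 : ‖T‖ ≤ 1 + ‖N‖ * ‖T‖ := calc
    ‖T‖ = ‖1 - N * T‖ := by rw [← h3]
    _ ≤ ‖(1 : X →L[ℂ] X)‖ + ‖N * T‖ := norm_sub_le _ _
    _ ≤ 1 + ‖N‖ * ‖T‖ := add_le_add ContinuousLinearMap.norm_id_le (norm_mul_le _ _)
  nlinarith [norm_nonneg T]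

/-- The angle condition means Re w ≤ ‖w‖/2, so ‖w - t‖² ≥ ‖w‖² - t‖w‖ + t², which dominates a
quarter of either square. -/
theorem le_norm_sub_of_arg {w : ℂ} (hw : Real.pi / 3 ≤ |w.arg|) {t : ℝ} (ht : 0 ≤ t) :
    ‖w‖ / 2 ≤ ‖w - t‖ ∧ t / 2 ≤ ‖w - t‖ := by
  have hre : w.re ≤ ‖w‖ / 2 := by
    rw [← Complex.norm_mul_cos_arg, ← Real.cos_abs]
    have := Real.cos_le_cos_of_nonneg_of_le_pi (by positivity) (Complex.abs_arg_le_pi w) hw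
    rw [Real.cos_pi_div_three] at this
    nlinarith [norm_nonneg w]
  have h : ‖w - t‖ ^ 2 = ‖w‖ ^ 2 - 2 * t * w.re + t ^ 2 := by
    rw [Complex.sq_norm, Complex.sq_norm, Complex.normSq_apply, Complex.normSq_apply]
    simp; ring
  have h' : 2 * t * w.re ≤ t * ‖w‖ := by nlinarith
  constructor <;> refine (sq_le_sq₀ (by positivity) (norm_nonneg _)).mp ?_ <;> rw [h]
  · nlinarith [sq_nonneg (‖w‖ - 2 * t), sq_nonneg ‖w‖]
  · nlinarith [sq_nonneg (2 * ‖w‖ - t), sq_nonneg t]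

/-- The coupling matrix of the lower order terms. -/
def couplingMatrix (σ η lam : ℝ) : Matrix (Fin 3) (Fin 3) ℝ :=
  !![0, σ * lam, -(σ * η); 1, 0, 0; 1, 0, 0]

theorem blockMatrix_eq (α σ τ η lam : ℝ) (p : ℤ × ℕ) :
    blockMatrix α σ τ η lam p = dirX α p • couplingMatrix σ η lam -
      gammaSq α p.1 (p.2 + 1) • Matrix.diagonal ![σ, 1, τ] := by
  ext m k
  fin_cases m <;> fin_cases k <;> simp [blockMatrix, couplingMatrix] <;> ring

/-- With -L = A - B and D = (z - A)⁻¹ the resolvent of -L is D(1 + BD)⁻¹. The coupling B is bounded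
since `dirX` is, and D is diagonal in the Fourier basis. -/
theorem isSectorial_neg_L {α : ℝ} (hα : 0 < α) {σ τ : ℝ} (hσ : 1 < σ) (hτ1 : τ < 1) (hτ0 : 0 < τ)
    (η lam : ℝ) : IsSectorial (-(L ℂ α σ τ η lam)) := by
  set d : Fin 3 → ℝ := ![σ, 1, τ] with hd
  have hdτ : ∀ m, τ ≤ d m := fun m => by fin_cases m <;> simp [hd] <;> linarith
  set a : (ℤ × ℕ) × Fin 3 → ℝ := fun i => gammaSq α i.1.1 (i.1.2 + 1) * d i.2 with ha
  have hg : ∀ p : ℤ × ℕ, 0 < gammaSq α p.1 (p.2 + 1) := fun p => gammaSq_pos α p.1 (by omega)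
  have haτ : ∀ i, gammaSq α i.1.1 (i.1.2 + 1) * τ ≤ a i := fun i =>
    mul_le_mul_of_nonneg_left (hdτ i.2) (hg i.1).le
  have ha0 : ∀ i, 0 < a i := fun i => (mul_pos (hg i.1) hτ0).trans_le (haτ i)
  obtain ⟨B, hB⟩ := exists_blockOp (𝕜 := ℂ) hα
    (V := fun p m k => ((dirX α p * couplingMatrix σ η lam m k : ℝ) : ℂ))
    (C := ∑ m, ∑ k, |couplingMatrix σ η lam m k|) fun p m k => by
      rw [Complex.norm_real, Real.norm_eq_abs, abs_mul]
      calc |dirX α p| * |couplingMatrix σ η lam m k| ≤ 1 * |couplingMatrix σ η lam m k| :=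
            mul_le_mul_of_nonneg_right (abs_dirX_le α p) (abs_nonneg _)
        _ = |couplingMatrix σ η lam m k| := one_mul _
        _ ≤ ∑ k, |couplingMatrix σ η lam m k| :=
            Finset.single_le_sum (fun k _ => abs_nonneg (couplingMatrix σ η lam m k))
              (Finset.mem_univ k)
        _ ≤ _ := Finset.single_le_sum
            (fun m _ => Finset.sum_nonneg fun k _ => abs_nonneg (couplingMatrix σ η lam m k))
              (Finset.mem_univ m)
  have hL : ∀ (ψ : H ℂ α) (h : ψ ∈ (L ℂ α σ τ η lam).domain) i,
      inner ℂ (basisVec ℂ hα i) (L ℂ α σ τ η lam ⟨ψ, h⟩) =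
        inner ℂ (basisVec ℂ hα i) (B ψ) - a i * inner ℂ (basisVec ℂ hα i) ψ := by
    rintro ψ h ⟨p, m⟩
    have e : ∀ k, ((blockMatrix α σ τ η lam p m k : ℝ) : ℂ) =
        ((dirX α p * couplingMatrix σ η lam m k : ℝ) : ℂ) - if m = k then (a (p, m) : ℂ) else 0 :=
      fun k => by
        rw [blockMatrix_eq, Matrix.sub_apply, Matrix.smul_apply, Matrix.smul_apply,
          Matrix.diagonal_apply, Complex.ofReal_sub]
        split_ifs <;> simp [ha, hd]
    rw [inner_basisVec_L hα h, hB]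
    simp only [RCLike.ofReal_eq_complex_ofReal, e, sub_mul, Finset.sum_sub_distrib, ite_mul,
      zero_mul, Finset.sum_ite_eq, Finset.mem_univ, if_true]
  -- The vertex is put at -K: the distance from z to the spectrum of A is then at least K/2, so ‖BD‖
  -- ≤ 2‖B‖/K ≤ 1/2; the summand 1 keeps K positive.
  set K : ℝ := 4 * ‖B‖ + 1 with hK
  have hK0 : 0 < K := by positivity
  have key : ∀ z : ℂ, z ≠ ((-K : ℝ) : ℂ) → Real.pi / 3 ≤ |(z - ((-K : ℝ) : ℂ)).arg| →
      ∃ R : H ℂ α →L[ℂ] H ℂ α, IsResolvent (-(L ℂ α σ τ η lam)) z R ∧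
        ‖R‖ ≤ 4 / ‖z - ((-K : ℝ) : ℂ)‖ := by
    intro z hz harg
    set w := z - ((-K : ℝ) : ℂ) with hw
    have hw0 : 0 < ‖w‖ := norm_pos_iff.mpr (sub_ne_zero.mpr hz)
    have hza : ∀ i, z - a i = w - ((K + a i : ℝ) : ℂ) := fun i => by rw [hw]; push_cast; ring
    have hle : ∀ i, ‖w‖ / 2 ≤ ‖z - a i‖ ∧ (K + a i) / 2 ≤ ‖z - a i‖ := fun i => by
      rw [hza]; exact le_norm_sub_of_arg harg (add_nonneg hK0.le (ha0 i).le)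
    have hpos : ∀ i, 0 < ‖z - a i‖ := fun i => (half_pos hw0).trans_le (hle i).1
    have hne : ∀ i, z - a i ≠ 0 := fun i => norm_pos_iff.mp (hpos i)
    -- Both bounds are needed: 2/‖w‖ gives the final decay of the resolvent, 2/K the smallness of
    -- BD.
    obtain ⟨D, hD, hDn⟩ := HilbertBasis.exists_weightedShift (basisH ℂ hα) Function.injective_id
      (m := fun i => (z - a i)⁻¹) (C := min (2 / ‖w‖) (2 / K)) (by positivity) fun i => by
        rw [norm_inv]
        refine le_min ?_ ?_
        · rw [← inv_div]; exact inv_anti₀ (half_pos hw0) (hle i).1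
        · rw [← inv_div]
          exact inv_anti₀ (half_pos hK0) (le_trans (by linarith [ha0 i]) (hle i).2)
    simp only [coe_basisH, id] at hD
    have hN : ‖B ∘L D‖ ≤ 1 / 2 := by
      refine (ContinuousLinearMap.opNorm_comp_le _ _).trans ?_
      have h1 : ‖B‖ * ‖D‖ ≤ ‖B‖ * (2 / K) :=
        mul_le_mul_of_nonneg_left (hDn.trans (min_le_right _ _)) (norm_nonneg B)
      refine h1.trans ?_
      rw [mul_div_assoc', div_le_div_iff₀ hK0 two_pos, hK]
      linarith
    obtain ⟨T, hT1, hT2, hTn⟩ := exists_inverse_one_add hN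
    -- The eigenvalues of A are at least τγ² and |z - a| ≥ a/2, so D gains a factor γ² up to the
    -- constant 2/τ, which is what regularity requires.
    have hdom : ∀ y, D y ∈ (L ℂ α σ τ η lam).domain := fun y => by
      refine mem_domain_of_summable hα σ τ η lam fun k => ?_
      have hs := ((HilbertBasis.hasSum_norm_sq (basisH ℂ hα) y).summable.mul_left
        ((2 / τ) ^ 2)).comp_injective (i := fun p : ℤ × ℕ => (p, k))
          fun p q h => (Prod.mk.inj h).1
      refine hs.of_nonneg_of_le (fun p => by positivity) fun p => ?_
      simp only [Function.comp, coe_basisH]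
      rw [← mul_pow, hD, norm_mul, norm_inv, ← mul_assoc]
      refine pow_le_pow_left₀ (by have := (hg p).le; positivity)
        (mul_le_mul_of_nonneg_right ?_ (norm_nonneg _)) 2
      rw [← div_eq_mul_inv, div_le_div_iff₀ (hpos _) hτ0]
      have := (hle (p, k)).2
      have := haτ (p, k)
      simp only at this
      linarith
    refine ⟨D ∘L T, ⟨fun x => ⟨hdom _, ?_⟩, fun x => ?_⟩, ?_⟩
    · refine ext_inner_basisVec hα fun i => ?_
      rw [LinearPMap.neg_apply, sub_neg_eq_add, inner_add_right, inner_smul_right]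
      simp only [ContinuousLinearMap.comp_apply]
      rw [hL, hD, ← hT1 x, inner_add_right, hT1 x]
      simp only [ContinuousLinearMap.comp_apply]
      linear_combination (inner ℂ (basisVec ℂ hα i) (T x)) * mul_inv_cancel₀ (hne i)
    · obtain ⟨ψ, h⟩ := x
      rw [LinearPMap.neg_apply, sub_neg_eq_add]
      change D (T (z • ψ + L ℂ α σ τ η lam ⟨ψ, h⟩)) = ψ
      set v := z • ψ + L ℂ α σ τ η lam ⟨ψ, h⟩ with hv
      have hDy : D (v - B ψ) = ψ := by
        refine ext_inner_basisVec hα fun i => ?_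
        rw [hD, inner_sub_right, hv, inner_add_right, inner_smul_right (basisVec ℂ hα i) ψ z, hL]
        linear_combination (inner ℂ (basisVec ℂ hα i) ψ) * inv_mul_cancel₀ (hne i)
      have hTv : T v = v - B ψ := by
        have := hT2 (v - B ψ)
        rwa [ContinuousLinearMap.comp_apply, hDy, sub_add_cancel] at this
      rw [hTv, hDy]
    · refine (ContinuousLinearMap.opNorm_comp_le _ _).trans ?_
      calc ‖D‖ * ‖T‖ ≤ 2 / ‖w‖ * 2 :=
            mul_le_mul (hDn.trans (min_le_left _ _)) hTn (norm_nonneg T) (by positivity)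
        _ = 4 / ‖w‖ := by ring
  refine ⟨?_, ?_, -K, Real.pi / 3, 4, by positivity, ?_, by norm_num, key⟩
  -- A single resolvent point suffices for closedness; -K-1 lies in the sector, at argument π.
  · obtain ⟨R, hR, -⟩ := key ((-K - 1 : ℝ) : ℂ)
      (fun h => by have := Complex.ofReal_injective h; linarith) (by
        have : (((-K - 1 : ℝ) : ℂ) - ((-K : ℝ) : ℂ)) = -1 := by push_cast; ring
        rw [this, Complex.arg_neg_one, abs_of_pos Real.pi_pos]
        linarith [Real.pi_pos])
    exact isClosed_of_isResolvent hR
  · have h1 : Submodule.span ℂ (Set.range (basisH ℂ hα)) ≤ (L ℂ α σ τ η lam).domain := by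
      refine Submodule.span_le.mpr ?_
      rintro _ ⟨⟨p, m⟩, rfl⟩
      rw [coe_basisH]
      rw [← blockVec_single]
      exact blockVec_mem_domain hα σ τ η lam p _
    have h2 := Submodule.dense_iff_topologicalClosure_eq_top.mpr (basisH ℂ hα).dense_span
    exact h2.mono h1
  · linarith [Real.pi_pos]

end sectorial

end DoubleDiffusive

end

noncomputable section

namespace DoubleDiffusive

/-! ### Eigenvectors of the blocks with large wave numbers -/

section asymptotics

/-- A simple zero at t = 0 is a sign change between two nearby points. The sign change persists for
small t, and the intermediate value theorem returns a zero in the prescribed neighbourhood. -/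
theorem eventually_exists_zero {h : ℝ × ℝ → ℝ} (hh : Continuous h) {g : ℝ → ℝ} (hg : Continuous g)
    {d : ℝ} (h0 : ∀ β, h (β, 0) = (β - d) * g β) (hd : 0 < g d) {W : Set ℝ} (hW : W ∈ 𝓝 d) :
    ∀ᶠ t in 𝓝 (0 : ℝ), ∃ β ∈ W, h (β, t) = 0 := by
  obtain ⟨ε, hε, hball⟩ := Metric.mem_nhds_iff.mp
    (inter_mem hW (hg.continuousAt.preimage_mem_nhds (Ioi_mem_nhds hd)))
  have hsub : ∀ x ∈ Icc (d - ε / 2) (d + ε / 2), x ∈ W ∩ g ⁻¹' Ioi 0 := fun x hx => hball <| by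
    rw [Metric.mem_ball, Real.dist_eq, abs_lt]
    constructor <;> linarith [hx.1, hx.2]
  have hl : h (d - ε / 2, 0) < 0 := by
    have := (hsub (d - ε / 2) ⟨le_rfl, by linarith⟩).2
    rw [h0]
    exact mul_neg_of_neg_of_pos (by linarith) this
  have hr : 0 < h (d + ε / 2, 0) := by
    have := (hsub (d + ε / 2) ⟨by linarith, le_rfl⟩).2
    rw [h0]
    exact mul_pos (by linarith) this
  have cl : Continuous fun t => h (d - ε / 2, t) := by fun_prop
  have cr : Continuous fun t => h (d + ε / 2, t) := by fun_prop
  filter_upwards [cl.continuousAt.preimage_mem_nhds (Iio_mem_nhds hl),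
    cr.continuousAt.preimage_mem_nhds (Ioi_mem_nhds hr)] with t h1 h2
  have hc : Continuous fun β => h (β, t) := by fun_prop
  obtain ⟨β, hβ, hz⟩ := intermediate_value_Icc (by linarith : d - ε / 2 ≤ d + ε / 2)
    hc.continuousOn (show (0 : ℝ) ∈ Icc _ _ from ⟨le_of_lt h1, le_of_lt h2⟩)
  exact ⟨β, (hsub β hβ).1, hz⟩

/-- The characteristic polynomial of `diag (-σ, -1, -τ) + t couplingMatrix`. -/
def scaledChar (σ τ η lam : ℝ) (q : ℝ × ℝ) : ℝ :=
  (q.1 + σ) * (q.1 + 1) * (q.1 + τ) -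
    q.2 ^ 2 * (σ * lam * (q.1 + τ) - σ * η * (q.1 + 1))

theorem continuous_scaledChar (σ τ η lam : ℝ) : Continuous (scaledChar σ τ η lam) := by
  unfold scaledChar; fun_prop

/-- Eigenvectors of `diag (-σ, -1, -τ) + t couplingMatrix` for the eigenvalues `β 0`, `β 1`, `β 2`
near `-σ`, `-1`, `-τ`, as columns. -/
def eigenMatrix (σ τ η lam : ℝ) (β : Fin 3 → ℝ) (t : ℝ) : Matrix (Fin 3) (Fin 3) ℝ :=
  !![1, t * (σ * lam) * (β 1 + τ) / ((β 1 + σ) * (β 1 + τ) + t ^ 2 * (σ * η)),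
      -(t * (σ * η) * (β 2 + 1)) / ((β 2 + σ) * (β 2 + 1) - t ^ 2 * (σ * lam));
    t / (β 0 + 1), 1, -(t ^ 2 * (σ * η)) / ((β 2 + σ) * (β 2 + 1) - t ^ 2 * (σ * lam));
    t / (β 0 + τ), t ^ 2 * (σ * lam) / ((β 1 + σ) * (β 1 + τ) + t ^ 2 * (σ * η)), 1]

/-- Since σ > 1 > τ, the diagonal matrix has simple spectrum. Its eigenvalues persist as real zeros
of the characteristic polynomial near -σ, -1, -τ, and explicit eigenvectors, normalized to have
diagonal entry 1, depend continuously on them and tend to the standard basis. -/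
theorem eventually_exists_eigenMatrix {σ τ : ℝ} (hσ : 1 < σ) (hτ1 : τ < 1) (η lam : ℝ)
    {U : Set (Matrix (Fin 3) (Fin 3) ℝ)} (hU : U ∈ 𝓝 1) :
    ∀ᶠ t in 𝓝 (0 : ℝ), ∃ V ∈ U, ∃ β : Fin 3 → ℝ, ∀ k,
      (t • couplingMatrix σ η lam - Matrix.diagonal ![σ, 1, τ]).mulVec (V.col k) =
        β k • V.col k := by
  set d : Fin 3 → ℝ := ![-σ, -1, -τ] with hd
  have hd0 : d 0 = -σ := rfl
  have hd1 : d 1 = -1 := rfl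
  have hd2 : d 2 = -τ := rfl
  have n1 : d 0 + 1 ≠ 0 := by rw [hd0]; linarith
  have n2 : d 0 + τ ≠ 0 := by rw [hd0]; linarith
  have n3 : (d 1 + σ) * (d 1 + τ) + (0 : ℝ) ^ 2 * (σ * η) ≠ 0 := by
    rw [hd1]; simp; constructor <;> intro h <;> linarith
  have n4 : (d 2 + σ) * (d 2 + 1) - (0 : ℝ) ^ 2 * (σ * lam) ≠ 0 := by
    rw [hd2]; simp; constructor <;> intro h <;> linarith
  have c : ∀ k : Fin 3, ContinuousAt (fun q : (Fin 3 → ℝ) × ℝ => q.1 k) (d, 0) := fun k => by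
    fun_prop
  have n5 : d 1 + τ ≠ 0 := by rw [hd1]; linarith
  have n6 : d 2 + 1 ≠ 0 := by rw [hd2]; linarith
  have hcont : ContinuousAt (fun q : (Fin 3 → ℝ) × ℝ => eigenMatrix σ τ η lam q.1 q.2) (d, 0) := by
    refine continuousAt_pi.mpr fun m => continuousAt_pi.mpr fun k => ?_
    fin_cases m <;> fin_cases k <;>
      simp only [eigenMatrix, Matrix.of_apply, Matrix.cons_val', Matrix.cons_val_zero,
        Matrix.cons_val_one, Matrix.cons_val, Fin.zero_eta, Fin.mk_one, Fin.reduceFinMk] <;>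
      first
        | exact continuousAt_const
        | (refine ContinuousAt.div (by fun_prop) (by fun_prop) ?_; assumption)
  have hval : eigenMatrix σ τ η lam d 0 = 1 := by
    ext m k
    fin_cases m <;> fin_cases k <;> simp [eigenMatrix]
  have ev : ∀ᶠ q : (Fin 3 → ℝ) × ℝ in 𝓝 (d, 0), eigenMatrix σ τ η lam q.1 q.2 ∈ U ∧
      q.1 0 + 1 ≠ 0 ∧ q.1 0 + τ ≠ 0 ∧ (q.1 1 + σ) * (q.1 1 + τ) + q.2 ^ 2 * (σ * η) ≠ 0 ∧
      (q.1 2 + σ) * (q.1 2 + 1) - q.2 ^ 2 * (σ * lam) ≠ 0 ∧ q.1 1 + τ ≠ 0 ∧ q.1 2 + 1 ≠ 0 := by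
    have hne : ∀ φ : (Fin 3 → ℝ) × ℝ → ℝ, Continuous φ → φ (d, 0) ≠ 0 →
        ∀ᶠ q in 𝓝 ((d, 0) : (Fin 3 → ℝ) × ℝ), φ q ≠ 0 := fun φ hφ h0 =>
      hφ.continuousAt.eventually_ne h0
    refine .and (hcont.eventually_mem (by rw [hval]; exact hU)) (.and ?_ (.and ?_ (.and ?_
      (.and ?_ (.and ?_ ?_)))))
    · exact hne _ (by fun_prop) n1
    · exact hne _ (by fun_prop) n2
    · exact hne _ (by fun_prop) n3
    · exact hne _ (by fun_prop) n4
    · exact hne _ (by fun_prop) n5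
    · exact hne _ (by fun_prop) n6
  rw [nhds_prod_eq] at ev
  obtain ⟨pa, ha, pb, hb, hab⟩ := Filter.eventually_prod_iff.mp ev
  rw [nhds_pi] at ha
  obtain ⟨I, -, W, hW, hWa⟩ := Filter.mem_pi.mp ha
  have hχ := continuous_scaledChar σ τ η lam
  have r0 := eventually_exists_zero hχ (g := fun β => (β + 1) * (β + τ)) (by fun_prop) (d := d 0)
    (fun β => by rw [hd0]; simp [scaledChar]; ring)
    (by rw [hd0]; exact mul_pos_of_neg_of_neg (by linarith) (by linarith)) (hW 0)
  -- At the middle eigenvalue the cubic decreases, so its negative is used to meet the sign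
  -- requirement on g.
  have r1 := eventually_exists_zero hχ.neg (g := fun β => -((β + σ) * (β + τ))) (by fun_prop)
    (d := d 1) (fun β => by rw [hd1]; simp [scaledChar]; ring)
    (by rw [hd1]; exact neg_pos.mpr (mul_neg_of_pos_of_neg (by linarith) (by linarith))) (hW 1)
  have r2 := eventually_exists_zero hχ (g := fun β => (β + σ) * (β + 1)) (by fun_prop) (d := d 2)
    (fun β => by rw [hd2]; simp [scaledChar]; ring)
    (by rw [hd2]; exact mul_pos (by linarith) (by linarith)) (hW 2)
  filter_upwards [hb, r0, r1, r2] with t ht h0 h1 h2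
  obtain ⟨β₀, hw0, h0⟩ := h0
  obtain ⟨β₁, hw1, h1⟩ := h1
  obtain ⟨β₂, hw2, h2⟩ := h2
  rw [Pi.neg_apply, neg_eq_zero] at h1
  simp only [scaledChar] at h0 h1 h2
  have hpa : pa ![β₀, β₁, β₂] := hWa fun k _ => by fin_cases k <;> assumption
  obtain ⟨hVU, m1, m2, m3, m4, m5, m6⟩ := hab hpa ht
  simp only [Matrix.cons_val_zero, Matrix.cons_val_one, Matrix.cons_val] at m1 m2 m3 m4 m5 m6
  refine ⟨_, hVU, ![β₀, β₁, β₂], fun k => ?_⟩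
  have e : ∀ x : Fin 3 → ℝ, (t • couplingMatrix σ η lam - Matrix.diagonal ![σ, 1, τ]).mulVec x =
      ![-(σ * x 0) + t * (σ * lam * x 1 - σ * η * x 2), t * x 0 - x 1, t * x 0 - τ * x 2] := by
    intro x
    funext m
    fin_cases m <;> simp [couplingMatrix, Matrix.mulVec, dotProduct, Fin.sum_univ_three] <;> ring
  rw [e]
  funext m
  generalize hP : (β₁ + σ) * (β₁ + τ) + t ^ 2 * (σ * η) = P at m3
  generalize hQ : (β₂ + σ) * (β₂ + 1) - t ^ 2 * (σ * lam) = Q at m4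
  -- Each column was found by solving two of the three rows; the remaining row is the characteristic
  -- equation for its eigenvalue, which is where the three zeros are used.
  fin_cases k <;> fin_cases m <;> simp [eigenMatrix, hP, hQ] <;> field_simp
  · linear_combination -h0
  · ring
  · ring
  · linear_combination -(t * lam) * hP
  · linear_combination -h1 + (β₁ + 1) * hP
  · ring
  · linear_combination t * η * hQ
  · ring
  · linear_combination -h2 + (β₂ + τ) * hQ

end asymptotics

end DoubleDiffusive

end

noncomputable section

namespace DoubleDiffusive

/-! ### The basis of root vectors -/

section rootBasis

/-- Only finitely many wave vectors lie in a given disc. Together with |`dirX`| ≤ 1 this makes the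
effective coupling dirX/γ² tend to 0. -/
theorem tendsto_gammaSq {α : ℝ} (hα : 0 < α) :
    Tendsto (fun p : ℤ × ℕ => gammaSq α p.1 (p.2 + 1)) cofinite atTop := by
  refine Filter.tendsto_atTop.mpr fun R => ?_
  obtain ⟨N, hN⟩ := exists_nat_ge (max (R / α ^ 2) R)
  refine Set.Finite.subset ((Set.finite_Icc (-(N : ℤ)) N).prod (Set.finite_Iic N)) ?_
  rintro ⟨n, l⟩ h
  have h : gammaSq α n (l + 1) < R := not_le.mp h
  have h1 : (n : ℝ) ^ 2 * α ^ 2 ≤ R := by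
    have : (0 : ℝ) ≤ ((l + 1 : ℕ) : ℝ) ^ 2 * Real.pi ^ 2 := by positivity
    rw [gammaSq] at h; linarith
  have h2 : (n : ℝ) ^ 2 ≤ N :=
    ((le_div_iff₀ (by positivity)).mpr h1).trans ((le_max_left _ _).trans hN)
  have h3 : n ^ 2 ≤ (N : ℤ) := by exact_mod_cast h2
  have h4 : ((l + 1 : ℕ) : ℝ) ≤ N := by
    refine le_trans ?_ ((le_max_right _ _).trans hN)
    refine le_trans ?_ ((gammaSq_ge α n (l + 1)).trans h.le)
    have e1 : (1 : ℝ) ≤ ((l + 1 : ℕ) : ℝ) := by exact_mod_cast Nat.le_add_left 1 l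
    have e2 : (1 : ℝ) ≤ Real.pi ^ 2 := one_le_pow₀ (by linarith [Real.pi_gt_three])
    nlinarith
  have h5 : l + 1 ≤ N := by exact_mod_cast h4
  refine ⟨⟨?_, ?_⟩, ?_⟩
  · simp only; nlinarith [Int.le_self_sq (-n)]
  · simp only; exact (Int.le_self_sq n).trans h3
  · simp only [Set.mem_Iic]; omega

theorem tendsto_dirX_div_gammaSq {α : ℝ} (hα : 0 < α) :
    Tendsto (fun p : ℤ × ℕ => dirX α p / gammaSq α p.1 (p.2 + 1)) cofinite (𝓝 0) := by
  refine squeeze_zero_norm (fun p => ?_) (tendsto_gammaSq hα).inv_tendsto_atTop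
  have hg := gammaSq_pos α p.1 (l := p.2 + 1) (by omega)
  rw [norm_div, Real.norm_eq_abs, Real.norm_eq_abs, abs_of_pos hg, Pi.inv_apply, ← one_div]
  exact div_le_div_of_nonneg_right (abs_dirX_le α p) hg.le

theorem mem_rootSet_of_eigenvector {α σ τ η lam : ℝ} {p : ℤ × ℕ} {v : Fin 3 → ℝ} (hv : v ≠ 0)
    {β : ℝ} (h : (blockMatrix α σ τ η lam p).mulVec v = β • v) : v ∈ rootSet α σ τ η lam p := by
  have h1 : (shiftedBlock α σ τ η lam p β ^ 1).mulVec (fun i => (v i : ℂ)) = 0 := by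
    rw [pow_one, shiftedBlock, Matrix.sub_mulVec, Matrix.smul_mulVec, Matrix.one_mulVec, sub_eq_zero]
    funext m
    have := congrArg (fun r : ℝ => (r : ℂ)) (congrFun h m)
    simpa [Matrix.mulVec, dotProduct] using this
  refine ⟨fun i => (v i : ℂ), β, 1, f_eq_zero_of_mulVec _ _ _ _ _ _ _ (fun h0 => hv ?_) h1, h1,
    Or.inl ?_⟩
  · funext i
    simpa using congrFun h0 i
  · funext i; simp

/-- Used for the finitely many blocks outside the perturbative regime, where eigenvalues may be
complex or multiple. -/
theorem exists_matrix_of_rootSet (α σ τ η lam : ℝ) (p : ℤ × ℕ) :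
    ∃ V : Matrix (Fin 3) (Fin 3) ℝ, IsUnit V ∧ ∀ k, V.col k ∈ rootSet α σ τ η lam p := by
  have h := Submodule.exists_fun_fin_finrank_span_eq ℝ (rootSet α σ τ η lam p)
  rw [span_rootSet, finrank_top, Module.finrank_fin_fun] at h
  obtain ⟨v, hv, -, hli⟩ := h
  refine ⟨Matrix.of fun m k => v k m, ?_, fun k => hv k⟩
  rw [← Matrix.linearIndependent_cols_iff_isUnit]
  exact hli

theorem exists_bound_of_eventually_cofinite {ι : Type*} {φ : ι → ℝ} {C : ℝ}
    (h : ∀ᶠ i in cofinite, φ i ≤ C) : ∃ C', ∀ i, φ i ≤ C' := by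
  obtain ⟨M, hM⟩ := (Set.Finite.image φ (Filter.eventually_cofinite.mp h)).bddAbove
  refine ⟨max C M, fun i => ?_⟩
  by_cases hi : φ i ≤ C
  · exact le_max_of_le_left hi
  · exact le_max_of_le_right (hM ⟨i, hi, rfl⟩)

/-- Matrices of root vectors, uniformly bounded together with their inverses. -/
theorem exists_bounded_rootMatrix {α : ℝ} (hα : 0 < α) {σ τ : ℝ} (hσ : 1 < σ) (hτ1 : τ < 1)
    (η lam : ℝ) :
    ∃ (V V' : ℤ × ℕ → Matrix (Fin 3) (Fin 3) ℝ) (C : ℝ),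
      (∀ p, V p * V' p = 1) ∧ (∀ p, V' p * V p = 1) ∧
      (∀ p k, (V p).col k ∈ rootSet α σ τ η lam p) ∧
      (∀ p m k, ‖V p m k‖ ≤ C) ∧ ∀ p m k, ‖V' p m k‖ ≤ C := by
  -- The inverse is written as adjugate over determinant because this expression is visibly
  -- continuous at the identity.
  let N : Matrix (Fin 3) (Fin 3) ℝ → ℝ := fun V =>
    ∑ m, ∑ k, (‖V m k‖ + ‖(V.det⁻¹ • V.adjugate) m k‖)
  have hdet : Continuous fun V : Matrix (Fin 3) (Fin 3) ℝ => V.det := continuous_id.matrix_det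
  have hadj : Continuous fun V : Matrix (Fin 3) (Fin 3) ℝ => V.adjugate :=
    continuous_id.matrix_adjugate
  have hN : ContinuousAt N 1 := by
    refine tendsto_finsetSum _ fun m _ => tendsto_finsetSum _ fun k _ => ?_
    have h1 : ContinuousAt (fun V : Matrix (Fin 3) (Fin 3) ℝ => V.det⁻¹ • V.adjugate) 1 :=
      (hdet.continuousAt.inv₀ (by simp)).smul hadj.continuousAt
    have h2 : ContinuousAt (fun V : Matrix (Fin 3) (Fin 3) ℝ => (V.det⁻¹ • V.adjugate) m k) 1 :=
      continuousAt_pi.mp (continuousAt_pi.mp h1 m) k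
    exact ((continuous_apply_apply m k).continuousAt.norm).add h2.norm
  have hU : {V : Matrix (Fin 3) (Fin 3) ℝ | V.det ≠ 0 ∧ N V < N 1 + 1} ∈ 𝓝 1 :=
    inter_mem (hdet.continuousAt.eventually_ne (by simp))
      (hN.eventually_lt continuousAt_const (by simp))
  have hev : ∀ᶠ p : ℤ × ℕ in cofinite, ∃ V : Matrix (Fin 3) (Fin 3) ℝ, IsUnit V ∧
      (∀ k, V.col k ∈ rootSet α σ τ η lam p) ∧ N V ≤ N 1 + 1 := by
    filter_upwards [(tendsto_dirX_div_gammaSq hα).eventually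
      (eventually_exists_eigenMatrix hσ hτ1 η lam hU)] with p hp
    obtain ⟨V, ⟨hV, hVN⟩, β, hβ⟩ := hp
    refine ⟨V, (Matrix.isUnit_iff_isUnit_det V).mpr hV.isUnit, fun k => ?_, hVN.le⟩
    have hg := (gammaSq_pos α p.1 (l := p.2 + 1) (by omega)).ne'
    refine mem_rootSet_of_eigenvector (β := gammaSq α p.1 (p.2 + 1) * β k)
      (fun h0 => hV (Matrix.det_eq_zero_of_column_eq_zero k fun m => congrFun h0 m)) ?_
    have e : blockMatrix α σ τ η lam p = gammaSq α p.1 (p.2 + 1) •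
        ((dirX α p / gammaSq α p.1 (p.2 + 1)) • couplingMatrix σ η lam -
          Matrix.diagonal ![σ, 1, τ]) := by
      rw [blockMatrix_eq, smul_sub, smul_smul, mul_div_cancel₀ _ hg]
    rw [e, Matrix.smul_mulVec, hβ, smul_smul]
  -- The implication makes the choice pick a bounded matrix whenever one exists, so the bound can
  -- fail only at the finitely many exceptional p.
  have hall : ∀ p : ℤ × ℕ, ∃ V : Matrix (Fin 3) (Fin 3) ℝ, IsUnit V ∧
      (∀ k, V.col k ∈ rootSet α σ τ η lam p) ∧
      ((∃ V : Matrix (Fin 3) (Fin 3) ℝ, IsUnit V ∧ (∀ k, V.col k ∈ rootSet α σ τ η lam p) ∧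
        N V ≤ N 1 + 1) → N V ≤ N 1 + 1) := by
    intro p
    by_cases h : ∃ V : Matrix (Fin 3) (Fin 3) ℝ, IsUnit V ∧
        (∀ k, V.col k ∈ rootSet α σ τ η lam p) ∧ N V ≤ N 1 + 1
    · obtain ⟨V, h1, h2, h3⟩ := h
      exact ⟨V, h1, h2, fun _ => h3⟩
    · obtain ⟨V, h1, h2⟩ := exists_matrix_of_rootSet α σ τ η lam p
      exact ⟨V, h1, h2, fun h' => absurd h' h⟩
  choose V hunit hcol hbd using hall
  obtain ⟨C, hC⟩ := exists_bound_of_eventually_cofinite (hev.mono fun p hp => hbd p hp)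
  have hle : ∀ p m k, ‖V p m k‖ + ‖((V p).det⁻¹ • (V p).adjugate) m k‖ ≤ C := fun p m k => by
    refine le_trans ?_ (hC p)
    refine le_trans ?_ (Finset.single_le_sum (f := fun m => ∑ k, (‖V p m k‖ +
      ‖((V p).det⁻¹ • (V p).adjugate) m k‖)) (fun m _ => by positivity) (Finset.mem_univ m))
    exact Finset.single_le_sum (f := fun k => ‖V p m k‖ + ‖((V p).det⁻¹ • (V p).adjugate) m k‖)
      (fun k _ => by positivity) (Finset.mem_univ k)
  have hinv : ∀ p, (V p).det⁻¹ • (V p).adjugate = (V p)⁻¹ := fun p => by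
    rw [Matrix.inv_def, Ring.inverse_eq_inv']
  have hdu : ∀ p, IsUnit (V p).det := fun p => (Matrix.isUnit_iff_isUnit_det _).mp (hunit p)
  refine ⟨V, fun p => (V p)⁻¹, C, fun p => Matrix.mul_nonsing_inv _ (hdu p),
    fun p => Matrix.nonsing_inv_mul _ (hdu p), hcol,
    fun p m k => (le_add_of_nonneg_right (norm_nonneg _)).trans (hle p m k), fun p m k => ?_⟩
  change ‖(V p)⁻¹ m k‖ ≤ C
  rw [← hinv]
  exact (le_add_of_nonneg_left (norm_nonneg _)).trans (hle p m k)

/-- A bounded invertible block operator maps the Fourier basis to an unconditional basis. -/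
theorem existsUnique_hasSum_blockVec {α : ℝ} (hα : 0 < α)
    {V V' : ℤ × ℕ → Matrix (Fin 3) (Fin 3) ℝ} {C : ℝ} (h1 : ∀ p, V p * V' p = 1)
    (h2 : ∀ p, V' p * V p = 1) (hV : ∀ p m k, ‖V p m k‖ ≤ C) (hV' : ∀ p m k, ‖V' p m k‖ ≤ C)
    (ψ : H ℝ α) :
    ∃! c : (ℤ × ℕ) × Fin 3 → ℝ,
      HasSum (fun i => c i • blockVec ℝ hα i.1 ((V i.1).col i.2)) ψ := by
  obtain ⟨W, hW⟩ := exists_blockOp hα hV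
  obtain ⟨W', hW'⟩ := exists_blockOp hα hV'
  have comp : ∀ {A A' : ℤ × ℕ → Matrix (Fin 3) (Fin 3) ℝ} {T T' : H ℝ α →L[ℝ] H ℝ α}
      (_ : ∀ p, A p * A' p = 1)
      (_ : ∀ p m ψ, inner ℝ (basisVec ℝ hα (p, m)) (T ψ) =
        ∑ k, A p m k * inner ℝ (basisVec ℝ hα (p, k)) ψ)
      (_ : ∀ p m ψ, inner ℝ (basisVec ℝ hα (p, m)) (T' ψ) =
        ∑ k, A' p m k * inner ℝ (basisVec ℝ hα (p, k)) ψ) (χ : H ℝ α), T (T' χ) = χ := by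
    intro A A' T T' hA hT hT' χ
    refine ext_inner_basisVec hα ?_
    rintro ⟨p, m⟩
    rw [hT]
    simp only [hT']
    have := Matrix.mulVec_mulVec (fun k => inner ℝ (basisVec ℝ hα (p, k)) χ) (A p) (A' p)
    rw [hA, Matrix.one_mulVec] at this
    exact congrFun this m
  -- W carries the orthonormal basis to the root vectors. Existence is the Fourier expansion of W′ψ
  -- mapped by W; uniqueness is W′ applied to a given expansion.
  have hWb : ∀ i : (ℤ × ℕ) × Fin 3,
      W (basisVec ℝ hα i) = blockVec ℝ hα i.1 ((V i.1).col i.2) := by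
    rintro ⟨q, k⟩
    refine ext_inner_basisVec hα ?_
    rintro ⟨p, m⟩
    rw [hW, inner_blockVec]
    simp only [orthonormal_iff_ite.mp (orthonormal_basisVec (𝕜 := ℝ) hα)]
    by_cases h : p = q
    · subst h; simp
    · simp [h]
  have hsum : ∀ χ : H ℝ α, HasSum (fun i => inner ℝ (basisVec ℝ hα i) χ • basisVec ℝ hα i) χ :=
    fun χ => by
      have := (basisH ℝ hα).hasSum_repr χ
      simpa [HilbertBasis.repr_apply_apply] using this
  refine ⟨fun i => inner ℝ (basisVec ℝ hα i) (W' ψ), ?_, fun c hc => ?_⟩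
  · have := (hsum (W' ψ)).mapL W
    rw [comp h1 hW hW'] at this
    simpa only [map_smul, hWb] using this
  · funext i
    have h3 := hc.mapL W'
    simp only [map_smul, ← hWb, comp h2 hW' hW] at h3
    have h4 := h3.mapL (innerSL ℝ (basisVec ℝ hα i))
    refine HasSum.unique ?_ h4
    have ho := orthonormal_iff_ite.mp (orthonormal_basisVec (𝕜 := ℝ) hα)
    convert hasSum_single i fun i' hi' => ?_
    · rw [innerSL_apply_apply, inner_smul_right (basisVec ℝ hα i) (basisVec ℝ hα i) (c i), ho]
      simp
    · rw [innerSL_apply_apply, inner_smul_right (basisVec ℝ hα i) (basisVec ℝ hα i') (c i'), ho]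
      simp [hi'.symm]

end rootBasis

/-- The Fourier modes `(j, l)` with `j ∈ ℤ` grouped by `|j|`. -/
theorem exists_indexEquiv :
    ∃ e : (Σ p : ℕ × ℕ, Fin (if p.1 = 0 then 3 else 6)) ≃ (ℤ × ℕ) × Fin 3,
      ∀ i, (e i).1.1.natAbs = i.1.1 ∧ (e i).1.2 = i.1.2 := by
  have h : ∀ j : ℕ, Nonempty (Fin (if j = 0 then 3 else 6) ≃ {n : ℤ // n.natAbs = j} × Fin 3) := by
    intro j
    let _ : Fintype {n : ℤ // n.natAbs = j} :=
      Fintype.subtype {(j : ℤ), -(j : ℤ)} fun n => by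
        rw [Finset.mem_insert, Finset.mem_singleton]; omega
    refine ⟨(Fintype.equivFinOfCardEq ?_).symm⟩
    rw [Fintype.card_prod, Fintype.card_fin, Fintype.subtype_card]
    split_ifs with hj
    · simp [hj]
    · rw [Finset.card_pair (by omega)]
  obtain ⟨e⟩ := Classical.nonempty_pi.mpr h
  refine ⟨⟨fun i => (((e i.1.1 i.2).1.1, i.1.2), (e i.1.1 i.2).2),
    fun y => ⟨(y.1.1.natAbs, y.1.2), (e _).symm (⟨y.1.1, rfl⟩, y.2)⟩, ?_, ?_⟩,
    fun i => ⟨(e i.1.1 i.2).1.2, rfl⟩⟩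
  · rintro ⟨⟨j, l⟩, x⟩
    -- The claim is stated for arbitrary y so that j can be replaced by |n|; for the specific image
    -- under the equivalence this substitution is blocked.
    have key : ∀ y : {n : ℤ // n.natAbs = j} × Fin 3,
        (⟨(y.1.1.natAbs, l), (e _).symm (⟨y.1.1, rfl⟩, y.2)⟩ :
          Σ p : ℕ × ℕ, Fin (if p.1 = 0 then 3 else 6)) = ⟨(j, l), (e j).symm y⟩ := by
      rintro ⟨⟨n, rfl⟩, k⟩
      rfl
    exact (key (e j x)).trans (by rw [Equiv.symm_apply_apply])
  · rintro ⟨⟨n, l⟩, k⟩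
    simp

theorem exists_basis_of_rootVectors {α : ℝ} (hα : 0 < α) {σ τ : ℝ} (hσ : 1 < σ) (hτ1 : τ < 1)
    (η lam : ℝ) :
    ∃ b : (Σ p : ℕ × ℕ, Fin (if p.1 = 0 then 3 else 6)) → H ℝ α,
      (∀ i, IsRootVector α σ τ η lam (i.1.1 : ℤ) (i.1.2 + 1) (b i)) ∧
      ∀ ψ : H ℝ α, ∃! c : (Σ p : ℕ × ℕ, Fin (if p.1 = 0 then 3 else 6)) → ℝ,
        HasSum (fun i => c i • b i) ψ := by
  obtain ⟨V, V', C, h1, h2, hcol, hV, hV'⟩ := exists_bounded_rootMatrix hα hσ hτ1 η lam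
  obtain ⟨e, he⟩ := exists_indexEquiv
  refine ⟨fun i => blockVec ℝ hα (e i).1 ((V (e i).1).col (e i).2), fun i => ?_, fun ψ => ?_⟩
  · rw [← (he i).2]
    exact isRootVector_blockVec hα (by rw [(he i).1, Int.natAbs_natCast]) (hcol _ _)
  · obtain ⟨c, hc, huniq⟩ := existsUnique_hasSum_blockVec hα h1 h2 hV hV' ψ
    refine ⟨fun i => c (e i), e.hasSum_iff.mpr hc, fun c' hc' => ?_⟩
    have h3 := huniq (fun i => c' (e.symm i)) (e.hasSum_iff.mp (by
      simpa [Function.comp_def] using hc'))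
    funext i
    have := congrFun h3 (e i)
    simpa using this

end DoubleDiffusive

end
-- Assembly of the four assertions
theorem mainTheorem4 (α σ τ η : ℝ) (hα : 0 < α) (hα2 : α ^ 2 = Real.pi ^ 2 / 2)
    (hσ : 1 < σ) (hτ1 : τ < 1) (hτ0 : 0 < τ) (hη0 : 0 < η)
    (hη : η < DoubleDiffusive.etaC σ τ) :
    ∃ δ > 0, ∀ lam : ℝ, |lam - DoubleDiffusive.lamC τ η| < δ →
      -- the eigenvectors and generalized eigenvectors span the Fourier blocks
      (∀ (j : ℤ) (l : ℕ), 1 ≤ l →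
        DoubleDiffusive.rootSpace α σ τ η lam j l = DoubleDiffusive.E ℝ α j l) ∧
      -- together they give a basis of `H`, with 3 vectors in each block with `j = 0` and 6
      -- vectors in each block with `j ≥ 1`
      (∃ b : (Σ p : ℕ × ℕ, Fin (if p.1 = 0 then 3 else 6)) → DoubleDiffusive.H ℝ α,
        (∀ i, DoubleDiffusive.IsRootVector α σ τ η lam (i.1.1 : ℤ) (i.1.2 + 1) (b i)) ∧
        ∀ ψ : DoubleDiffusive.H ℝ α,
          ∃! c : (Σ p : ℕ × ℕ, Fin (if p.1 = 0 then 3 else 6)) → ℝ,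
            HasSum (fun i => c i • b i) ψ) ∧
      -- each block is invariant under `L`
      (∀ (j : ℤ) (l : ℕ), 1 ≤ l → ∀ x ∈ DoubleDiffusive.E ℝ α j l,
        ∃ h : x ∈ (DoubleDiffusive.L ℝ α σ τ η lam).domain,
          DoubleDiffusive.L ℝ α σ τ η lam ⟨x, h⟩ ∈ DoubleDiffusive.E ℝ α j l) ∧
      -- below the critical value the restriction of `L` to each block is negative definite:
      -- its eigenvalues have negative real parts, and its quadratic form is negative definite
      -- with respect to an inner product on the block
      (lam < DoubleDiffusive.lamC τ η → ∀ (j : ℤ) (l : ℕ), 1 ≤ l →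
        (∀ (β : ℂ) (ψ : DoubleDiffusive.H ℂ α) (h : ψ ∈ (DoubleDiffusive.L ℂ α σ τ η lam).domain),
          ψ ∈ DoubleDiffusive.E ℂ α j l → ψ ≠ 0 →
          DoubleDiffusive.L ℂ α σ τ η lam ⟨ψ, h⟩ = β • ψ → β.re < 0) ∧
        ∃ Q : LinearMap.BilinForm ℝ (DoubleDiffusive.H ℝ α),
          (∀ x y, Q x y = Q y x) ∧
          (∀ x ∈ DoubleDiffusive.E ℝ α j l, x ≠ 0 → 0 < Q x x) ∧
          ∀ (x : DoubleDiffusive.H ℝ α) (h : x ∈ (DoubleDiffusive.L ℝ α σ τ η lam).domain),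
            x ∈ DoubleDiffusive.E ℝ α j l → x ≠ 0 →
            Q (DoubleDiffusive.L ℝ α σ τ η lam ⟨x, h⟩) x < 0) ∧
      -- `-L` is sectorial
      DoubleDiffusive.IsSectorial (-(DoubleDiffusive.L ℂ α σ τ η lam)) := by
  -- Any δ works: spanning, the basis, invariance and sectoriality hold for every real λ, and
  -- negativity uses only λ < λ_c.
  refine ⟨1, one_pos, fun lam _ => ⟨fun j l hl => ?_,
    DoubleDiffusive.exists_basis_of_rootVectors hα hσ hτ1 η lam, fun j l hl x hx => ?_,
    fun hlam j l hl => ?_, DoubleDiffusive.isSectorial_neg_L hα hσ hτ1 hτ0 η lam⟩⟩ <;>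
    obtain ⟨l, rfl⟩ := Nat.exists_eq_add_of_le' hl
  · exact DoubleDiffusive.rootSpace_eq_E hα σ τ η lam j l
  · have h := DoubleDiffusive.mem_domain_of_mem_E hα σ τ η lam hx
    exact ⟨h, DoubleDiffusive.L_mem_E hα hx h⟩
  · exact ⟨fun β ψ h hE h0 hL =>
      DoubleDiffusive.re_neg_of_eigenvalue hα hσ hτ1 hτ0 hη hlam h hE h0 hL,
      DoubleDiffusive.exists_bilinForm_neg hα hσ hτ1 hτ0 hη hlam j l⟩
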